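/- Let $d\ge 1$ be an integer, $\mathbb{S}^d\subset\mathbb{R}^{d+1}$ the unit sphere, $\sigma_d$ its normalized surface area measure, $0<s<d$ and $q>0$. For a positive Borel measure $\mu$ put $U_s^\mu(x)=\int|x-y|^{-s}\,d\mu(y)$ and $\mathcal I_s[\mu]=\iint|x-y|^{-s}\,d\mu(x)\,d\mu(y)$; let $W_s(\mathbb{S}^d)$ be the infimum of $\mathcal I_s[\mu]$ over all Borel probability measures $\mu$ on $\mathbb{S}^d$. For $0\le R<1$ let $a=(0,\dots,0,R)$ and $Q_R(x)=q/|x-a|^s$. A signed $s$-equilibrium on $\mathbb{S}^d$ associated with $Q_R$ is a (finite) signed Borel measure $\eta$ on $\mathbb{S}^d$ with $\eta(\mathbb{S}^d)=1$ whose weighted potential $U_s^\eta+Q_R$ is (well defined, finite and) constant everywhere on $\mathbb{S}^d$. An $s$-extremal measure on $\mathbb{S}^d$ associated with $Q_R$ is a Borel probability measure $\mu$ on $\mathbb{S}^d$ that minimizes $\mathcal I_s[\mu]+2\int Q_R\,d\mu$ among all such measures. Define the Gonchar function of the second kind by $$G(d,s,q;R)=\frac{W_s(\mathbb{S}^d)}{q}(1-R)^d-(1+R)^{d-s}+(1-R)^d\,U_s^{\sigma_d}(a),\qquad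 0\le R<1 .$$ Then: 1. $G(d,s,q;\cdot)$ has exactly one zero $R_q$ in $(0,1)$. 2. For every $R\in[0,1)$ there is a unique signed $s$-equilibrium $\eta_{Q_R}$ on $\mathbb{S}^d$ associated with $Q_R$. It is a positive measure if and only if $0\le R\le R_q$, and in that case its support is all of $\mathbb{S}^d$. 3. If $s=d-1-2m$ for a non-negative integer $m$, then $G(d,s,q;\cdot)$ is (the restriction to $[0,1)$ of) a polynomial in $R$. 4. The solution of Gonchar's problem for interior sources is $1-R_q$: this is the smallest distance from the point charge at $a$, $0\le R<1$, to $\mathbb{S}^d$ for which there is an $s$-extremal measure on $\mathbb{S}^d$ associated with $Q_R$ whose support is the entire sphere. The distance $1$ (that is, $R=0$) also has this property (the trivial solution). -/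

import Mathlib

open MeasureTheory Set
open scoped ENNReal

noncomputable section

namespace Riesz

/-- Euclidean space `ℝ^p`. -/
abbrev Space (p : ℕ) : Type := EuclideanSpace ℝ (Fin p)

/-- The unit sphere `S^d` in `ℝ^(d+1)`. -/
def unitSphere (d : ℕ) : Set (Space (d + 1)) := Metric.sphere 0 1

/-- The normalized surface area measure `σ_d` on `S^d`, as a Borel measure on `ℝ^(d+1)`. -/
def sigma (d : ℕ) : Measure (Space (d + 1)) :=
  Measure.map Subtype.val
    (((volume : Measure (Space (d + 1))).toSphere univ)⁻¹ •
      (volume : Measure (Space (d + 1))).toSphere)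

/-- The class `M(A)` of unit positive Borel measures supported on `A`. -/
def unitMeasures {p : ℕ} (A : Set (Space p)) : Set (Measure (Space p)) :=
  {μ | IsProbabilityMeasure μ ∧ μ Aᶜ = 0}

/-- The Riesz `s`-potential `U_s^μ(x) = ∫ |x - y|^(-s) dμ(y)` of a positive measure; the kernel is
`∞` on the diagonal (for `s > 0`). -/
def potential {p : ℕ} (s : ℝ) (μ : Measure (Space p)) (x : Space p) : ℝ≥0∞ :=
  ∫⁻ y, edist x y ^ (-s) ∂μ

/-- The Riesz `s`-energy `I_s[μ] = ∫ ∫ |x - y|^(-s) dμ(x) dμ(y)`. -/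
def energy {p : ℕ} (s : ℝ) (μ : Measure (Space p)) : ℝ≥0∞ :=
  ∫⁻ x, ∫⁻ y, edist x y ^ (-s) ∂μ ∂μ

/-- The Riesz `s`-energy `W_s(A)` of a set `A`. -/
def wienerEnergy {p : ℕ} (s : ℝ) (A : Set (Space p)) : ℝ≥0∞ :=
  ⨅ μ ∈ unitMeasures A, energy s μ

/-- The weighted `s`-energy `I_Q[μ] = I_s[μ] + 2 ∫ Q dμ`. -/
def weightedEnergy {p : ℕ} (s : ℝ) (Q : Space p → ℝ) (μ : Measure (Space p)) : EReal :=
  (energy s μ : EReal) + ((2 * ∫ x, Q x ∂μ : ℝ) : EReal)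

/-- The extremal value `V_Q(A)` of the weighted `s`-energy. -/
def extremalValue {p : ℕ} (s : ℝ) (A : Set (Space p)) (Q : Space p → ℝ) : EReal :=
  ⨅ μ ∈ unitMeasures A, weightedEnergy s Q μ

/-- `μ` is an `s`-extremal (positive equilibrium) measure on `A` associated with `Q`. -/
def IsExtremal {p : ℕ} (s : ℝ) (A : Set (Space p)) (Q : Space p → ℝ)
    (μ : Measure (Space p)) : Prop :=
  μ ∈ unitMeasures A ∧ weightedEnergy s Q μ = extremalValue s A Q

/-- `η` is a signed `s`-equilibrium on `A` associated with `Q`: a signed Borel measure supported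
on `A`, of total charge `1`, whose weighted potential `U_s^η + Q` is well defined, finite and equal
to a constant `G` everywhere on `A`. Here `U_s^η = U_s^{η⁺} - U_s^{η⁻}`. -/
structure IsSignedEquilibrium {p : ℕ} (s : ℝ) (A : Set (Space p)) (Q : Space p → ℝ)
    (η : SignedMeasure (Space p)) : Prop where
  supported : η.totalVariation Aᶜ = 0
  total_charge : η univ = 1
  pos_finite : ∀ x ∈ A, potential s η.toJordanDecomposition.posPart x ≠ ∞
  neg_finite : ∀ x ∈ A, potential s η.toJordanDecomposition.negPart x ≠ ∞
  constant : ∃ G : ℝ, ∀ x ∈ A,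
    (potential s η.toJordanDecomposition.posPart x).toReal
      - (potential s η.toJordanDecomposition.negPart x).toReal + Q x = G

/-- The point `a = (0, R)` on the polar axis of `ℝ^(d+1)`. -/
def source (d : ℕ) (R : ℝ) : Space (d + 1) := EuclideanSpace.single (Fin.last d) R

/-- The Riesz external field `Q(x) = q / |x - a|^s` of a point charge `q` at `a = (0, R)`. -/
def field (d : ℕ) (s q R : ℝ) (x : Space (d + 1)) : ℝ := q / ‖x - source d R‖ ^ s

/-- The Gonchar function of the second kind,
`(W_s(S^d) / q) (1 - R)^d - (1 + R)^(d - s) + (1 - R)^d U_s^{σ_d}(R)`. -/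
def goncharB (d : ℕ) (s q R : ℝ) : ℝ :=
  (wienerEnergy s (unitSphere d)).toReal / q * (1 - R) ^ d - (1 + R) ^ ((d : ℝ) - s)
    + (1 - R) ^ d * (potential s (sigma d) (source d R)).toReal

/-- The distances from an interior point charge `q` at `(0, R)`, `0 ≤ R < 1`, to `S^d` for which
the support of the extremal measure on `S^d` associated with its field is the entire sphere. -/
def goncharDistances (d : ℕ) (s q : ℝ) : Set ℝ :=
  {δ | ∃ R ∈ Ico (0 : ℝ) 1, δ = Metric.infDist (source d R) (unitSphere d) ∧
    ∃ μ, IsExtremal s (unitSphere d) (field d s q R) μ ∧ μ.support = unitSphere d}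

end Riesz

end

/-! Put λ(y) = (1 - R²)/|y - a|² on the sphere. The involution T of the sphere along the chords
through a is conformal: |Ty - Tz|² = λ(y)λ(z)|y - z|², and T has Jacobian λ^d with respect to σ_d.
The potential of σ_d is a constant W on the sphere, by rotation invariance, and W = W_s by positive
definiteness of the Riesz kernel. Changing variables by T in this constant potential shows that the
density (1 - R²)^(-s/2) λ^(d - s/2) / W has potential |x - a|^(-s) on the sphere, i.e. it is the
balayage of a unit mass at a (`potential_balayage`).

With Φ(R) the potential of σ_d at a, the measure (1 + qΦ(R)/W) σ_d minus q times this balayage is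
therefore a signed equilibrium. Its density is smallest at the pole `source d 1`, where it equals
(q/W)(W/q - θ(R)) with θ = `threshold`; and the Gonchar function is (1 - R)^d (W/q - θ(R)). Since θ
is strictly increasing from 0 to infinity, it takes the value W/q at exactly one R_q, and positivity
of the equilibrium means R ≤ R_q.

Uniqueness (`measure_eq_of_potential_ae_eq`) comes from the same conformal formula, which recovers a
bounded potential inside the ball from boundary values, and from strict positive definiteness of
that bounded kernel through a Gaussian mixture. For extremal measures, constant weighted potential
implies minimality by positive definiteness; conversely a minimizer of full support has constant
weighted potential σ_d-almost everywhere, by the Frostman inequalities, so it is the signed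
equilibrium.

The polynomial claim rests on an exchange of the exponents t and 2d - t, which yields an ODE
expressing Φ for exponent t through Φ for exponent t + 2. The recursion starts at t = d - 1, where
the inhomogeneity vanishes. -/

namespace Riesz

/-! ### Surface measure, polar coordinates, rotation invariance -/

section SphereMeasure

variable {d : ℕ}

/-- The total surface area of `S^d`. -/
noncomputable def sphereArea (d : ℕ) : ℝ≥0∞ :=
  (volume : Measure (Space (d + 1))).toSphere univ

lemma sphereArea_ne_zero (d : ℕ) : sphereArea d ≠ 0 := by
  simp only [sphereArea, ne_eq, Measure.measure_univ_eq_zero]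
  exact Measure.toSphere_ne_zero _

lemma sphereArea_ne_top (d : ℕ) : sphereArea d ≠ ∞ := measure_ne_top _ _

lemma measurable_sphere_coe :
    Measurable (Subtype.val : Metric.sphere (0 : Space (d + 1)) 1 → Space (d + 1)) :=
  measurable_subtype_coe

lemma lintegral_sigma {f : Space (d + 1) → ℝ≥0∞} (hf : Measurable f) :
    ∫⁻ x, f x ∂sigma d = (sphereArea d)⁻¹ *
      ∫⁻ y : Metric.sphere (0 : Space (d + 1)) 1, f y
        ∂(volume : Measure (Space (d + 1))).toSphere := by
  rw [sigma, lintegral_map hf measurable_sphere_coe, lintegral_smul_measure]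
  rfl

instance : IsProbabilityMeasure (sigma d) := by
  constructor
  have := lintegral_sigma (d := d) (f := fun _ => 1) measurable_const
  simp only [lintegral_const, one_mul] at this
  rw [this]
  exact ENNReal.inv_mul_cancel (sphereArea_ne_zero d) (sphereArea_ne_top d)

lemma measurableSet_unitSphere : MeasurableSet (unitSphere d) := by
  rw [unitSphere]; exact Metric.isClosed_sphere.measurableSet

lemma mem_unitSphere {x : Space (d + 1)} : x ∈ unitSphere d ↔ ‖x‖ = 1 := by
  simp [unitSphere]

lemma sigma_compl : sigma d (unitSphere d)ᶜ = 0 := by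
  rw [sigma, Measure.map_apply measurable_sphere_coe measurableSet_unitSphere.compl]
  have : (Subtype.val : Metric.sphere (0 : Space (d + 1)) 1 → Space (d + 1)) ⁻¹'
      (unitSphere d)ᶜ = ∅ := by
    ext x; simp [unitSphere]
  simp [this]

lemma ae_mem_unitSphere {μ : Measure (Space (d + 1))} (h : μ (unitSphere d)ᶜ = 0) :
    ∀ᵐ x ∂μ, x ∈ unitSphere d := by
  rw [ae_iff]; exact h

lemma sigma_pos_of_isOpen {U : Set (Space (d + 1))} (hU : IsOpen U)
    (hne : (U ∩ unitSphere d).Nonempty) : 0 < sigma d U := by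
  rw [sigma, Measure.map_apply measurable_sphere_coe hU.measurableSet, Measure.smul_apply,
    smul_eq_mul]
  obtain ⟨x, hxU, hxS⟩ := hne
  refine ENNReal.mul_pos (ENNReal.inv_ne_zero.2 (sphereArea_ne_top d)) ?_
  have hinst := Measure.toSphere.instIsOpenPosMeasure (volume : Measure (Space (d + 1)))
  exact ((hU.preimage continuous_subtype_val).measure_pos
    (volume : Measure (Space (d + 1))).toSphere ⟨⟨x, hxS⟩, hxU⟩).ne'

/-- Integration in polar coordinates. -/
lemma lintegral_polar {f : Space (d + 1) → ℝ≥0∞} (hf : Measurable f) :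
    ∫⁻ x, f x = sphereArea d * ∫⁻ y, ∫⁻ r : Ioi (0 : ℝ), f (r.1 • y)
      ∂Measure.volumeIoiPow d ∂sigma d := by
  have hm : Measurable fun y : Space (d + 1) => ∫⁻ r : Ioi (0 : ℝ), f (r.1 • y)
      ∂Measure.volumeIoiPow d := by
    apply Measurable.lintegral_prod_right' (f := fun p : Space (d + 1) × Ioi (0 : ℝ) =>
      f (p.2.1 • p.1))
    fun_prop
  rw [lintegral_sigma hm, ← mul_assoc,
    ENNReal.mul_inv_cancel (sphereArea_ne_zero d) (sphereArea_ne_top d), one_mul]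
  have h1 : ∫⁻ x, f x = ∫⁻ x : ({0}ᶜ : Set (Space (d + 1))), 
      f x.1 ∂((volume : Measure (Space (d + 1))).comap Subtype.val) := by
    rw [lintegral_subtype_comap (measurableSet_singleton _).compl, restrict_compl_singleton]
  have h2 := (volume : Measure (Space (d + 1))).measurePreserving_homeomorphUnitSphereProd
  have hdim : Module.finrank ℝ (Space (d + 1)) - 1 = d := by simp
  rw [hdim] at h2
  have h3 : ∀ x : ({0}ᶜ : Set (Space (d + 1))),
      f x.1 = (fun p : Metric.sphere (0 : Space (d + 1)) 1 × Ioi (0 : ℝ) => f (p.2.1 • p.1.1))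
        (homeomorphUnitSphereProd (Space (d + 1)) x) := by
    intro x
    have hx : ‖(x : Space (d + 1))‖ ≠ 0 := norm_ne_zero_iff.2 x.2
    simp [smul_smul, hx]
  have hg : Measurable
      (fun p : Metric.sphere (0 : Space (d + 1)) 1 × Ioi (0 : ℝ) => f (p.2.1 • p.1.1)) := by
    fun_prop
  rw [h1, lintegral_congr h3, h2.lintegral_comp hg, lintegral_prod _ hg.aemeasurable]

/-- Expresses a sphere integral through Lebesgue measure and the extension of φ that is constant on
rays. Maps of the space that are homogeneous of degree one can then be studied by ordinary change of
variables. -/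
lemma lintegral_ball_polar {φ : Space (d + 1) → ℝ≥0∞} (hφ : Measurable φ) :
    ∫⁻ x in Metric.ball 0 1, φ (‖x‖⁻¹ • x) = sphereArea d * ENNReal.ofReal (1 / (d + 1)) *
      ∫⁻ y, φ y ∂sigma d := by
  rw [← lintegral_indicator Metric.isOpen_ball.measurableSet, lintegral_polar, mul_assoc]
  · congr 1
    rw [← lintegral_const_mul _ hφ]
    refine lintegral_congr_ae ?_
    filter_upwards [ae_mem_unitSphere (sigma_compl (d := d))] with y hy
    rw [mem_unitSphere] at hy
    have : ∀ r : Ioi (0 : ℝ), (Metric.ball (0 : Space (d + 1)) 1).indicator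
        (fun x => φ (‖x‖⁻¹ • x)) (r.1 • y)
        = (Iio (⟨1, mem_Ioi.2 one_pos⟩ : Ioi (0 : ℝ))).indicator (fun _ => φ y) r := by
      rintro ⟨r, hr⟩
      have hr' : 0 < r := hr
      have h1 : (r • y ∈ Metric.ball (0 : Space (d + 1)) 1) ↔
          ((⟨r, hr⟩ : Ioi (0 : ℝ)) ∈ Iio (⟨1, mem_Ioi.2 one_pos⟩ : Ioi (0 : ℝ))) := by
        simp [norm_smul, hy, abs_of_pos hr']
      by_cases h : r • y ∈ Metric.ball (0 : Space (d + 1)) 1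
      · rw [indicator_of_mem h, indicator_of_mem (h1.1 h), norm_smul, hy, smul_smul]
        simp [abs_of_pos hr', hr'.ne']
      · rw [indicator_of_notMem h, indicator_of_notMem (fun h' => h (h1.2 h'))]
    simp only [this]
    rw [lintegral_indicator measurableSet_Iio, lintegral_const, Measure.restrict_apply_univ,
      Measure.volumeIoiPow_apply_Iio]
    simp [mul_comm]
  · refine Measurable.indicator ?_ Metric.isOpen_ball.measurableSet
    fun_prop

/-- Inherited from Lebesgue measure, since a linear isometry preserves the unit ball and commutes
with radial projection. -/
lemma lintegral_sigma_isometry (L : Space (d + 1) ≃ₗᵢ[ℝ] Space (d + 1))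
    {φ : Space (d + 1) → ℝ≥0∞} (hφ : Measurable φ) :
    ∫⁻ y, φ (L y) ∂sigma d = ∫⁻ y, φ y ∂sigma d := by
  have hLm : Measurable L := L.continuous.measurable
  have h1 := lintegral_ball_polar hφ
  have h2 := lintegral_ball_polar (hφ.comp hLm)
  have h3 : ∫⁻ x in Metric.ball 0 1, φ (‖x‖⁻¹ • x)
      = ∫⁻ x in Metric.ball 0 1, (φ ∘ L) (‖x‖⁻¹ • x) := by
    have := L.measurePreserving.setLIntegral_comp_preimage
      (s := Metric.ball (0 : Space (d + 1)) 1) (f := fun x => φ (‖x‖⁻¹ • x))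
      Metric.isOpen_ball.measurableSet (by fun_prop)
    rw [← this]
    have hpre : L ⁻¹' Metric.ball (0 : Space (d + 1)) 1 = Metric.ball 0 1 := by
      ext x; simp
    rw [hpre]
    simp
  rw [h1, h2] at h3
  have hne : sphereArea d * ENNReal.ofReal (1 / (d + 1)) ≠ 0 :=
    mul_ne_zero (sphereArea_ne_zero d) (by simp; positivity)
  have hnt : sphereArea d * ENNReal.ofReal (1 / (d + 1)) ≠ ∞ :=
    ENNReal.mul_ne_top (sphereArea_ne_top d) ENNReal.ofReal_ne_top
  exact ((ENNReal.mul_right_inj hne hnt).1 h3).symm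

end SphereMeasure

/-! ### Finiteness and constancy of the potential of the surface measure on the sphere -/

section Finiteness

variable {d : ℕ}

lemma rpow_neg_le_rpow_neg {a b : ℝ≥0∞} {t : ℝ} (ht : 0 ≤ t) (h : a ≤ b) :
    b ^ (-t) ≤ a ^ (-t) := by
  rw [ENNReal.rpow_neg, ENNReal.rpow_neg, ENNReal.inv_le_inv]
  exact ENNReal.rpow_le_rpow h ht

lemma measurable_kernel (s : ℝ) :
    Measurable fun p : Space (d + 1) × Space (d + 1) => edist p.1 p.2 ^ (-s) := by
  fun_prop

lemma measurable_potential (s : ℝ) (μ : Measure (Space (d + 1))) [SFinite μ] :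
    Measurable (potential s μ) :=
  (measurable_kernel s).lintegral_prod_right'

lemma lintegral_ball_kernel_lt_top {t : ℝ} (ht : t < d + 1) (x : Space (d + 1)) (r : ℝ) :
    ∫⁻ y in Metric.ball x r, edist x y ^ (-t) < ∞ := by
  have h1 : IntegrableOn (fun y : Space (d + 1) => ‖y‖ ^ (-t)) (Metric.ball 0 r) := by
    rw [integrableOn_fun_norm_addHaar volume (f := fun u => u ^ (-t))]
    -- In polar coordinates the integrand is y^(d - t), with exponent above -1; `max r 0` absorbs
    -- negative radii.
    have h2 : IntegrableOn (fun y : ℝ => y ^ ((d : ℝ) - t)) (Ioo 0 (max r 0)) := by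
      have := (intervalIntegral.intervalIntegrable_rpow' (a := 0) (b := max r 0)
        (r := (d : ℝ) - t) (by linarith)).1
      exact this.mono_set Ioo_subset_Ioc_self
    refine (h2.mono_set (Ioo_subset_Ioo_right (le_max_left _ _))).congr_fun ?_ measurableSet_Ioo
    intro y hy
    have hy0 : 0 < y := hy.1
    simp only [finrank_euclideanSpace, Fintype.card_fin, add_tsub_cancel_right, smul_eq_mul]
    rw [← Real.rpow_natCast, ← Real.rpow_add hy0, sub_eq_add_neg]
  have h3 : ∫⁻ y in Metric.ball x r, edist x y ^ (-t)
      = ∫⁻ y in Metric.ball (0 : Space (d + 1)) r, edist 0 y ^ (-t) := by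
    have := (measurePreserving_add_left (volume : Measure (Space (d + 1)))
      x).setLIntegral_comp_preimage (s := Metric.ball x r)
      (f := fun y => edist x y ^ (-t)) Metric.isOpen_ball.measurableSet (by fun_prop)
    rw [← this]
    have hpre : (fun y => x + y) ⁻¹' Metric.ball x r = Metric.ball 0 r := by
      ext y; simp
    rw [hpre]
    refine lintegral_congr fun y => ?_
    have : edist x (x + y) = edist 0 y := by
      simpa using edist_add_left x 0 y
    rw [this]
  rw [h3]
  refine lt_of_le_of_lt (lintegral_mono_ae ?_) h1.lintegral_lt_top
  have h0 : ∀ᵐ y ∂(volume.restrict (Metric.ball (0 : Space (d + 1)) r)), y ≠ 0 := by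
    refine ae_restrict_of_ae ?_
    rw [ae_iff]; simp
  filter_upwards [h0] with y hy
  rw [← ENNReal.ofReal_rpow_of_pos (norm_pos_iff.2 hy), edist_dist, dist_zero_left]

/-- The part of a polar ray close to a point of the sphere at distance less than `D`. -/
lemma radial_lower_bound {s D : ℝ} (hs : 0 < s) (hD : 0 < D) (hD2 : D ≤ 2)
    {x y : Space (d + 1)} (hy : ‖y‖ = 1) (hxy : dist x y ≤ D) :
    ENNReal.ofReal ((2 * D) ^ (-(s + 1)) * (D / 4 / (d + 1))) ≤
      ∫⁻ r : Ioi (0 : ℝ), (Metric.ball x 5).indicator (fun z => edist x z ^ (-(s + 1))) (r.1 • y)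
        ∂Measure.volumeIoiPow d := by
  -- On the segment 1 - D/4 ≤ r < 1 the point r • y is within D + D/4 ≤ 2D ≤ 4 of x, hence inside
  -- the ball of radius 5, and the radial mass of the segment is at least (D/4)/(d + 1).
  set b : Ioi (0 : ℝ) := ⟨1 - D / 4, mem_Ioi.2 (by linarith)⟩ with hb
  set e : Ioi (0 : ℝ) := ⟨1, mem_Ioi.2 one_pos⟩ with he
  have hbe : Iio b ⊆ Iio e := Iio_subset_Iio (by
    rw [← Subtype.coe_le_coe]; simp only [hb, he]; linarith)
  have hmeas : ENNReal.ofReal (D / 4 / (d + 1)) ≤ Measure.volumeIoiPow d (Iio e \ Iio b) := by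
    rw [measure_sdiff hbe measurableSet_Iio.nullMeasurableSet
      (by rw [Measure.volumeIoiPow_apply_Iio]; exact ENNReal.ofReal_ne_top),
      Measure.volumeIoiPow_apply_Iio, Measure.volumeIoiPow_apply_Iio,
      ← ENNReal.ofReal_sub _ (by simp only [hb]; have : 0 ≤ 1 - D / 4 := by linarith
                                 positivity)]
    refine ENNReal.ofReal_le_ofReal ?_
    rw [← sub_div]
    gcongr
    simp only [hb, he, one_pow]
    have := pow_le_of_le_one (show 0 ≤ 1 - D / 4 by linarith) (by linarith)
      (show d + 1 ≠ 0 by omega)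
    linarith
  have hlow : ∀ r ∈ Iio e \ Iio b, ENNReal.ofReal ((2 * D) ^ (-(s + 1))) ≤
      (Metric.ball x 5).indicator (fun z => edist x z ^ (-(s + 1))) (r.1 • y) := by
    rintro r ⟨h1, h2⟩
    have h1' : r.1 < 1 := h1
    have h2' : 1 - D / 4 ≤ r.1 := not_lt.1 h2
    have hd : dist x (r.1 • y) ≤ 2 * D := by
      have h3 : dist y (r.1 • y) = 1 - r.1 := by
        rw [dist_eq_norm, show y - r.1 • y = (1 - r.1) • y by rw [sub_smul, one_smul],
          norm_smul, hy, mul_one, Real.norm_eq_abs, abs_of_pos (by linarith)]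
      have := dist_triangle x y (r.1 • y)
      linarith
    have hmem : r.1 • y ∈ Metric.ball x 5 := by
      rw [Metric.mem_ball']; linarith
    rw [indicator_of_mem hmem, ← ENNReal.ofReal_rpow_of_pos (by linarith)]
    refine rpow_neg_le_rpow_neg (by linarith) ?_
    rw [edist_dist]
    exact ENNReal.ofReal_le_ofReal hd
  calc ENNReal.ofReal ((2 * D) ^ (-(s + 1)) * (D / 4 / (d + 1)))
      = ENNReal.ofReal ((2 * D) ^ (-(s + 1))) * ENNReal.ofReal (D / 4 / (d + 1)) :=
        ENNReal.ofReal_mul (by positivity)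
    _ ≤ ENNReal.ofReal ((2 * D) ^ (-(s + 1))) * Measure.volumeIoiPow d (Iio e \ Iio b) := by
        gcongr
    _ = ∫⁻ r in Iio e \ Iio b, ENNReal.ofReal ((2 * D) ^ (-(s + 1)))
        ∂Measure.volumeIoiPow d := by rw [setLIntegral_const]
    _ ≤ ∫⁻ r in Iio e \ Iio b, (Metric.ball x 5).indicator
          (fun z => edist x z ^ (-(s + 1))) (r.1 • y) ∂Measure.volumeIoiPow d :=
        setLIntegral_mono' (measurableSet_Iio.diff measurableSet_Iio) hlow
    _ ≤ _ := setLIntegral_le_lintegral _ _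

/-- Taking D = |x - y| in `radial_lower_bound`: integrating the exponent s + 1 along a ray costs one
power and leaves the exponent s. This reduces finiteness on the sphere to local integrability in the
ambient space. -/
lemma radial_lower_bound_kernel {s : ℝ} (hs : 0 < s)
    {x y : Space (d + 1)} (hx : ‖x‖ = 1) (hy : ‖y‖ = 1) :
    ENNReal.ofReal (2 ^ (-(s + 1)) / 4 / (d + 1)) * edist x y ^ (-s) ≤
      ∫⁻ r : Ioi (0 : ℝ), (Metric.ball x 5).indicator (fun z => edist x z ^ (-(s + 1))) (r.1 • y)
        ∂Measure.volumeIoiPow d := by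
  have hc : ∀ D : ℝ, 0 < D → ENNReal.ofReal ((2 * D) ^ (-(s + 1)) * (D / 4 / (d + 1)))
      = ENNReal.ofReal (2 ^ (-(s + 1)) / 4 / (d + 1)) * ENNReal.ofReal D ^ (-s) := by
    intro D hD
    rw [ENNReal.ofReal_rpow_of_pos hD, ← ENNReal.ofReal_mul (by positivity),
      Real.mul_rpow (by norm_num) hD.le, neg_add, Real.rpow_add hD, Real.rpow_neg_one]
    congr 1
    field_simp
  rcases eq_or_ne x y with rfl | hne
  -- On the diagonal the bound is applied with D = 1/(n + 1), and the limit gives the infinite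
  -- value.
  · have hlim : Filter.Tendsto (fun n : ℕ => ENNReal.ofReal (2 ^ (-(s + 1)) / 4 / (d + 1)) *
        ENNReal.ofReal (1 / ((n : ℝ) + 1)) ^ (-s)) Filter.atTop
        (nhds (ENNReal.ofReal (2 ^ (-(s + 1)) / 4 / (d + 1)) * edist x x ^ (-s))) := by
      refine ENNReal.Tendsto.const_mul ?_ (Or.inr ENNReal.ofReal_ne_top)
      have h0 : Filter.Tendsto (fun n : ℕ => ENNReal.ofReal (1 / ((n : ℝ) + 1))) Filter.atTop
          (nhds (edist x x)) := by
        rw [edist_self, ← ENNReal.ofReal_zero]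
        exact ENNReal.tendsto_ofReal tendsto_one_div_add_atTop_nhds_zero_nat
      exact (ENNReal.continuous_rpow_const.tendsto _).comp h0
    refine le_of_tendsto' hlim fun n => ?_
    rw [← hc _ (by positivity)]
    refine radial_lower_bound hs (by positivity) ?_ hy (by rw [dist_self]; positivity)
    rw [div_le_iff₀ (by positivity)]
    have : (0 : ℝ) ≤ n := Nat.cast_nonneg n
    linarith
  · have hpos := dist_pos.2 hne
    rw [edist_dist, ← hc _ hpos]
    refine radial_lower_bound hs hpos ?_ hy le_rfl
    have := dist_le_norm_add_norm x y
    linarith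

/-- The kernel with exponent s + 1 < d + 1 is integrable over the ball of radius 5; its polar form
dominates a positive multiple of the potential. -/
lemma potential_sigma_lt_top {s : ℝ} (hs : 0 < s) (hsd : s < d) {x : Space (d + 1)}
    (hx : x ∈ unitSphere d) : potential s (sigma d) x < ∞ := by
  have h1 := lintegral_ball_kernel_lt_top (d := d) (t := s + 1) (by linarith) x 5
  rw [← lintegral_indicator Metric.isOpen_ball.measurableSet, lintegral_polar
    (Measurable.indicator (by fun_prop) Metric.isOpen_ball.measurableSet)] at h1
  set c := ENNReal.ofReal (2 ^ (-(s + 1)) / 4 / (d + 1)) with hc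
  have hc0 : c ≠ 0 := by
    simp only [hc, ne_eq, ENNReal.ofReal_eq_zero, not_le]; positivity
  have h2 : c * potential s (sigma d) x ≤ ∫⁻ y, ∫⁻ r : Ioi (0 : ℝ), (Metric.ball x 5).indicator
      (fun z => edist x z ^ (-(s + 1))) (r.1 • y) ∂Measure.volumeIoiPow d ∂sigma d := by
    rw [potential, ← lintegral_const_mul _ (by fun_prop)]
    refine lintegral_mono_ae ?_
    filter_upwards [ae_mem_unitSphere (sigma_compl (d := d))] with y hy
    exact radial_lower_bound_kernel hs (mem_unitSphere.1 hx) (mem_unitSphere.1 hy)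
  have h3 := ENNReal.lt_top_of_mul_ne_top_right h1.ne (sphereArea_ne_zero d)
  exact ENNReal.lt_top_of_mul_ne_top_right (lt_of_le_of_lt h2 h3).ne hc0

/-- The energy of the normalized surface measure. -/
noncomputable def sphereEnergy (d : ℕ) (s : ℝ) : ℝ≥0∞ :=
  potential s (sigma d) (EuclideanSpace.single (Fin.last d) 1)

/-- The reflection in the hyperplane orthogonal to x - e exchanges x with the pole e and preserves
`sigma d`. -/
lemma potential_sigma {s : ℝ} {x : Space (d + 1)}
    (hx : x ∈ unitSphere d) : potential s (sigma d) x = sphereEnergy d s := by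
  set e : Space (d + 1) := EuclideanSpace.single (Fin.last d) 1 with he
  have hn : ‖x‖ = ‖e‖ := by rw [mem_unitSphere.1 hx, he]; simp
  set L := (Submodule.span ℝ {x - e})ᗮ.reflection with hL
  have hLx : L x = e := Submodule.reflection_sub hn
  rw [sphereEnergy, ← he, potential, potential,
    ← lintegral_sigma_isometry L (φ := fun y => edist e y ^ (-s)) (by fun_prop)]
  refine lintegral_congr fun y => ?_
  rw [← hLx, LinearIsometryEquiv.edist_map]

lemma single_last_mem_unitSphere :
    (EuclideanSpace.single (Fin.last d) 1 : Space (d + 1)) ∈ unitSphere d := by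
  rw [mem_unitSphere]; simp

lemma sphereEnergy_ne_top {s : ℝ} (hs : 0 < s) (hsd : s < d) : sphereEnergy d s ≠ ∞ :=
  (potential_sigma_lt_top hs hsd single_last_mem_unitSphere).ne

/-- An atom on the sphere would make the potential infinite at its location. -/
lemma sigma_singleton {s : ℝ} (hs : 0 < s) (hsd : s < d) (x : Space (d + 1)) :
    sigma d {x} = 0 := by
  by_cases hx : x ∈ unitSphere d
  · have h := potential_sigma_lt_top hs hsd hx
    by_contra hne
    have : ∫⁻ y in {x}, edist x y ^ (-s) ∂sigma d ≤ potential s (sigma d) x :=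
      setLIntegral_le_lintegral _ _
    rw [lintegral_singleton, edist_self, ENNReal.zero_rpow_of_neg (by linarith),
      ENNReal.top_mul hne] at this
    exact absurd (top_le_iff.1 this) h.ne
  · exact measure_mono_null (singleton_subset_iff.2 hx) sigma_compl

lemma sphereEnergy_pos {s : ℝ} (hs : 0 < s) : sphereEnergy d s ≠ 0 := by
  intro h
  rw [sphereEnergy, potential, lintegral_eq_zero_iff (by fun_prop)] at h
  have : ∀ᵐ y ∂sigma d, False := by
    filter_upwards [h] with y hy
    simp only [Pi.zero_apply, ENNReal.rpow_eq_zero_iff] at hy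
    rcases hy with ⟨_, h2⟩ | ⟨h1, _⟩
    · linarith
    · exact edist_ne_top _ _ h1
  simp at this
  exact IsProbabilityMeasure.ne_zero (sigma d) this

end Finiteness

/-! ### The conformal involution of the sphere along chords through an interior point -/

section Kelvin

variable {d : ℕ}

local notation "⟪" x ", " y "⟫" => inner ℝ x y

/-- The Lorentz reflection of the light cone `{(‖x‖, x)}`, as an involution of `ℝ^(d+1)`; its
projectivization is the involution of the sphere along the chords through `a`. -/
noncomputable def coneReflection (a x : Space (d + 1)) : Space (d + 1) :=
  (2 / (1 - ‖a‖ ^ 2) * (‖x‖ - ⟪a, x⟫)) • a - x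

variable {a : Space (d + 1)}

lemma one_sub_sq_pos (ha : ‖a‖ < 1) : 0 < 1 - ‖a‖ ^ 2 := by
  nlinarith [norm_nonneg a]

/-- The right side is the time coordinate of the image of the lightlike vector (‖x‖, x) under the
reflection of Minkowski space fixing (1, a). It is nonnegative, being at least (1 - ‖a‖)² ‖x‖ / (1 -
‖a‖²), so the image stays on the forward cone. -/
lemma norm_coneReflection (ha : ‖a‖ < 1) (x : Space (d + 1)) :
    ‖coneReflection a x‖ = ((1 + ‖a‖ ^ 2) * ‖x‖ - 2 * ⟪a, x⟫) / (1 - ‖a‖ ^ 2) := by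
  have hA := one_sub_sq_pos ha
  have hin : ⟪a, x⟫ ≤ ‖a‖ * ‖x‖ := real_inner_le_norm a x
  have hnn : 0 ≤ (1 + ‖a‖ ^ 2) * ‖x‖ - 2 * ⟪a, x⟫ := by
    nlinarith [norm_nonneg x, sq_nonneg (1 - ‖a‖)]
  rw [← sq_eq_sq₀ (norm_nonneg _) (by positivity), coneReflection, norm_sub_sq_real,
    norm_smul, inner_smul_left, mul_pow, Real.norm_eq_abs, sq_abs]
  simp only [conj_trivial]
  field_simp
  ring

lemma coneReflection_coneReflection (ha : ‖a‖ < 1) (x : Space (d + 1)) :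
    coneReflection a (coneReflection a x) = x := by
  have hA := one_sub_sq_pos ha
  -- The Lorentz product with the fixed axis (1, a) is preserved.
  have h : ‖coneReflection a x‖ - ⟪a, coneReflection a x⟫ = ‖x‖ - ⟪a, x⟫ := by
    rw [norm_coneReflection ha, coneReflection, inner_sub_right, inner_smul_right,
      real_inner_self_eq_norm_sq]
    field_simp
    ring
  rw [coneReflection, h, coneReflection]
  abel

lemma coneReflection_smul {r : ℝ} (hr : 0 ≤ r) (x : Space (d + 1)) :
    coneReflection a (r • x) = r • coneReflection a x := by
  simp only [coneReflection, norm_smul, inner_smul_right, Real.norm_eq_abs, abs_of_nonneg hr,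
    smul_sub, smul_smul]
  congr 2
  ring

lemma coneReflection_eq_zero (ha : ‖a‖ < 1) {x : Space (d + 1)} :
    coneReflection a x = 0 ↔ x = 0 := by
  have h0 : coneReflection a (0 : Space (d + 1)) = 0 := by simp [coneReflection]
  constructor
  · intro h
    rw [← coneReflection_coneReflection ha x, h, h0]
  · rintro rfl; exact h0

@[fun_prop]
lemma continuous_coneReflection : Continuous (coneReflection a) := by
  unfold coneReflection; fun_prop

lemma hasFDerivAt_norm {x : Space (d + 1)} (hx : x ≠ 0) :
    HasFDerivAt (fun y : Space (d + 1) => ‖y‖) (‖x‖⁻¹ • innerSL ℝ x) x := by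
  have h1 := (hasStrictFDerivAt_norm_sq x).hasFDerivAt
  have h2 := h1.sqrt (by positivity)
  have h3 : (fun y : Space (d + 1) => ‖y‖) = fun y => √(‖y‖ ^ 2) := by
    ext y; rw [Real.sqrt_sq (norm_nonneg y)]
  have h4 : (1 / (2 * √(‖x‖ ^ 2))) • (2 • innerSL ℝ x) = ‖x‖⁻¹ • innerSL ℝ x := by
    rw [Real.sqrt_sq (norm_nonneg x), ← Nat.cast_smul_eq_nsmul ℝ, smul_smul]
    congr 1
    push_cast
    field_simp
  rw [h3, ← h4]
  exact h2

lemma hasFDerivAt_coneReflection {x : Space (d + 1)} (hx : x ≠ 0) :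
    HasFDerivAt (coneReflection a) (((2 / (1 - ‖a‖ ^ 2)) • (‖x‖⁻¹ • innerSL ℝ x
      - innerSL ℝ a)).smulRight a - ContinuousLinearMap.id ℝ (Space (d + 1))) x := by
  have h1 : HasFDerivAt (fun y : Space (d + 1) => ‖y‖ - ⟪a, y⟫)
      (‖x‖⁻¹ • innerSL ℝ x - innerSL ℝ a) x :=
    (hasFDerivAt_norm hx).sub (innerSL ℝ a).hasFDerivAt
  exact ((h1.const_mul (2 / (1 - ‖a‖ ^ 2))).smul_const a).sub (hasFDerivAt_id x)

/-- The derivative is minus the identity plus a rank one map f ⊗ a, so up to sign its determinant is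
1 - f(a). -/
lemma abs_det_fderiv_coneReflection (ha : ‖a‖ < 1) {x : Space (d + 1)} (hx : x ≠ 0) :
    |(((2 / (1 - ‖a‖ ^ 2)) • (‖x‖⁻¹ • innerSL ℝ x
      - innerSL ℝ a)).smulRight a - ContinuousLinearMap.id ℝ (Space (d + 1))).det| =
      ‖coneReflection a x‖ / ‖x‖ := by
  set f : Space (d + 1) →L[ℝ] ℝ := (2 / (1 - ‖a‖ ^ 2)) • (‖x‖⁻¹ • innerSL ℝ x - innerSL ℝ a)
    with hf
  have h1 : ((f.smulRight a - ContinuousLinearMap.id ℝ (Space (d + 1)) :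
      Space (d + 1) →L[ℝ] Space (d + 1)) : Space (d + 1) →ₗ[ℝ] Space (d + 1)) =
      (-1 : ℝ) • LinearMap.transvection (-f : Space (d + 1) →L[ℝ] ℝ).toLinearMap a := by
    ext y : 1
    simp [LinearMap.transvection.apply]
    abel
  have hA := one_sub_sq_pos ha
  have hx0 : ‖x‖ ≠ 0 := norm_ne_zero_iff.2 hx
  rw [ContinuousLinearMap.det, h1, LinearMap.det_smul, LinearMap.transvection.det, abs_mul,
    abs_pow, abs_neg, abs_one, one_pow, one_mul]
  have h2 : 1 + (-f : Space (d + 1) →L[ℝ] ℝ).toLinearMap a = ‖coneReflection a x‖ / ‖x‖ := by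
    rw [norm_coneReflection ha]
    simp only [hf, ContinuousLinearMap.coe_coe, _root_.neg_apply,
      _root_.smul_apply, _root_.sub_apply, innerSL_apply_apply,
      smul_eq_mul, real_inner_self_eq_norm_sq, real_inner_comm a x]
    field_simp
    ring
  rw [h2, abs_of_nonneg (by positivity)]

/-- This is the Lorentz invariance of the measure dx/‖x‖ on the light cone. -/
lemma lintegral_comp_coneReflection (ha : ‖a‖ < 1) (g : Space (d + 1) → ℝ≥0∞) :
    ∫⁻ x, ENNReal.ofReal (‖coneReflection a x‖ / ‖x‖) * g (coneReflection a x) = ∫⁻ x, g x := by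
  -- The norm is not differentiable at the origin, which is a null set and is removed.
  have hms : MeasurableSet ({0}ᶜ : Set (Space (d + 1))) := (measurableSet_singleton _).compl
  have himg : coneReflection a '' ({0}ᶜ) = {0}ᶜ := by
    ext y
    simp only [mem_image, mem_compl_iff, mem_singleton_iff]
    constructor
    · rintro ⟨x, hx, rfl⟩
      rwa [coneReflection_eq_zero ha]
    · intro hy
      exact ⟨coneReflection a y, by rwa [coneReflection_eq_zero ha],
        coneReflection_coneReflection ha y⟩
  have hinj : InjOn (coneReflection a) ({0}ᶜ) := fun x _ y _ h => by
    rw [← coneReflection_coneReflection ha x, h, coneReflection_coneReflection ha]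
  have h := lintegral_image_eq_lintegral_abs_det_fderiv_mul volume hms
    (fun x hx => (hasFDerivAt_coneReflection (a := a) hx).hasFDerivWithinAt) hinj g
  rw [himg, restrict_compl_singleton] at h
  rw [h, ← setLIntegral_univ]
  conv_lhs => rw [setLIntegral_univ, ← restrict_compl_singleton (μ := volume) (0 : Space (d + 1))]
  conv_rhs => rw [← restrict_compl_singleton (μ := volume) (0 : Space (d + 1))]
  refine setLIntegral_congr_fun hms fun x hx => ?_
  simp only
  rw [abs_det_fderiv_coneReflection ha hx]

/-- The conformal factor of the involution of the sphere along the chords through `a`. -/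
noncomputable def conformalFactor (a y : Space (d + 1)) : ℝ := (1 - ‖a‖ ^ 2) / ‖y - a‖ ^ 2

/-- The involution of the sphere along the chords through `a`. -/
noncomputable def chordMap (a y : Space (d + 1)) : Space (d + 1) :=
  ‖coneReflection a y‖⁻¹ • coneReflection a y

@[fun_prop]
lemma measurable_conformalFactor : Measurable (conformalFactor a) := by
  unfold conformalFactor; fun_prop

@[fun_prop]
lemma measurable_chordMap : Measurable (chordMap a) := by
  unfold chordMap; fun_prop

lemma sub_ne_zero_of_norm (ha : ‖a‖ < 1) {y : Space (d + 1)} (hy : ‖y‖ = 1) : 0 < ‖y - a‖ := by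
  rw [norm_pos_iff, sub_ne_zero]; rintro rfl; linarith

lemma norm_sub_sq_of_mem (y : Space (d + 1)) (hy : ‖y‖ = 1) :
    ‖y - a‖ ^ 2 = 1 + ‖a‖ ^ 2 - 2 * ⟪a, y⟫ := by
  rw [norm_sub_sq_real, hy, real_inner_comm]; ring

lemma conformalFactor_pos (ha : ‖a‖ < 1) {y : Space (d + 1)} (hy : ‖y‖ = 1) :
    0 < conformalFactor a y := by
  have := one_sub_sq_pos ha
  have := sub_ne_zero_of_norm ha hy
  unfold conformalFactor; positivity

lemma norm_coneReflection_of_mem (ha : ‖a‖ < 1) {y : Space (d + 1)} (hy : ‖y‖ = 1) :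
    ‖coneReflection a y‖ = (conformalFactor a y)⁻¹ := by
  rw [norm_coneReflection ha, conformalFactor, norm_sub_sq_of_mem y hy, hy, inv_div, mul_one]

lemma chordMap_eq (ha : ‖a‖ < 1) {y : Space (d + 1)} (hy : ‖y‖ = 1) :
    chordMap a y = conformalFactor a y • coneReflection a y := by
  rw [chordMap, norm_coneReflection_of_mem ha hy, inv_inv]

lemma norm_chordMap (ha : ‖a‖ < 1) {y : Space (d + 1)} (hy : ‖y‖ = 1) : ‖chordMap a y‖ = 1 := by
  have := conformalFactor_pos ha hy
  rw [chordMap_eq ha hy, norm_smul, norm_coneReflection_of_mem ha hy, Real.norm_eq_abs,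
    abs_of_pos this, mul_inv_cancel₀ this.ne']

lemma conformalFactor_chordMap (ha : ‖a‖ < 1) {y : Space (d + 1)} (hy : ‖y‖ = 1) :
    conformalFactor a (chordMap a y) = (conformalFactor a y)⁻¹ := by
  have h := conformalFactor_pos ha hy
  rw [← inv_inj, ← norm_coneReflection_of_mem ha (norm_chordMap ha hy), chordMap_eq ha hy,
    coneReflection_smul h.le, coneReflection_coneReflection ha, norm_smul, hy, inv_inv,
    Real.norm_eq_abs, abs_of_pos h, mul_one]

lemma chordMap_chordMap (ha : ‖a‖ < 1) {y : Space (d + 1)} (hy : ‖y‖ = 1) :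
    chordMap a (chordMap a y) = y := by
  have h := conformalFactor_pos ha hy
  rw [chordMap_eq ha (norm_chordMap ha hy), conformalFactor_chordMap ha hy, chordMap_eq ha hy,
    coneReflection_smul h.le, coneReflection_coneReflection ha, smul_smul, inv_mul_cancel₀ h.ne',
    one_smul]

/-- For unit vectors |y - z|² is twice the Lorentz product of (1, y) and (1, z). The reflection
preserves it, and rescaling the images to the unit sphere contributes one conformal factor each. -/
lemma dist_chordMap_sq (ha : ‖a‖ < 1) {y z : Space (d + 1)} (hy : ‖y‖ = 1) (hz : ‖z‖ = 1) :
    dist (chordMap a y) (chordMap a z) ^ 2 =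
      conformalFactor a y * conformalFactor a z * dist y z ^ 2 := by
  have h1 := norm_chordMap ha hy
  have h2 := norm_chordMap ha hz
  have hA := one_sub_sq_pos ha
  have hya := pow_pos (sub_ne_zero_of_norm ha hy) 2
  have hza := pow_pos (sub_ne_zero_of_norm ha hz) 2
  rw [dist_eq_norm, dist_eq_norm, norm_sub_sq_real, norm_sub_sq_real, h1, h2, hy, hz,
    chordMap_eq ha hy, chordMap_eq ha hz, inner_smul_left, inner_smul_right]
  simp only [coneReflection, inner_sub_left, inner_sub_right, inner_smul_left, inner_smul_right,
    real_inner_self_eq_norm_sq, conj_trivial, hy, hz, conformalFactor, real_inner_comm a y]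
  rw [norm_sub_sq_of_mem y hy] at hya ⊢
  rw [norm_sub_sq_of_mem z hz] at hza ⊢
  field_simp
  ring

lemma edist_chordMap_rpow (ha : ‖a‖ < 1) {y z : Space (d + 1)} (hy : ‖y‖ = 1) (hz : ‖z‖ = 1)
    {s : ℝ} :
    edist (chordMap a y) (chordMap a z) ^ (-s) =
      ENNReal.ofReal (conformalFactor a y ^ (-(s / 2)) * conformalFactor a z ^ (-(s / 2))) *
        edist y z ^ (-s) := by
  have h1 := conformalFactor_pos ha hy
  have h2 := conformalFactor_pos ha hz
  have h : dist (chordMap a y) (chordMap a z) =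
      √(conformalFactor a y * conformalFactor a z) * dist y z := by
    rw [← sq_eq_sq₀ dist_nonneg (by positivity), dist_chordMap_sq ha hy hz, mul_pow,
      Real.sq_sqrt (by positivity)]
  rw [edist_dist, h, ENNReal.ofReal_mul (by positivity), ← edist_dist,
    ENNReal.mul_rpow_of_ne_top ENNReal.ofReal_ne_top (edist_ne_top _ _),
    ENNReal.ofReal_rpow_of_pos (by positivity), Real.sqrt_eq_rpow, ← Real.rpow_mul (by positivity),
    Real.mul_rpow h1.le h2.le]
  congr 4 <;> ring

/-- The change of variables on the sphere for the involution along the chords through `a`. -/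
lemma lintegral_comp_chordMap (ha : ‖a‖ < 1) {φ : Space (d + 1) → ℝ≥0∞} (hφ : Measurable φ) :
    ∫⁻ y, ENNReal.ofReal (conformalFactor a y ^ d) * φ (chordMap a y) ∂sigma d
      = ∫⁻ y, φ y ∂sigma d := by
  have h1 := lintegral_ball_polar hφ
  rw [← lintegral_indicator Metric.isOpen_ball.measurableSet,
    ← lintegral_comp_coneReflection ha] at h1
  have hm : Measurable fun x : Space (d + 1) => ENNReal.ofReal (‖coneReflection a x‖ / ‖x‖) *
      (Metric.ball (0 : Space (d + 1)) 1).indicator (fun x => φ (‖x‖⁻¹ • x))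
        (coneReflection a x) := by
    have hi : Measurable ((Metric.ball (0 : Space (d + 1)) 1).indicator
        fun x => φ (‖x‖⁻¹ • x)) :=
      Measurable.indicator (by fun_prop) Metric.isOpen_ball.measurableSet
    exact Measurable.mul (by fun_prop) (hi.comp continuous_coneReflection.measurable)
  rw [lintegral_polar hm, mul_assoc,
    ENNReal.mul_right_inj (sphereArea_ne_zero d) (sphereArea_ne_top d)] at h1
  have hne : ENNReal.ofReal (1 / ((d : ℝ) + 1)) ≠ 0 := by
    simp only [ne_eq, ENNReal.ofReal_eq_zero, not_le]; positivity
  rw [← ENNReal.mul_right_inj hne ENNReal.ofReal_ne_top, ← h1,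
    ← lintegral_const_mul _ (by fun_prop)]
  refine lintegral_congr_ae ?_
  filter_upwards [ae_mem_unitSphere (sigma_compl (d := d))] with y hy
  rw [mem_unitSphere] at hy
  have hl := conformalFactor_pos ha hy
  have hm := norm_coneReflection_of_mem ha hy
  set l := conformalFactor a y with hl_def
  -- On the ray through y the image has norm r/l, so the unit ball becomes r < l. The Jacobian 1/l
  -- times the radial mass l^(d+1)/(d+1) leaves the factor l^d.
  have : ∀ r : Ioi (0 : ℝ), ENNReal.ofReal (‖coneReflection a (r.1 • y)‖ / ‖r.1 • y‖) *
      (Metric.ball (0 : Space (d + 1)) 1).indicator (fun x => φ (‖x‖⁻¹ • x))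
        (coneReflection a (r.1 • y))
      = (Iio (⟨l, mem_Ioi.2 hl⟩ : Ioi (0 : ℝ))).indicator
        (fun _ => ENNReal.ofReal l⁻¹ * φ (chordMap a y)) r := by
    rintro ⟨r, hr⟩
    have hr' : 0 < r := hr
    simp only [coneReflection_smul hr'.le]
    have hq : ‖r • coneReflection a y‖ / ‖r • y‖ = l⁻¹ := by
      rw [norm_smul, norm_smul, hm, hy, Real.norm_eq_abs, abs_of_pos hr', mul_one,
        mul_div_cancel_left₀ _ hr'.ne']
    have h1 : (r • coneReflection a y ∈ Metric.ball (0 : Space (d + 1)) 1) ↔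
        ((⟨r, hr⟩ : Ioi (0 : ℝ)) ∈ Iio (⟨l, mem_Ioi.2 hl⟩ : Ioi (0 : ℝ))) := by
      rw [mem_ball_zero_iff, norm_smul, hm, Real.norm_eq_abs, abs_of_pos hr', mem_Iio,
        Subtype.mk_lt_mk, ← div_eq_mul_inv, div_lt_one hl]
    rw [hq]
    by_cases h : r • coneReflection a y ∈ Metric.ball (0 : Space (d + 1)) 1
    · rw [indicator_of_mem h, indicator_of_mem (h1.1 h), norm_smul, smul_smul, chordMap,
        Real.norm_eq_abs, abs_of_pos hr']
      congr 4
      field_simp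
    · rw [indicator_of_notMem h, indicator_of_notMem (fun h' => h (h1.2 h')), mul_zero]
  simp only [this]
  rw [lintegral_indicator measurableSet_Iio, lintegral_const, Measure.restrict_apply_univ,
    Measure.volumeIoiPow_apply_Iio, mul_right_comm, ← mul_assoc,
    ← ENNReal.ofReal_mul (by positivity), ← ENNReal.ofReal_mul (by positivity)]
  congr 2
  simp only
  rw [pow_succ]
  field_simp

/-- After the substitution y ↦ Ty all powers of λ(y) cancel and the constant potential at Tx
remains. As λ(x)^(s/2) is a multiple of |x - a|^(-s), the weight λ^(d - s/2) is, up to a factor, the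
balayage density of a point mass at a. -/
lemma lintegral_conformalFactor_kernel (ha : ‖a‖ < 1) {s : ℝ} {x : Space (d + 1)}
    (hx : x ∈ unitSphere d) :
    ∫⁻ y, ENNReal.ofReal (conformalFactor a y ^ (d - s / 2)) * edist x y ^ (-s) ∂sigma d
      = ENNReal.ofReal (conformalFactor a x ^ (s / 2)) * sphereEnergy d s := by
  rw [mem_unitSphere] at hx
  have hTx := norm_chordMap ha hx
  rw [← potential_sigma (mem_unitSphere.2 hTx), potential,
    ← lintegral_comp_chordMap ha (by fun_prop), ← lintegral_const_mul _ (by fun_prop)]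
  refine lintegral_congr_ae ?_
  filter_upwards [ae_mem_unitSphere (sigma_compl (d := d))] with y hy
  rw [mem_unitSphere] at hy
  have hl := conformalFactor_pos ha hy
  have hlx := conformalFactor_pos ha hx
  have hk : edist x (chordMap a y) ^ (-s) =
      edist (chordMap a (chordMap a x)) (chordMap a y) ^ (-s) := by
    rw [chordMap_chordMap ha hx]
  rw [hk, edist_chordMap_rpow ha hTx hy, conformalFactor_chordMap ha hy,
    conformalFactor_chordMap ha hx, ← mul_assoc, ← mul_assoc,
    ← ENNReal.ofReal_mul (by positivity), ← ENNReal.ofReal_mul (by positivity)]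
  congr 2
  rw [Real.inv_rpow hl.le, Real.inv_rpow hlx.le, ← Real.rpow_neg hl.le, ← Real.rpow_neg hlx.le,
    ← Real.rpow_natCast, neg_neg, mul_comm (conformalFactor a x ^ (s / 2)), ← mul_assoc,
    ← Real.rpow_add hl, ← Real.rpow_add hl]
  ring_nf
  simp

/-- T inverts λ and has Jacobian λ^d, so it exchanges the exponents p and d - p. -/
lemma lintegral_conformalFactor_symm (ha : ‖a‖ < 1) (s : ℝ) :
    ∫⁻ y, ENNReal.ofReal (conformalFactor a y ^ (d - s / 2)) ∂sigma d
      = ∫⁻ y, ENNReal.ofReal (conformalFactor a y ^ (s / 2)) ∂sigma d := by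
  rw [← lintegral_comp_chordMap ha (by fun_prop)]
  refine lintegral_congr_ae ?_
  filter_upwards [ae_mem_unitSphere (sigma_compl (d := d))] with y hy
  rw [mem_unitSphere] at hy
  have hl := conformalFactor_pos ha hy
  rw [conformalFactor_chordMap ha hy, ← ENNReal.ofReal_mul (by positivity)]
  congr 1
  rw [Real.inv_rpow hl.le, ← Real.rpow_neg hl.le, ← Real.rpow_natCast, ← Real.rpow_add hl]
  ring_nf

lemma conformalFactor_rpow (ha : ‖a‖ < 1) {y : Space (d + 1)} (hy : ‖y‖ = 1) (t : ℝ) :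
    conformalFactor a y ^ t = (1 - ‖a‖ ^ 2) ^ t * ‖y - a‖ ^ (-(2 * t)) := by
  have := one_sub_sq_pos ha
  have h := sub_ne_zero_of_norm ha hy
  rw [conformalFactor, Real.div_rpow this.le (by positivity), ← Real.rpow_natCast ‖y - a‖ 2,
    ← Real.rpow_mul h.le, Real.rpow_neg h.le, div_eq_mul_inv]
  norm_cast

end Kelvin

/-! ### Strict positive definiteness through Gaussian mixtures -/

section PositiveDefinite

lemma ennreal_two_mul_le_add_sq (a b : ℝ≥0∞) : 2 * (a * b) ≤ a * a + b * b := by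
  by_cases ha : a = ∞
  · simp [ha]
  by_cases hb : b = ∞
  · simp [hb]
  lift a to NNReal using ha
  lift b to NNReal using hb
  norm_cast
  have := two_mul_le_add_sq a b
  calc 2 * (a * b) = 2 * a * b := by ring
    _ ≤ a ^ 2 + b ^ 2 := this
    _ = _ := by ring

lemma ennreal_eq_of_add_sq_eq {a b : ℝ≥0∞} (ha : a ≠ ∞) (hb : b ≠ ∞)
    (h : a * a + b * b = 2 * (a * b)) : a = b := by
  lift a to NNReal using ha
  lift b to NNReal using hb
  norm_cast at h ⊢
  have h' : ((a : ℝ)) * a + b * b = 2 * (a * b) := by exact_mod_cast h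
  have : ((a : ℝ) - b) ^ 2 = 0 := by linear_combination h'
  have := pow_eq_zero_iff (two_ne_zero) |>.1 this
  exact_mod_cast sub_eq_zero.1 this

section Factorization

variable {X Ω : Type*} [MeasurableSpace X] [MeasurableSpace Ω]

/-- For a kernel factored as ∫ h(x, ω) h(y, ω) dm(ω), mutual energy is an L² pairing of transforms.
The inequality 2ab ≤ a² + b² then plays the role of positive definiteness, with no subtraction of
possibly infinite energies. -/
lemma lintegral_factor {h : X → Ω → ℝ≥0∞} (hh : Measurable (Function.uncurry h))
    (m : Measure Ω) [SFinite m] (μ ν : Measure X) [SFinite μ] [SFinite ν] :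
    ∫⁻ x, ∫⁻ y, ∫⁻ ω, h x ω * h y ω ∂m ∂ν ∂μ =
      ∫⁻ ω, (∫⁻ x, h x ω ∂μ) * (∫⁻ y, h y ω ∂ν) ∂m := by
  have hx : ∀ x, Measurable (h x) := fun x => hh.of_uncurry_left
  have hω : ∀ ω, Measurable fun x => h x ω := fun ω => hh.of_uncurry_right
  have hG : Measurable fun ω => ∫⁻ y, h y ω ∂ν := hh.lintegral_prod_left'
  have h1 : ∀ x, ∫⁻ y, ∫⁻ ω, h x ω * h y ω ∂m ∂ν = ∫⁻ ω, h x ω * ∫⁻ y, h y ω ∂ν ∂m := by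
    intro x
    rw [lintegral_lintegral_swap]
    · refine lintegral_congr fun ω => ?_
      rw [lintegral_const_mul _ (hω ω)]
    · exact (((hx x).comp measurable_snd).mul hh).aemeasurable
  simp only [h1]
  rw [lintegral_lintegral_swap]
  · refine lintegral_congr fun ω => ?_
    rw [lintegral_mul_const _ (hω ω)]
  · exact (hh.mul (hG.comp measurable_snd)).aemeasurable

lemma two_mul_factor_le {h : X → Ω → ℝ≥0∞} (hh : Measurable (Function.uncurry h))
    (m : Measure Ω) [SFinite m] (μ ν : Measure X) [SFinite μ] [SFinite ν] :
    2 * ∫⁻ x, ∫⁻ y, ∫⁻ ω, h x ω * h y ω ∂m ∂ν ∂μ ≤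
      ∫⁻ x, ∫⁻ y, ∫⁻ ω, h x ω * h y ω ∂m ∂μ ∂μ + ∫⁻ x, ∫⁻ y, ∫⁻ ω, h x ω * h y ω ∂m ∂ν ∂ν := by
  have hμ : Measurable fun ω => ∫⁻ y, h y ω ∂μ := hh.lintegral_prod_left'
  have hν : Measurable fun ω => ∫⁻ y, h y ω ∂ν := hh.lintegral_prod_left'
  have hμν : Measurable fun ω => (∫⁻ y, h y ω ∂μ) * ∫⁻ y, h y ω ∂ν := hμ.mul hν
  have hμμ : Measurable fun ω => (∫⁻ y, h y ω ∂μ) * ∫⁻ y, h y ω ∂μ := hμ.mul hμ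
  rw [lintegral_factor hh, lintegral_factor hh, lintegral_factor hh,
    ← lintegral_const_mul _ hμν, ← lintegral_add_left hμμ]
  exact lintegral_mono fun ω => ennreal_two_mul_le_add_sq _ _

lemma ae_eq_of_factor_eq {h : X → Ω → ℝ≥0∞} (hh : Measurable (Function.uncurry h))
    (m : Measure Ω) [SFinite m] (μ ν : Measure X) [SFinite μ] [SFinite ν]
    (hμt : ∀ᵐ ω ∂m, ∫⁻ x, h x ω ∂μ ≠ ∞) (hνt : ∀ᵐ ω ∂m, ∫⁻ x, h x ω ∂ν ≠ ∞)
    (hfin : ∫⁻ x, ∫⁻ y, ∫⁻ ω, h x ω * h y ω ∂m ∂ν ∂μ ≠ ∞)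
    (heq : ∫⁻ x, ∫⁻ y, ∫⁻ ω, h x ω * h y ω ∂m ∂μ ∂μ + ∫⁻ x, ∫⁻ y, ∫⁻ ω, h x ω * h y ω ∂m ∂ν ∂ν
      = 2 * ∫⁻ x, ∫⁻ y, ∫⁻ ω, h x ω * h y ω ∂m ∂ν ∂μ) :
    ∀ᵐ ω ∂m, ∫⁻ x, h x ω ∂μ = ∫⁻ x, h x ω ∂ν := by
  have hμ : Measurable fun ω => ∫⁻ y, h y ω ∂μ := hh.lintegral_prod_left'
  have hν : Measurable fun ω => ∫⁻ y, h y ω ∂ν := hh.lintegral_prod_left'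
  have hμν : Measurable fun ω => (∫⁻ y, h y ω ∂μ) * ∫⁻ y, h y ω ∂ν := hμ.mul hν
  have hμμ : Measurable fun ω => (∫⁻ y, h y ω ∂μ) * ∫⁻ y, h y ω ∂μ := hμ.mul hμ
  rw [lintegral_factor hh, lintegral_factor hh, lintegral_factor hh,
    ← lintegral_const_mul _ hμν, ← lintegral_add_left hμμ] at heq
  rw [lintegral_factor hh] at hfin
  have := ae_eq_of_ae_le_of_lintegral_le
    (Filter.Eventually.of_forall fun ω => ennreal_two_mul_le_add_sq
      (∫⁻ x, h x ω ∂μ) (∫⁻ x, h x ω ∂ν)) (μ := m)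
    (by
      rw [lintegral_const_mul _ hμν]
      exact ENNReal.mul_ne_top (by norm_num) hfin)
    ((hμ.mul hμ).add (hν.mul hν)).aemeasurable heq.le
  filter_upwards [this, hμt, hνt] with ω h1 h2 h3
  exact ennreal_eq_of_add_sq_eq h2 h3 h1.symm

end Factorization

/-- The Gamma integral writes a negative power as a mixture of exponentials. For u = 0 both sides
are infinite; this case covers the diagonal of the Riesz kernel. -/
lemma lintegral_gamma {c u : ℝ} (hc : 0 < c) (hu : 0 ≤ u) :
    ∫⁻ t in Ioi (0 : ℝ), ENNReal.ofReal (t ^ (c - 1) * Real.exp (-(u * t))) =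
      ENNReal.ofReal (Real.Gamma c) * ENNReal.ofReal u ^ (-c) := by
  have hnn : ∀ᵐ t ∂(volume.restrict (Ioi (0 : ℝ))), 0 ≤ t ^ (c - 1) * Real.exp (-(u * t)) := by
    filter_upwards [ae_restrict_mem measurableSet_Ioi] with t ht
    have : 0 < t := ht
    positivity
  have hG := Real.Gamma_pos_of_pos hc
  rcases hu.eq_or_lt with rfl | hu
  · rw [ENNReal.ofReal_zero, ENNReal.zero_rpow_of_neg (by linarith), ENNReal.mul_top
      (by simpa using hG)]
    by_contra hne
    refine not_integrableOn_Ioi_rpow (c - 1) ?_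
    have := (lintegral_ofReal_ne_top_iff_integrable (by fun_prop) hnn).1 hne
    simpa [IntegrableOn] using this
  · have h := Real.integral_rpow_mul_exp_neg_mul_Ioi hc hu
    have hi : Integrable (fun t : ℝ => t ^ (c - 1) * Real.exp (-(u * t)))
        (volume.restrict (Ioi (0 : ℝ))) := by
      by_contra hn
      rw [integral_undef hn] at h
      have : 0 < (1 / u) ^ c * Real.Gamma c := by positivity
      linarith
    rw [← ofReal_integral_eq_lintegral_ofReal hi hnn, h, ENNReal.ofReal_rpow_of_pos hu, mul_comm,
      ENNReal.ofReal_mul hG.le]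
    congr 2
    rw [one_div, Real.inv_rpow hu.le, Real.rpow_neg hu.le]

variable {d : ℕ}

local notation "⟪" x ", " y "⟫" => inner ℝ x y

/-- Completing the square at the midpoint of x and y: a Gaussian kernel is, up to a constant, the
convolution of a narrower one with itself. -/
lemma lintegral_gaussian_mul {t : ℝ} (ht : 0 < t) (x y : Space (d + 1)) :
    ∫⁻ z, ENNReal.ofReal (Real.exp (-(2 * t) * ‖x - z‖ ^ 2)) *
        ENNReal.ofReal (Real.exp (-(2 * t) * ‖y - z‖ ^ 2)) =
      ENNReal.ofReal ((Real.pi / (4 * t)) ^ (((d : ℝ) + 1) / 2)) *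
        ENNReal.ofReal (Real.exp (-t * ‖x - y‖ ^ 2)) := by
  have key : ∀ z : Space (d + 1), ENNReal.ofReal (Real.exp (-(2 * t) * ‖x - z‖ ^ 2)) *
        ENNReal.ofReal (Real.exp (-(2 * t) * ‖y - z‖ ^ 2)) =
      ENNReal.ofReal (Real.exp (-t * ‖x - y‖ ^ 2)) *
        ENNReal.ofReal (Real.exp (-(4 * t) * ‖z - (1 / 2 : ℝ) • (x + y)‖ ^ 2)) := by
    intro z
    rw [← ENNReal.ofReal_mul (by positivity), ← ENNReal.ofReal_mul (by positivity),
      ← Real.exp_add, ← Real.exp_add]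
    congr 2
    have h : ‖z - (1 / 2 : ℝ) • (x + y)‖ ^ 2 =
        ‖z‖ ^ 2 - (⟪x, z⟫ + ⟪y, z⟫) + (‖x‖ ^ 2 + 2 * ⟪x, y⟫ + ‖y‖ ^ 2) / 4 := by
      rw [norm_sub_sq_real, norm_smul, mul_pow, norm_add_sq_real, inner_smul_right,
        inner_add_right, real_inner_comm x z, real_inner_comm y z]
      norm_num
      ring
    rw [h, norm_sub_sq_real, norm_sub_sq_real, norm_sub_sq_real]
    ring
  simp only [key]
  rw [lintegral_const_mul _ (by fun_prop), mul_comm]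
  congr 1
  rw [lintegral_sub_right_eq_self
    (fun z : Space (d + 1) => ENNReal.ofReal (Real.exp (-(4 * t) * ‖z‖ ^ 2)))]
  have h := GaussianFourier.integral_rexp_neg_mul_sq_norm (V := Space (d + 1))
    (show 0 < 4 * t by linarith)
  have hi : Integrable fun z : Space (d + 1) => Real.exp (-(4 * t) * ‖z‖ ^ 2) := by
    by_contra hn
    rw [integral_undef hn] at h
    have : 0 < (Real.pi / (4 * t)) ^ ((Module.finrank ℝ (Space (d + 1)) : ℝ) / 2) := by
      have := Real.pi_pos
      positivity
    linarith
  rw [← ofReal_integral_eq_lintegral_ofReal hi (Filter.Eventually.of_forall fun z => by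
    simp only [Pi.zero_apply]; positivity), h]
  congr 3
  simp

/-- The weight in the representation of `(ε + r|x-y|²)^{-s/2}` by Gaussians. -/
noncomputable def gaussWeight (d : ℕ) (s ε r t : ℝ) : ℝ :=
  √(t ^ (s / 2 - 1) * Real.exp (-(ε * t)) * ((Real.pi / (4 * (r * t))) ^ (((d : ℝ) + 1) / 2))⁻¹)

/-- The factor `h` with `∫ h(x, ω) h(y, ω) dω` a multiple of `(ε + r|x-y|²)^{-s/2}`. -/
noncomputable def gaussFactor (s ε r : ℝ) (x : Space (d + 1)) (ω : ℝ × Space (d + 1)) : ℝ≥0∞ :=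
  ENNReal.ofReal (gaussWeight d s ε r ω.1) *
    ENNReal.ofReal (Real.exp (-(2 * (r * ω.1)) * ‖x - ω.2‖ ^ 2))

lemma measurable_gaussFactor (s ε r : ℝ) :
    Measurable (Function.uncurry (gaussFactor (d := d) s ε r)) := by
  unfold Function.uncurry gaussFactor gaussWeight
  fun_prop

/-- The measure on the parameter space of the Gaussians. -/
noncomputable def gaussMeasure (d : ℕ) : Measure (ℝ × Space (d + 1)) :=
  (volume.restrict (Ioi 0)).prod volume

instance : SFinite (gaussMeasure d) := by unfold gaussMeasure; infer_instance

lemma gaussWeight_pos {s ε r t : ℝ} (hr : 0 < r) (ht : 0 < t) : 0 < gaussWeight d s ε r t := by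
  have := Real.pi_pos
  unfold gaussWeight; positivity

/-- The kernel `(ε + r|x-y|²)^{-s/2}`. -/
noncomputable def shiftedKernel (s ε r : ℝ) (x y : Space (d + 1)) : ℝ≥0∞ :=
  ENNReal.ofReal (ε + r * ‖x - y‖ ^ 2) ^ (-(s / 2))

/-- Two parameter pairs matter: (0, 1) gives the Riesz kernel, and (1/4, 1/2) gives, for x, y on the
sphere, the bounded kernel |x - y/2|^(-s). -/
lemma shiftedKernel_factor {s ε r : ℝ} (hs : 0 < s) (hε : 0 ≤ ε) (hr : 0 < r)
    (x y : Space (d + 1)) :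
    ∫⁻ ω, gaussFactor s ε r x ω * gaussFactor s ε r y ω ∂gaussMeasure d =
      ENNReal.ofReal (Real.Gamma (s / 2)) * shiftedKernel s ε r x y := by
  have hpi := Real.pi_pos
  rw [shiftedKernel, ← lintegral_gamma (by linarith) (by positivity), gaussMeasure,
    lintegral_prod]
  · refine setLIntegral_congr_fun measurableSet_Ioi fun t ht => ?_
    have ht' : 0 < t := ht
    have hw := gaussWeight_pos (d := d) (s := s) (ε := ε) hr ht'
    have h1 : ∀ z : Space (d + 1), gaussFactor s ε r x (t, z) * gaussFactor s ε r y (t, z) =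
        ENNReal.ofReal (gaussWeight d s ε r t ^ 2) *
        (ENNReal.ofReal (Real.exp (-(2 * (r * t)) * ‖x - z‖ ^ 2)) *
        ENNReal.ofReal (Real.exp (-(2 * (r * t)) * ‖y - z‖ ^ 2))) := by
      intro z
      simp only [gaussFactor]
      rw [pow_two (gaussWeight d s ε r t), ENNReal.ofReal_mul hw.le]
      ring
    simp only [h1]
    rw [lintegral_const_mul _ (by fun_prop), lintegral_gaussian_mul (by positivity),
      ← ENNReal.ofReal_mul (by positivity), ← ENNReal.ofReal_mul (by positivity)]
    congr 1
    have hp : 0 < (Real.pi / (4 * (r * t))) ^ (((d : ℝ) + 1) / 2) := by positivity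
    rw [gaussWeight, Real.sq_sqrt (by positivity), show -((ε + r * ‖x - y‖ ^ 2) * t) =
      -(ε * t) + -(r * t) * ‖x - y‖ ^ 2 by ring, Real.exp_add]
    field_simp
  · have := measurable_gaussFactor (d := d) s ε r
    exact ((this.of_uncurry_left (x := x)).mul (this.of_uncurry_left (x := y))).aemeasurable

lemma lintegral_factor_eq {s ε r : ℝ} (hs : 0 < s) (hε : 0 ≤ ε) (hr : 0 < r)
    (μ ν : Measure (Space (d + 1))) :
    ∫⁻ x, ∫⁻ y, ∫⁻ ω, gaussFactor s ε r x ω * gaussFactor s ε r y ω ∂gaussMeasure d ∂ν ∂μ =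
      ENNReal.ofReal (Real.Gamma (s / 2)) * ∫⁻ x, ∫⁻ y, shiftedKernel s ε r x y ∂ν ∂μ := by
  simp only [shiftedKernel_factor hs hε hr]
  simp only [lintegral_const_mul' _ _ ENNReal.ofReal_ne_top]

lemma shiftedKernel_two_mul_le {s ε r : ℝ} (hs : 0 < s) (hε : 0 ≤ ε) (hr : 0 < r)
    (μ ν : Measure (Space (d + 1))) [SFinite μ] [SFinite ν] :
    2 * ∫⁻ x, ∫⁻ y, shiftedKernel s ε r x y ∂ν ∂μ ≤
      ∫⁻ x, ∫⁻ y, shiftedKernel s ε r x y ∂μ ∂μ + ∫⁻ x, ∫⁻ y, shiftedKernel s ε r x y ∂ν ∂ν := by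
  have h := two_mul_factor_le (measurable_gaussFactor (d := d) s ε r) (gaussMeasure d) μ ν
  rw [lintegral_factor_eq hs hε hr, lintegral_factor_eq hs hε hr, lintegral_factor_eq hs hε hr,
    ← mul_add, mul_left_comm] at h
  have hG : 0 < Real.Gamma (s / 2) := Real.Gamma_pos_of_pos (by linarith)
  exact (ENNReal.mul_le_mul_iff_right (by simpa using hG) ENNReal.ofReal_ne_top).1 h

/-- Finite measures on the sphere with the same Laplace transform are equal. -/
lemma measure_eq_of_integral_exp_inner {μ ν : Measure (Space (d + 1))} [IsFiniteMeasure μ]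
    [IsFiniteMeasure ν] (hμ : μ (unitSphere d)ᶜ = 0)
    (h : ∀ w : Space (d + 1), ∫ x, Real.exp ⟪w, x⟫ ∂μ = ∫ x, Real.exp ⟪w, x⟫ ∂ν) : μ = ν := by
  have hint : ∀ {ρ : Measure (Space (d + 1))} [IsFiniteMeasure ρ], ρ (unitSphere d)ᶜ = 0 →
      ∀ w : Space (d + 1), Integrable (fun x => Real.exp ⟪w, x⟫) ρ := by
    intro ρ _ hρ w
    refine Integrable.of_bound (by fun_prop) (Real.exp ‖w‖) ?_
    filter_upwards [ae_mem_unitSphere hρ] with x hx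
    rw [Real.norm_eq_abs, Real.abs_exp, Real.exp_le_exp]
    have := real_inner_le_norm w x
    rwa [mem_unitSphere.1 hx, mul_one] at this
  have hmass : μ = 0 ↔ ν = 0 := by
    have h0 := h 0
    simp only [inner_zero_left, Real.exp_zero, integral_const, smul_eq_mul, mul_one] at h0
    rw [← Measure.measure_univ_eq_zero, ← Measure.measure_univ_eq_zero (μ := ν),
      ← measureReal_eq_zero_iff, ← measureReal_eq_zero_iff, h0]
  refine Measure.ext_of_charFun (funext fun w => ?_)
  have hm : ProbabilityTheory.mgf (fun x => ⟪w, x⟫) μ =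
      ProbabilityTheory.mgf (fun x => ⟪w, x⟫) ν := by
    funext t
    have := h (t • w)
    simpa only [ProbabilityTheory.mgf, inner_smul_left, conj_trivial] using this
  have huniv : ProbabilityTheory.integrableExpSet (fun x => ⟪w, x⟫) μ = univ := by
    refine eq_univ_of_forall fun t => ?_
    have := hint hμ (t • w)
    simpa only [ProbabilityTheory.integrableExpSet, mem_ofPred_eq, inner_smul_left,
      conj_trivial] using this
  -- The moment generating functions are finite everywhere, so their equality continues analytically
  -- to the imaginary axis, which yields the characteristic functions.
  have := ProbabilityTheory.eqOn_complexMGF_of_mgf' hm hmass (x := Complex.I)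
    (by rw [huniv]; simp)
  rw [ProbabilityTheory.complexMGF, ProbabilityTheory.complexMGF] at this
  rw [charFun_apply, charFun_apply]
  simpa only [mul_comm Complex.I, real_inner_comm w] using this

/-- Continuity in z upgrades the hypothesis to all z. On the sphere |x - z|² = 1 + |z|² - 2⟨x, z⟩,
so the Gaussian centred at z = w/(2T) is a constant times exp⟨w, x⟩. -/
lemma measure_eq_of_gaussian {T : ℝ} (hT : 0 < T) {μ ν : Measure (Space (d + 1))}
    [IsFiniteMeasure μ] [IsFiniteMeasure ν] (hμ : μ (unitSphere d)ᶜ = 0)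
    (hν : ν (unitSphere d)ᶜ = 0)
    (h : ∀ᵐ z : Space (d + 1), ∫⁻ x, ENNReal.ofReal (Real.exp (-T * ‖x - z‖ ^ 2)) ∂μ
      = ∫⁻ x, ENNReal.ofReal (Real.exp (-T * ‖x - z‖ ^ 2)) ∂ν) : μ = ν := by
  have hbd : ∀ x z : Space (d + 1), ‖Real.exp (-T * ‖x - z‖ ^ 2)‖ ≤ 1 := by
    intro x z
    rw [Real.norm_eq_abs, Real.abs_exp, Real.exp_le_one_iff]
    have : 0 ≤ T * ‖x - z‖ ^ 2 := by positivity
    linarith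
  have hint : ∀ (ρ : Measure (Space (d + 1))) [IsFiniteMeasure ρ] (z : Space (d + 1)),
      Integrable (fun x => Real.exp (-T * ‖x - z‖ ^ 2)) ρ := fun ρ _ z =>
    Integrable.of_bound (by fun_prop) 1 (Filter.Eventually.of_forall fun x => hbd x z)
  have hcont : ∀ (ρ : Measure (Space (d + 1))) [IsFiniteMeasure ρ],
      Continuous fun z => ∫ x, Real.exp (-T * ‖x - z‖ ^ 2) ∂ρ := fun ρ _ =>
    continuous_of_dominated (bound := fun _ => 1) (fun z => by fun_prop)
      (fun z => Filter.Eventually.of_forall fun x => hbd x z) (integrable_const _)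
      (Filter.Eventually.of_forall fun x => by fun_prop)
  have hall : (fun z => ∫ x, Real.exp (-T * ‖x - z‖ ^ 2) ∂μ)
      = fun z => ∫ x, Real.exp (-T * ‖x - z‖ ^ 2) ∂ν := by
    refine ((hcont μ).ae_eq_iff_eq volume (hcont ν)).1 ?_
    filter_upwards [h] with z hz
    rw [integral_eq_lintegral_of_nonneg_ae (Filter.Eventually.of_forall fun x => by
        simp only [Pi.zero_apply]; positivity) (by fun_prop),
      integral_eq_lintegral_of_nonneg_ae (Filter.Eventually.of_forall fun x => by
        simp only [Pi.zero_apply]; positivity) (by fun_prop), hz]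
  refine measure_eq_of_integral_exp_inner hμ fun w => ?_
  have hz := congrFun hall ((2 * T)⁻¹ • w)
  have hconv : ∀ (ρ : Measure (Space (d + 1))), ρ (unitSphere d)ᶜ = 0 →
      ∫ x, Real.exp (-T * ‖x - (2 * T)⁻¹ • w‖ ^ 2) ∂ρ =
        Real.exp (-T * (1 + ‖(2 * T)⁻¹ • w‖ ^ 2)) * ∫ x, Real.exp ⟪w, x⟫ ∂ρ := by
    intro ρ hρ
    rw [← integral_const_mul]
    refine integral_congr_ae ?_
    filter_upwards [ae_mem_unitSphere hρ] with x hx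
    rw [← Real.exp_add, norm_sub_sq_real, mem_unitSphere.1 hx, inner_smul_right,
      real_inner_comm w x]
    congr 1
    field_simp
    ring
  rw [hconv μ hμ, hconv ν hν] at hz
  exact mul_left_cancel₀ (Real.exp_pos _).ne' hz

/-- Equality in 2ab ≤ a² + b² forces the Gaussian transforms to agree for almost every scale and
centre; a single scale t > 0 already determines the measure. -/
lemma measure_eq_of_shiftedKernel_eq {s ε r : ℝ} (hs : 0 < s) (hε : 0 ≤ ε) (hr : 0 < r)
    {μ ν : Measure (Space (d + 1))} [IsFiniteMeasure μ] [IsFiniteMeasure ν]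
    (hμ : μ (unitSphere d)ᶜ = 0) (hν : ν (unitSphere d)ᶜ = 0)
    (hfin : ∫⁻ x, ∫⁻ y, shiftedKernel s ε r x y ∂ν ∂μ ≠ ∞)
    (heq : ∫⁻ x, ∫⁻ y, shiftedKernel s ε r x y ∂μ ∂μ + ∫⁻ x, ∫⁻ y, shiftedKernel s ε r x y ∂ν ∂ν
      = 2 * ∫⁻ x, ∫⁻ y, shiftedKernel s ε r x y ∂ν ∂μ) : μ = ν := by
  have htop : ∀ (ρ : Measure (Space (d + 1))) [IsFiniteMeasure ρ],
      ∀ᵐ ω ∂gaussMeasure d, ∫⁻ x, gaussFactor s ε r x ω ∂ρ ≠ ∞ := by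
    intro ρ _
    have hω : ∀ᵐ ω ∂gaussMeasure d, 0 < ω.1 :=
      Measure.quasiMeasurePreserving_fst.ae (ae_restrict_mem measurableSet_Ioi)
    filter_upwards [hω] with ω hω
    refine ne_top_of_le_ne_top (b := ∫⁻ _, ENNReal.ofReal (gaussWeight d s ε r ω.1) ∂ρ) ?_ ?_
    · rw [lintegral_const]
      exact ENNReal.mul_ne_top ENNReal.ofReal_ne_top (measure_ne_top _ _)
    · refine lintegral_mono fun x => ?_
      refine mul_le_of_le_one_right' ?_
      rw [ENNReal.ofReal_le_one, Real.exp_le_one_iff]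
      have : 0 ≤ r * ω.1 * ‖x - ω.2‖ ^ 2 := by positivity
      linarith
  have h := ae_eq_of_factor_eq (measurable_gaussFactor (d := d) s ε r) (gaussMeasure d) μ ν
    (htop μ) (htop ν)
    (by
      rw [lintegral_factor_eq hs hε hr]
      exact ENNReal.mul_ne_top ENNReal.ofReal_ne_top hfin)
    (by
      rw [lintegral_factor_eq hs hε hr, lintegral_factor_eq hs hε hr,
        lintegral_factor_eq hs hε hr, ← mul_add, heq, mul_left_comm])
  have h2 := Measure.ae_ae_of_ae_prod h
  have hne : (ae ((volume : Measure ℝ).restrict (Ioi 0))).NeBot := by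
    rw [ae_neBot, ne_eq, Measure.restrict_eq_zero]
    simp
  obtain ⟨t, ht, ht0⟩ := (h2.and (ae_restrict_mem measurableSet_Ioi)).exists
  have ht' : 0 < t := ht0
  have hw := gaussWeight_pos (d := d) (s := s) (ε := ε) hr ht'
  refine measure_eq_of_gaussian (T := 2 * (r * t)) (by positivity) hμ hν ?_
  filter_upwards [ht] with z hz
  simp only [gaussFactor] at hz
  rwa [lintegral_const_mul' _ _ ENNReal.ofReal_ne_top,
    lintegral_const_mul' _ _ ENNReal.ofReal_ne_top,
    ENNReal.mul_right_inj (by simpa using hw) ENNReal.ofReal_ne_top] at hz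

end PositiveDefinite

/-! ### Minimal energy of the sphere and uniqueness of measures from their potentials -/

section Energy

variable {d : ℕ} {s : ℝ}

lemma shiftedKernel_zero_one (x y : Space (d + 1)) :
    shiftedKernel s 0 1 x y = edist x y ^ (-s) := by
  rw [shiftedKernel, zero_add, one_mul, edist_dist, dist_eq_norm,
    ENNReal.ofReal_pow (norm_nonneg _), ← ENNReal.rpow_natCast, ← ENNReal.rpow_mul]
  congr 1
  push_cast
  ring

lemma two_mul_lintegral_potential_le (hs : 0 < s) (μ ν : Measure (Space (d + 1))) [SFinite μ]
    [SFinite ν] : 2 * ∫⁻ x, potential s ν x ∂μ ≤ energy s μ + energy s ν := by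
  have := shiftedKernel_two_mul_le hs le_rfl one_pos μ ν
  simp only [shiftedKernel_zero_one] at this
  exact this

lemma lintegral_mul_potential {φ : Space (d + 1) → ℝ≥0∞} (hφ : Measurable φ)
    (μ ν : Measure (Space (d + 1))) [SFinite μ] [SFinite ν] :
    ∫⁻ x, φ x * potential s μ x ∂ν = ∫⁻ y, ∫⁻ x, φ x * edist y x ^ (-s) ∂ν ∂μ := by
  simp only [potential]
  have : ∀ x, φ x * ∫⁻ y, edist x y ^ (-s) ∂μ = ∫⁻ y, φ x * edist y x ^ (-s) ∂μ := by
    intro x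
    rw [← lintegral_const_mul _ (by fun_prop)]
    simp only [edist_comm x]
  simp only [this]
  rw [lintegral_lintegral_swap]
  fun_prop

lemma lintegral_potential_comm (μ ν : Measure (Space (d + 1))) [SFinite μ] [SFinite ν] :
    ∫⁻ x, potential s μ x ∂ν = ∫⁻ x, potential s ν x ∂μ := by
  simpa [potential] using lintegral_mul_potential (s := s) (φ := fun _ => 1) measurable_const μ ν

lemma lintegral_potential_sigma {μ : Measure (Space (d + 1))} (hμ : μ (unitSphere d)ᶜ = 0) :
    ∫⁻ x, potential s (sigma d) x ∂μ = sphereEnergy d s * μ univ := by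
  rw [← lintegral_const]
  refine lintegral_congr_ae ?_
  filter_upwards [ae_mem_unitSphere hμ] with x hx
  exact potential_sigma hx

/-- The mutual energy of any probability measure μ on the sphere with σ_d is the constant W, so 2W ≤
I_s[μ] + W. -/
lemma wienerEnergy_unitSphere (hs : 0 < s) (hsd : s < d) :
    wienerEnergy s (unitSphere d) = sphereEnergy d s := by
  have hσ : energy s (sigma d) = sphereEnergy d s := by
    have := lintegral_potential_sigma (s := s) (sigma_compl (d := d))
    rwa [measure_univ, mul_one] at this
  apply le_antisymm
  · rw [← hσ]
    exact iInf₂_le (sigma d) ⟨inferInstance, sigma_compl⟩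
  · refine le_iInf₂ fun μ hμ => ?_
    have := hμ.1
    have h := two_mul_lintegral_potential_le hs μ (sigma d)
    rw [lintegral_potential_sigma hμ.2, measure_univ, mul_one, hσ, two_mul] at h
    exact (ENNReal.add_le_add_iff_right (sphereEnergy_ne_top hs hsd)).1 h

lemma conformalFactor_le {a : Space (d + 1)} (ha : ‖a‖ < 1) {y : Space (d + 1)} (hy : ‖y‖ = 1) :
    conformalFactor a y ≤ (1 + ‖a‖) / (1 - ‖a‖) := by
  have h1 : 1 - ‖a‖ ≤ ‖y - a‖ := by
    have := norm_sub_norm_le y a; rwa [hy] at this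
  have h2 : 0 < 1 - ‖a‖ := by linarith
  have h3 : (1 - ‖a‖) ^ 2 ≤ ‖y - a‖ ^ 2 := by gcongr
  have h4 : (1 + ‖a‖) / (1 - ‖a‖) = (1 - ‖a‖ ^ 2) / (1 - ‖a‖) ^ 2 := by
    field_simp; ring
  have h5 := one_sub_sq_pos ha
  rw [conformalFactor, h4]
  gcongr

lemma lintegral_conformalFactor_ne_top {a : Space (d + 1)} (ha : ‖a‖ < 1) {p : ℝ} (hp : 0 ≤ p)
    {μ : Measure (Space (d + 1))} [IsFiniteMeasure μ] (hμ : μ (unitSphere d)ᶜ = 0) :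
    ∫⁻ y, ENNReal.ofReal (conformalFactor a y ^ p) ∂μ ≠ ∞ := by
  refine ne_top_of_le_ne_top
    (b := ∫⁻ _, ENNReal.ofReal (((1 + ‖a‖) / (1 - ‖a‖)) ^ p) ∂μ) ?_ ?_
  · rw [lintegral_const]
    exact ENNReal.mul_ne_top ENNReal.ofReal_ne_top (measure_ne_top _ _)
  · refine lintegral_mono_ae ?_
    filter_upwards [ae_mem_unitSphere hμ] with y hy
    have hy' := mem_unitSphere.1 hy
    exact ENNReal.ofReal_le_ofReal (Real.rpow_le_rpow (conformalFactor_pos ha hy').le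
      (conformalFactor_le ha hy') hp)

/-- Potential values known only σ_d-almost everywhere on the sphere thus determine the potential at
the interior point a, up to an explicit factor. -/
lemma lintegral_conformalFactor_mul_potential {a : Space (d + 1)} (ha : ‖a‖ < 1)
    {μ : Measure (Space (d + 1))} [SFinite μ] (hμ : μ (unitSphere d)ᶜ = 0) :
    ∫⁻ x, ENNReal.ofReal (conformalFactor a x ^ (d - s / 2)) * potential s μ x ∂sigma d =
      (∫⁻ y, ENNReal.ofReal (conformalFactor a y ^ (s / 2)) ∂μ) * sphereEnergy d s := by
  rw [lintegral_mul_potential (by fun_prop), ← lintegral_mul_const _ (by fun_prop)]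
  refine lintegral_congr_ae ?_
  filter_upwards [ae_mem_unitSphere hμ] with y hy
  exact lintegral_conformalFactor_kernel ha hy

lemma shiftedKernel_eq_conformalFactor {x y : Space (d + 1)} (hx : ‖x‖ = 1) (hy : ‖y‖ = 1) :
    shiftedKernel s (1 / 4) (1 / 2) x y = ENNReal.ofReal ((3 / 4 : ℝ) ^ (-(s / 2))) *
      ENNReal.ofReal (conformalFactor ((1 / 2 : ℝ) • y) x ^ (s / 2)) := by
  have h1 : ‖(1 / 2 : ℝ) • y‖ = 1 / 2 := by rw [norm_smul, hy]; norm_num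
  have h2 : ‖x - (1 / 2 : ℝ) • y‖ ^ 2 = 1 / 4 + 1 / 2 * ‖x - y‖ ^ 2 := by
    rw [norm_sub_sq_real, norm_sub_sq_real, h1, hx, hy, inner_smul_right]
    ring
  rw [shiftedKernel, conformalFactor, h2, h1]
  have hu : 0 < 1 / 4 + 1 / 2 * ‖x - y‖ ^ 2 := by positivity
  generalize 1 / 4 + 1 / 2 * ‖x - y‖ ^ 2 = u at hu
  rw [← ENNReal.ofReal_mul (by positivity), ENNReal.ofReal_rpow_of_pos hu,
    show (1 - (1 / 2 : ℝ) ^ 2) = 3 / 4 by norm_num, Real.div_rpow (by norm_num) hu.le,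
    ← mul_div_assoc, ← Real.rpow_add (by norm_num), neg_add_cancel, Real.rpow_zero,
    Real.rpow_neg hu.le, one_div]

/-- A measure on the sphere is determined by its mass and its potential up to a constant. -/
lemma measure_eq_of_potential_ae_eq (hs : 0 < s) (hsd : s < d) {μ ν : Measure (Space (d + 1))}
    [IsFiniteMeasure μ] [IsFiniteMeasure ν] (hμ : μ (unitSphere d)ᶜ = 0)
    (hν : ν (unitSphere d)ᶜ = 0) (hmass : μ univ = ν univ) {c₁ c₂ : ℝ≥0∞} (hc₁ : c₁ ≠ ∞)
    (h : ∀ᵐ x ∂sigma d, potential s μ x + c₁ = potential s ν x + c₂) : μ = ν := by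
  have hW0 := sphereEnergy_pos (d := d) hs
  have hWt := sphereEnergy_ne_top hs hsd
  have hp : 0 ≤ (d : ℝ) - s / 2 := by linarith
  have key : ∀ a : Space (d + 1), ‖a‖ < 1 →
      (∫⁻ y, ENNReal.ofReal (conformalFactor a y ^ (s / 2)) ∂μ) * sphereEnergy d s +
        (∫⁻ x, ENNReal.ofReal (conformalFactor a x ^ (d - s / 2)) ∂sigma d) * c₁ =
      (∫⁻ y, ENNReal.ofReal (conformalFactor a y ^ (s / 2)) ∂ν) * sphereEnergy d s +
        (∫⁻ x, ENNReal.ofReal (conformalFactor a x ^ (d - s / 2)) ∂sigma d) * c₂ := by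
    intro a ha
    rw [← lintegral_conformalFactor_mul_potential ha hμ,
      ← lintegral_conformalFactor_mul_potential ha hν, ← lintegral_mul_const _ (by fun_prop),
      ← lintegral_mul_const _ (by fun_prop), ← lintegral_add_right _ (by fun_prop),
      ← lintegral_add_right _ (by fun_prop)]
    refine lintegral_congr_ae ?_
    filter_upwards [h] with x hx
    rw [← mul_add, hx, mul_add]
  -- At a = 0 the conformal factor is 1 on the sphere, so equal masses force equal constants.
  have hcc : c₁ = c₂ := by
    have h0 := key 0 (by simp)
    have hone : ∀ (ρ : Measure (Space (d + 1))) (p : ℝ), ρ (unitSphere d)ᶜ = 0 →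
        ∫⁻ y, ENNReal.ofReal (conformalFactor 0 y ^ p) ∂ρ = ρ univ := by
      intro ρ p hρ
      rw [← one_mul (ρ univ), ← lintegral_const]
      refine lintegral_congr_ae ?_
      filter_upwards [ae_mem_unitSphere hρ] with y hy
      simp [conformalFactor, mem_unitSphere.1 hy]
    rw [hone _ _ hμ, hone _ _ hν, hone _ _ sigma_compl, hmass, measure_univ (μ := sigma d), one_mul,
      one_mul] at h0
    exact (ENNReal.add_right_inj (ENNReal.mul_ne_top (measure_ne_top _ _) hWt)).1 h0
  have key2 : ∀ a : Space (d + 1), ‖a‖ < 1 →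
      ∫⁻ y, ENNReal.ofReal (conformalFactor a y ^ (s / 2)) ∂μ =
      ∫⁻ y, ENNReal.ofReal (conformalFactor a y ^ (s / 2)) ∂ν := by
    intro a ha
    have h0 := key a ha
    rw [← hcc, ENNReal.add_left_inj (ENNReal.mul_ne_top
      (lintegral_conformalFactor_ne_top ha hp sigma_compl) hc₁)] at h0
    exact (ENNReal.mul_left_inj hW0 hWt).1 h0
  -- The Riesz energies of μ and ν may be infinite and the hypothesis ignores σ_d-null sets. Taking
  -- a = x/2 replaces the Riesz kernel by a bounded one whose potentials agree at every point of the
  -- sphere.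
  have key3 : ∀ x ∈ unitSphere d, ∫⁻ y, shiftedKernel s (1 / 4) (1 / 2) x y ∂μ =
      ∫⁻ y, shiftedKernel s (1 / 4) (1 / 2) x y ∂ν := by
    intro x hx
    have hx' := mem_unitSphere.1 hx
    have hb : ‖(1 / 2 : ℝ) • x‖ < 1 := by rw [norm_smul, hx']; norm_num
    have hρ : ∀ (ρ : Measure (Space (d + 1))), ρ (unitSphere d)ᶜ = 0 →
        ∫⁻ y, shiftedKernel s (1 / 4) (1 / 2) x y ∂ρ = ENNReal.ofReal ((3 / 4 : ℝ) ^ (-(s / 2))) *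
          ∫⁻ y, ENNReal.ofReal (conformalFactor ((1 / 2 : ℝ) • x) y ^ (s / 2)) ∂ρ := by
      intro ρ hρ
      rw [← lintegral_const_mul _ (by fun_prop)]
      refine lintegral_congr_ae ?_
      filter_upwards [ae_mem_unitSphere hρ] with y hy
      rw [← shiftedKernel_eq_conformalFactor (mem_unitSphere.1 hy) hx', shiftedKernel,
        shiftedKernel, norm_sub_rev]
    rw [hρ μ hμ, hρ ν hν, key2 _ hb]
  have e1 : ∫⁻ x, ∫⁻ y, shiftedKernel s (1 / 4) (1 / 2) x y ∂μ ∂μ =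
      ∫⁻ x, ∫⁻ y, shiftedKernel s (1 / 4) (1 / 2) x y ∂ν ∂μ := by
    refine lintegral_congr_ae ?_
    filter_upwards [ae_mem_unitSphere hμ] with x hx using key3 x hx
  have e2 : ∫⁻ x, ∫⁻ y, shiftedKernel s (1 / 4) (1 / 2) x y ∂ν ∂ν =
      ∫⁻ x, ∫⁻ y, shiftedKernel s (1 / 4) (1 / 2) x y ∂ν ∂μ := by
    refine Eq.trans ?_ (lintegral_lintegral_swap
      (f := fun x y => shiftedKernel s (1 / 4) (1 / 2) x y)
      (by unfold shiftedKernel Function.uncurry; fun_prop)).symm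
    refine lintegral_congr_ae ?_
    filter_upwards [ae_mem_unitSphere hν] with x hx
    rw [← key3 x hx]
    simp only [shiftedKernel, norm_sub_rev x]
  refine measure_eq_of_shiftedKernel_eq hs (by norm_num : (0 : ℝ) ≤ 1 / 4)
    (by norm_num : (0 : ℝ) < 1 / 2) hμ hν ?_ (by rw [e1, e2, two_mul])
  refine ne_top_of_le_ne_top (b := ∫⁻ _, ∫⁻ _, ENNReal.ofReal (1 / 4) ^ (-(s / 2)) ∂ν ∂μ) ?_ ?_
  · rw [lintegral_const, lintegral_const]
    refine ENNReal.mul_ne_top (ENNReal.mul_ne_top ?_ (measure_ne_top _ _)) (measure_ne_top _ _)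
    rw [ENNReal.ofReal_rpow_of_pos (by norm_num)]
    exact ENNReal.ofReal_ne_top
  · refine lintegral_mono fun x => lintegral_mono fun y => ?_
    refine rpow_neg_le_rpow_neg (by linarith) (ENNReal.ofReal_le_ofReal ?_)
    have : 0 ≤ 1 / 2 * ‖x - y‖ ^ 2 := by positivity
    linarith

end Energy

/-! ### The potential of the surface measure along the polar axis -/

section Radial

variable {d : ℕ}

local notation "⟪" x ", " y "⟫" => inner ℝ x y

lemma norm_source (d : ℕ) (R : ℝ) : ‖source d R‖ = |R| := by
  simp [source]

lemma norm_source_lt_one {R : ℝ} (hR : |R| < 1) : ‖source d R‖ < 1 := by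
  rwa [norm_source]

lemma norm_sub_source_sq (y : Space (d + 1)) (R : ℝ) :
    ‖y - source d R‖ ^ 2 = ‖y‖ ^ 2 - 2 * R * y (Fin.last d) + R ^ 2 := by
  rw [norm_sub_sq_real, norm_source, sq_abs, source, EuclideanSpace.inner_single_right]
  simp only [conj_trivial]
  ring

lemma one_sub_le_norm_sub_source {y : Space (d + 1)} (hy : ‖y‖ = 1) (R : ℝ) :
    1 - |R| ≤ ‖y - source d R‖ := by
  have := norm_sub_norm_le y (source d R)
  rwa [hy, norm_source] at this

lemma norm_sub_source_pos {y : Space (d + 1)} (hy : ‖y‖ = 1) {R : ℝ} (hR : |R| < 1) :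
    0 < ‖y - source d R‖ := by
  have := one_sub_le_norm_sub_source hy R
  linarith

lemma norm_sub_source_rpow_le {t : ℝ} (ht : 0 ≤ t) {y : Space (d + 1)} (hy : ‖y‖ = 1) {R : ℝ}
    (hR : |R| < 1) : ‖y - source d R‖ ^ (-t) ≤ (1 - |R|) ^ (-t) :=
  Real.rpow_le_rpow_of_nonpos (by linarith) (one_sub_le_norm_sub_source hy R) (by linarith)

/-- The potential of `σ_d` at `(0, R)`, as a real function of `R`. -/
noncomputable def radialPotential (d : ℕ) (t R : ℝ) : ℝ :=
  ∫ y, ‖y - source d R‖ ^ (-t) ∂sigma d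

lemma integrable_norm_sub_source {t : ℝ} (ht : 0 ≤ t) {R : ℝ} (hR : |R| < 1) :
    Integrable (fun y => ‖y - source d R‖ ^ (-t)) (sigma d) := by
  refine Integrable.of_bound (Measurable.aestronglyMeasurable (by fun_prop)) ((1 - |R|) ^ (-t)) ?_
  filter_upwards [ae_mem_unitSphere (sigma_compl (d := d))] with y hy
  rw [Real.norm_eq_abs, abs_of_nonneg (by positivity)]
  exact norm_sub_source_rpow_le ht (mem_unitSphere.1 hy) hR

lemma radialPotential_le {t : ℝ} (ht : 0 ≤ t) {R : ℝ} (hR : |R| < 1) :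
    radialPotential d t R ≤ (1 - |R|) ^ (-t) := by
  have : radialPotential d t R ≤ ∫ _, (1 - |R|) ^ (-t) ∂sigma d := by
    refine integral_mono_ae (integrable_norm_sub_source ht hR) (integrable_const _) ?_
    filter_upwards [ae_mem_unitSphere (sigma_compl (d := d))] with y hy
    exact norm_sub_source_rpow_le ht (mem_unitSphere.1 hy) hR
  simpa using this

lemma radialPotential_zero (t : ℝ) : radialPotential d t 0 = 1 := by
  have : radialPotential d t 0 = ∫ _, (1 : ℝ) ∂sigma d := by
    refine integral_congr_ae ?_
    filter_upwards [ae_mem_unitSphere (sigma_compl (d := d))] with y hy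
    have : source d 0 = 0 := by simp [source]
    rw [this, sub_zero, mem_unitSphere.1 hy, Real.one_rpow]
  simpa using this

lemma lintegral_norm_sub_source {t : ℝ} {R : ℝ} :
    radialPotential d t R =
      (∫⁻ y, ENNReal.ofReal (‖y - source d R‖ ^ (-t)) ∂sigma d).toReal := by
  rw [radialPotential, integral_eq_lintegral_of_nonneg_ae
    (Filter.Eventually.of_forall fun y => by simp only [Pi.zero_apply]; positivity)
    (Measurable.aestronglyMeasurable (by fun_prop))]

lemma toReal_potential_sigma_source {s R : ℝ} (hR : |R| < 1) :
    (potential s (sigma d) (source d R)).toReal = radialPotential d s R := by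
  rw [lintegral_norm_sub_source, potential]
  congr 1
  refine lintegral_congr_ae ?_
  filter_upwards [ae_mem_unitSphere (sigma_compl (d := d))] with y hy
  rw [← ENNReal.ofReal_rpow_of_pos (norm_sub_source_pos (mem_unitSphere.1 hy) hR), edist_comm,
    edist_dist, dist_eq_norm]

lemma one_sub_sq_pos_of_abs {R : ℝ} (hR : |R| < 1) : 0 < 1 - R ^ 2 := by
  have := (sq_lt_one_iff_abs_lt_one R).2 hR
  linarith

lemma lintegral_conformalFactor_source {p R : ℝ} (hR : |R| < 1) :
    (∫⁻ y, ENNReal.ofReal (conformalFactor (source d R) y ^ p) ∂sigma d).toReal =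
      (1 - R ^ 2) ^ p * radialPotential d (2 * p) R := by
  have hA := one_sub_sq_pos_of_abs hR
  rw [lintegral_norm_sub_source, ← ENNReal.toReal_ofReal (show 0 ≤ (1 - R ^ 2) ^ p by positivity),
    ← ENNReal.toReal_mul, ← lintegral_const_mul _ (by fun_prop)]
  congr 1
  refine lintegral_congr_ae ?_
  filter_upwards [ae_mem_unitSphere (sigma_compl (d := d))] with y hy
  rw [conformalFactor_rpow (norm_source_lt_one hR) (mem_unitSphere.1 hy), norm_source, sq_abs,
    ENNReal.ofReal_mul (by positivity)]

/-- The exponent exchange of `lintegral_conformalFactor_symm`, read along the axis. -/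
lemma radialPotential_symm (t : ℝ) {R : ℝ} (hR : |R| < 1) :
    radialPotential d t R = (1 - R ^ 2) ^ (d - t) * radialPotential d (2 * d - t) R := by
  have hA := one_sub_sq_pos_of_abs hR
  have h := congrArg ENNReal.toReal
    (lintegral_conformalFactor_symm (d := d) (norm_source_lt_one (d := d) hR) t)
  rw [lintegral_conformalFactor_source hR, lintegral_conformalFactor_source hR,
    show 2 * ((d : ℝ) - t / 2) = 2 * d - t by ring, show 2 * (t / 2) = t by ring,
    show (d : ℝ) - t / 2 = (d - t) + t / 2 by ring, Real.rpow_add hA] at h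
  have hp : (1 - R ^ 2) ^ (t / 2) ≠ 0 := by positivity
  refine mul_left_cancel₀ hp ?_
  rw [← h]
  ring

/-- The derivative of the potential of `σ_d` along the polar axis. -/
noncomputable def radialDeriv (d : ℕ) (t R : ℝ) : ℝ :=
  ∫ y, -t * (R - y (Fin.last d)) * ‖y - source d R‖ ^ (-(t + 2)) ∂sigma d

lemma abs_sub_last_le {y : Space (d + 1)} (R : ℝ) :
    |R - y (Fin.last d)| ≤ ‖y - source d R‖ := by
  have := PiLp.norm_apply_le (y - source d R) (Fin.last d)
  simpa [source, abs_sub_comm] using this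

lemma hasDerivAt_radialPotential {t : ℝ} (ht : 0 ≤ t) {R : ℝ} (hR : |R| < 1) :
    HasDerivAt (radialPotential d t) (radialDeriv d t R) R := by
  -- For |x| < ρ < 1 the distance from (0, x) to the sphere is at least 1 - ρ, which gives a uniform
  -- bound for the differentiated integrand.
  obtain ⟨ρ, hρ, hρ1⟩ := exists_between hR
  have hρ0 : 0 ≤ ρ := (abs_nonneg R).trans hρ.le
  have hnhds : Ioo (-ρ) ρ ∈ nhds R := Ioo_mem_nhds (by linarith [(abs_lt.1 hρ).1]) (abs_lt.1 hρ).2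
  refine (hasDerivAt_integral_of_dominated_loc_of_deriv_le (μ := sigma d)
    (F := fun R y => ‖y - source d R‖ ^ (-t))
    (F' := fun R y => -t * (R - y (Fin.last d)) * ‖y - source d R‖ ^ (-(t + 2)))
    (bound := fun _ => t * 2 * (1 - ρ) ^ (-(t + 2))) hnhds
    (Filter.Eventually.of_forall fun R => Measurable.aestronglyMeasurable (by fun_prop))
    (integrable_norm_sub_source ht hR) (Measurable.aestronglyMeasurable (by fun_prop)) ?_
    (integrable_const _) ?_).2
  · filter_upwards [ae_mem_unitSphere (sigma_compl (d := d))] with y hy x hx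
    have hy' := mem_unitSphere.1 hy
    have hx' : |x| < ρ := abs_lt.2 hx
    have hx1 : |x| < 1 := hx'.trans hρ1
    have h1 : |x - y (Fin.last d)| ≤ 2 := by
      refine (abs_sub_last_le x).trans ((norm_sub_le _ _).trans ?_)
      rw [hy', norm_source]; linarith
    have h2 := norm_sub_source_rpow_le (t := t + 2) (by linarith) hy' hx1
    have h3 : (1 - |x|) ^ (-(t + 2)) ≤ (1 - ρ) ^ (-(t + 2)) :=
      Real.rpow_le_rpow_of_nonpos (by linarith) (by linarith) (by linarith)
    have h4 : 0 ≤ ‖y - source d x‖ ^ (-(t + 2)) := by positivity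
    rw [Real.norm_eq_abs, abs_mul, abs_mul, abs_neg, abs_of_nonneg ht, abs_of_nonneg h4]
    have h5 := h2.trans h3
    gcongr
  · filter_upwards [ae_mem_unitSphere (sigma_compl (d := d))] with y hy x hx
    have hy' := mem_unitSphere.1 hy
    have hx1 : |x| < 1 := (abs_lt.2 hx).trans hρ1
    have hpos := norm_sub_source_pos hy' hx1
    have hb : ∀ z : ℝ, ‖y - source d z‖ ^ (-t) =
        (‖y‖ ^ 2 - 2 * z * y (Fin.last d) + z ^ 2) ^ (-(t / 2)) := by
      intro z
      rw [← norm_sub_source_sq, ← Real.rpow_natCast, ← Real.rpow_mul (norm_nonneg _)]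
      congr 1; push_cast; ring
    have hd : HasDerivAt (fun z : ℝ => ‖y‖ ^ 2 - 2 * z * y (Fin.last d) + z ^ 2)
        (2 * (x - y (Fin.last d))) x := by
      have h1 := (((hasDerivAt_id x).const_mul 2).mul_const (y (Fin.last d))).const_sub (‖y‖ ^ 2)
      have h2 := h1.add ((hasDerivAt_id x).pow 2)
      refine h2.congr_deriv ?_
      simp; ring
    have hne : ‖y‖ ^ 2 - 2 * x * y (Fin.last d) + x ^ 2 ≠ 0 := by
      rw [← norm_sub_source_sq]; positivity
    have h := hd.rpow_const (p := -(t / 2)) (Or.inl hne)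
    simp only [hb]
    refine h.congr_deriv ?_
    rw [← norm_sub_source_sq, ← Real.rpow_natCast, ← Real.rpow_mul (norm_nonneg _),
      show ((2 : ℕ) : ℝ) * (-(t / 2) - 1) = -(t + 2) by push_cast; ring]
    ring

/-- On the sphere 2R(R - y_last) = |y - a|² - (1 - R²), so the derivative is a combination of
potentials with exponents t and t + 2. -/
lemma two_mul_radialDeriv {t : ℝ} (ht : 0 ≤ t) {R : ℝ} (hR : |R| < 1) :
    2 * R * radialDeriv d t R =
      t * ((1 - R ^ 2) * radialPotential d (t + 2) R - radialPotential d t R) := by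
  rw [radialDeriv, radialPotential, radialPotential, ← integral_const_mul, ← integral_const_mul,
    ← integral_sub ((integrable_norm_sub_source (by linarith) hR).const_mul _)
      (integrable_norm_sub_source ht hR), ← integral_const_mul]
  refine integral_congr_ae ?_
  filter_upwards [ae_mem_unitSphere (sigma_compl (d := d))] with y hy
  have hy' := mem_unitSphere.1 hy
  have hpos := norm_sub_source_pos hy' hR
  have h1 : ‖y - source d R‖ ^ (-t) = ‖y - source d R‖ ^ 2 * ‖y - source d R‖ ^ (-(t + 2)) := by
    rw [← Real.rpow_natCast, ← Real.rpow_add hpos]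
    congr 1; push_cast; ring
  rw [h1, norm_sub_source_sq, hy']
  ring

lemma radialDeriv_le {t : ℝ} (ht : 0 ≤ t) {R : ℝ} (hR : |R| < 1) :
    radialDeriv d t R ≤ t * (1 - |R|) ^ (-(t + 1)) := by
  have h1R : 0 < 1 - |R| := by linarith
  have : ‖radialDeriv d t R‖ ≤ t * (1 - |R|) ^ (-(t + 1)) * (sigma d).real univ := by
    refine norm_integral_le_of_norm_le_const ?_
    filter_upwards [ae_mem_unitSphere (sigma_compl (d := d))] with y hy
    have hy' := mem_unitSphere.1 hy
    have hpos := norm_sub_source_pos hy' hR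
    have h4 : 0 ≤ ‖y - source d R‖ ^ (-(t + 2)) := by positivity
    rw [Real.norm_eq_abs, abs_mul, abs_mul, abs_neg, abs_of_nonneg ht, abs_of_nonneg h4, mul_assoc]
    refine mul_le_mul_of_nonneg_left ?_ ht
    calc |R - y (Fin.last d)| * ‖y - source d R‖ ^ (-(t + 2))
        ≤ ‖y - source d R‖ * ‖y - source d R‖ ^ (-(t + 2)) := by
          gcongr; exact abs_sub_last_le R
      _ = ‖y - source d R‖ ^ (-(t + 1)) := by
          rw [← Real.rpow_one_add' hpos.le (by linarith)]; congr 1; ring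
      _ ≤ _ := norm_sub_source_rpow_le (by linarith) hy' hR
  rw [probReal_univ, mul_one] at this
  exact (le_abs_self _).trans this

end Radial

/-! ### Monotonicity and range of the threshold function -/

section Gonchar

variable {d : ℕ} {s : ℝ}

/-- The function of `R` whose comparison with `W_s / q` gives the sign of the Gonchar function. -/
noncomputable def threshold (d : ℕ) (s R : ℝ) : ℝ :=
  (1 + R) ^ ((d : ℝ) - s) * (1 - R) ^ (-(d : ℝ)) - radialPotential d s R

lemma abs_lt_one_of_mem_Ico {R : ℝ} (hR : R ∈ Ico (0 : ℝ) 1) : |R| < 1 := by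
  rw [abs_of_nonneg hR.1]; exact hR.2

lemma goncharB_eq (hs : 0 < s) (hsd : s < d) (q : ℝ) {R : ℝ} (hR : R ∈ Ico (0 : ℝ) 1) :
    goncharB d s q R = (1 - R) ^ d * ((sphereEnergy d s).toReal / q - threshold d s R) := by
  have h1 : 0 < 1 - R := by linarith [hR.2]
  rw [goncharB, wienerEnergy_unitSphere hs hsd,
    toReal_potential_sigma_source (abs_lt_one_of_mem_Ico hR), threshold, Real.rpow_neg h1.le,
    Real.rpow_natCast]
  field_simp
  ring

lemma threshold_zero : threshold d s 0 = 0 := by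
  simp [threshold, radialPotential_zero]

lemma hasDerivAt_threshold (hs : 0 < s) {R : ℝ} (hR : |R| < 1) :
    HasDerivAt (threshold d s) (((d : ℝ) - s) * (1 + R) ^ ((d : ℝ) - s - 1) * (1 - R) ^ (-(d : ℝ)) +
      (1 + R) ^ ((d : ℝ) - s) * (d * (1 - R) ^ (-(d : ℝ) - 1)) - radialDeriv d s R) R := by
  have hR' := abs_lt.1 hR
  have h1 := (((hasDerivAt_id R).const_add 1).rpow_const (p := (d : ℝ) - s)
    (Or.inl (show 1 + R ≠ 0 by linarith [hR'.1])))
  have h2 := (((hasDerivAt_id R).const_sub 1).rpow_const (p := -(d : ℝ))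
    (Or.inl (show 1 - R ≠ 0 by linarith [hR'.2])))
  refine ((h1.mul h2).sub (hasDerivAt_radialPotential hs.le hR)).congr_deriv ?_
  simp only [id_eq]
  ring

lemma continuousOn_threshold (hs : 0 < s) : ContinuousOn (threshold d s) (Ico 0 1) := fun _ hR =>
  (hasDerivAt_threshold hs (abs_lt_one_of_mem_Ico hR)).continuousAt.continuousWithinAt

/-- Differentiating (1 - R)^(-d) alone contributes at least d(1 - R)^(-d-1), which exceeds s(1 -
R)^(-s-1), a bound for the derivative of the potential. -/
lemma strictMonoOn_threshold (hs : 0 < s) (hsd : s < d) :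
    StrictMonoOn (threshold d s) (Ico 0 1) := by
  refine strictMonoOn_of_deriv_pos (convex_Ico 0 1) (continuousOn_threshold hs) fun R hR => ?_
  rw [interior_Ico] at hR
  have hR1 : |R| < 1 := abs_lt_one_of_mem_Ico ⟨hR.1.le, hR.2⟩
  rw [(hasDerivAt_threshold hs hR1).deriv]
  have h0 := hR.1
  have h1 : 0 < 1 - R := by linarith [hR.2]
  have hA : 0 ≤ ((d : ℝ) - s) * (1 + R) ^ ((d : ℝ) - s - 1) * (1 - R) ^ (-(d : ℝ)) := by
    have : 0 ≤ (d : ℝ) - s := by linarith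
    positivity
  have hB : 1 ≤ (1 + R) ^ ((d : ℝ) - s) := Real.one_le_rpow (by linarith) (by linarith)
  have hC : (1 - R) ^ (-(s + 1)) ≤ (1 - R) ^ (-(d : ℝ) - 1) :=
    Real.rpow_le_rpow_of_exponent_ge h1 (by linarith) (by linarith)
  have hD := radialDeriv_le (d := d) hs.le hR1
  rw [abs_of_pos h0] at hD
  have hE : 0 < (1 - R) ^ (-(s + 1)) := by positivity
  have hd : (0 : ℝ) < d := hs.trans hsd
  have hF : s * (1 - R) ^ (-(s + 1)) < d * (1 - R) ^ (-(d : ℝ) - 1) := by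
    calc s * (1 - R) ^ (-(s + 1)) < d * (1 - R) ^ (-(s + 1)) := by gcongr
      _ ≤ _ := by gcongr
  have hG : d * (1 - R) ^ (-(d : ℝ) - 1) ≤
      (1 + R) ^ ((d : ℝ) - s) * (d * (1 - R) ^ (-(d : ℝ) - 1)) := by
    refine le_mul_of_one_le_left (by positivity) hB
  linarith

/-- At R = 1 - e with e ≤ 1/2 the first term is at least (3/2)^(d-s) e^(-d) and the potential at
most e^(-s) ≤ (1/2)^(d-s) e^(-d). The difference is at least k e^(-d) ≥ k/e, and e is chosen so that
k/e ≥ |c| + 1. -/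
lemma exists_threshold_gt (hs : 0 < s) (hsd : s < d) (c : ℝ) :
    ∃ R ∈ Ioo (0 : ℝ) 1, c < threshold d s R := by
  have hp : 0 < (d : ℝ) - s := by linarith
  set k : ℝ := (3 / 2) ^ ((d : ℝ) - s) - (1 / 2) ^ ((d : ℝ) - s) with hk
  have hk0 : 0 < k := by
    have : (1 / 2 : ℝ) ^ ((d : ℝ) - s) < (3 / 2) ^ ((d : ℝ) - s) :=
      Real.rpow_lt_rpow (by norm_num) (by norm_num) hp
    linarith
  set e : ℝ := min (1 / 2) (k / (|c| + 1)) with he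
  have hc1 : 0 < |c| + 1 := by positivity
  have he0 : 0 < e := lt_min (by norm_num) (by positivity)
  have he1 : e ≤ 1 / 2 := min_le_left _ _
  have he2 : e * (|c| + 1) ≤ k := by
    rw [← le_div_iff₀ hc1]; exact min_le_right _ _
  have hR : 1 - e ∈ Ico (0 : ℝ) 1 := ⟨by linarith, by linarith⟩
  refine ⟨1 - e, ⟨by linarith, by linarith⟩, ?_⟩
  have h1 := radialPotential_le (d := d) hs.le (abs_lt_one_of_mem_Ico hR)
  rw [abs_of_nonneg hR.1, sub_sub_cancel] at h1
  have h2 : (3 / 2 : ℝ) ^ ((d : ℝ) - s) ≤ (1 + (1 - e)) ^ ((d : ℝ) - s) :=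
    Real.rpow_le_rpow (by norm_num) (by linarith) hp.le
  have h3 : e ^ ((d : ℝ) - s) ≤ (1 / 2) ^ ((d : ℝ) - s) := Real.rpow_le_rpow he0.le he1 hp.le
  have h4 : e ^ (-s) = e ^ ((d : ℝ) - s) * e ^ (-(d : ℝ)) := by
    rw [← Real.rpow_add he0]; congr 1; ring
  have hd : (1 : ℝ) ≤ d := by
    have : 0 < d := by
      have : (0 : ℝ) < d := hs.trans hsd
      exact_mod_cast this
    exact_mod_cast this
  have h5 : e ^ (-1 : ℝ) ≤ e ^ (-(d : ℝ)) :=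
    Real.rpow_le_rpow_of_exponent_ge he0 (by linarith) (by linarith)
  have h6 : |c| + 1 ≤ k * e ^ (-1 : ℝ) := by
    rw [Real.rpow_neg_one, ← div_eq_mul_inv, le_div_iff₀ he0]; linarith
  have h7 : 0 ≤ e ^ (-(d : ℝ)) := by positivity
  have h8 : k * e ^ (-(d : ℝ)) ≤ threshold d s (1 - e) := by
    rw [threshold, sub_sub_cancel]
    have : k * e ^ (-(d : ℝ)) ≤
        ((1 + (1 - e)) ^ ((d : ℝ) - s) - e ^ ((d : ℝ) - s)) * e ^ (-(d : ℝ)) := by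
      refine mul_le_mul_of_nonneg_right ?_ h7
      linarith
    rw [sub_mul _ (e ^ ((d : ℝ) - s)), ← h4] at this
    linarith
  have h9 : k * e ^ (-1 : ℝ) ≤ k * e ^ (-(d : ℝ)) := by gcongr
  have := le_abs_self c
  linarith

lemma exists_threshold_eq (hs : 0 < s) (hsd : s < d) {c : ℝ} (hc : 0 < c) :
    ∃ R ∈ Ioo (0 : ℝ) 1, threshold d s R = c := by
  obtain ⟨R₁, hR₁, h⟩ := exists_threshold_gt hs hsd c
  have hcont : ContinuousOn (threshold d s) (Icc 0 R₁) :=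
    (continuousOn_threshold hs).mono fun x hx => ⟨hx.1, hx.2.trans_lt hR₁.2⟩
  obtain ⟨R, hR, hRc⟩ := intermediate_value_Ioo hR₁.1.le hcont
    (show c ∈ Ioo (threshold d s 0) (threshold d s R₁) from ⟨by rwa [threshold_zero], h⟩)
  exact ⟨R, ⟨hR.1, hR.2.trans hR₁.2⟩, hRc⟩

end Gonchar

/-! ### Polynomiality for s = d - 1 - 2m through a radial differential equation -/

section Polynomial

open Polynomial

variable {d : ℕ}

lemma exists_derivative_X_pow_mul_eq (P : ℝ[X]) (n : ℕ) :
    ∃ Q : ℝ[X], Polynomial.derivative (X ^ (n + 1) * Q) = X ^ n * P := by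
  induction P using Polynomial.induction_on' with
  | add p r hp hr =>
    obtain ⟨Q₁, h₁⟩ := hp
    obtain ⟨Q₂, h₂⟩ := hr
    exact ⟨Q₁ + Q₂, by rw [mul_add, derivative_add, h₁, h₂, mul_add]⟩
  | monomial k a =>
    refine ⟨monomial k (a / (n + 1 + k)), ?_⟩
    rw [X_pow_mul_monomial, X_pow_mul_monomial, derivative_monomial]
    have h : (n : ℝ) + 1 + k ≠ 0 := by positivity
    have h2 : k + (n + 1) - 1 = k + n := by omega
    rw [h2]
    congr 1
    push_cast
    rw [show (k : ℝ) + (n + 1) = n + 1 + k by ring]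
    field_simp

/-- Derivatives are required only on the open interval because the radial equation is singular at 0.
-/
lemma eq_of_hasDerivAt_eq {f g f' : ℝ → ℝ} {b : ℝ} (hb : 0 ≤ b)
    (hf : ContinuousOn f (Icc 0 b)) (hg : ContinuousOn g (Icc 0 b))
    (hf' : ∀ x ∈ Ioo 0 b, HasDerivAt f (f' x) x) (hg' : ∀ x ∈ Ioo 0 b, HasDerivAt g (f' x) x)
    (h0 : f 0 = g 0) : f b = g b := by
  rcases hb.eq_or_lt with rfl | hb
  · exact h0
  obtain ⟨c, _, hc⟩ := exists_hasDerivAt_eq_slope (fun x => f x - g x) (fun x => f' x - f' x) hb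
    (hf.sub hg) fun x hx => (hf' x hx).sub (hg' x hx)
  rw [sub_self, h0, sub_self, sub_zero, sub_zero, eq_comm, div_eq_zero_iff] at hc
  rcases hc with hc | hc
  · linarith
  · linarith

/-- The scaled derivative `R f'(R)` of the potential of `σ_d`. -/
noncomputable def radialEuler (d : ℕ) (t R : ℝ) : ℝ :=
  t / 2 * ((1 - R ^ 2) * radialPotential d (t + 2) R - radialPotential d t R)

lemma mul_radialDeriv {t : ℝ} (ht : 0 ≤ t) {R : ℝ} (hR : |R| < 1) :
    R * radialDeriv d t R = radialEuler d t R := by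
  have := two_mul_radialDeriv (d := d) ht hR
  rw [radialEuler]
  linarith

lemma mem_nhds_abs_lt_one {R : ℝ} (hR : |R| < 1) : {x : ℝ | |x| < 1} ∈ nhds R :=
  (isOpen_lt continuous_abs continuous_const).mem_nhds hR

/-- The radial Laplacian of the potential, as a first order equation for `R f'(R)`. -/
lemma hasDerivAt_radialEuler {t : ℝ} (ht : 0 < t) (htd : t ≤ 2 * d - 2) {R : ℝ} (hR0 : 0 < R)
    (hR : |R| < 1) :
    HasDerivAt (radialEuler d t) (t * (t + 1 - d) * R * radialPotential d (t + 2) R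
      - (d - 1) * (radialEuler d t R / R)) R := by
  have hA := one_sub_sq_pos_of_abs hR
  -- The symmetry turns exponent t + 2 into τ. Differentiating at τ produces the exponent τ + 2,
  -- which the symmetry sends back to t, so the equation closes on the exponents t and t + 2.
  set τ : ℝ := 2 * d - t - 2 with hτ
  have hτ0 : 0 ≤ τ := by linarith
  have hloc : (fun x => t / 2 * ((1 - x ^ 2) ^ ((d : ℝ) - t - 1) * radialPotential d τ x
      - radialPotential d t x)) =ᶠ[nhds R] radialEuler d t := by
    filter_upwards [mem_nhds_abs_lt_one hR] with x hx
    have hx' := one_sub_sq_pos_of_abs hx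
    rw [radialEuler, radialPotential_symm (t + 2) hx, ← mul_assoc,
      show (d : ℝ) - t - 1 = 1 + (d - (t + 2)) by ring, Real.rpow_add hx', Real.rpow_one,
      show (2 : ℝ) * d - (t + 2) = τ by rw [hτ]; ring]
  refine HasDerivAt.congr_of_eventuallyEq ?_ hloc.symm
  have hq : HasDerivAt (fun x : ℝ => 1 - x ^ 2) (-(2 * R)) R := by
    have := ((hasDerivAt_id R).pow 2).const_sub 1
    refine this.congr_deriv ?_
    simp
  have hp := hq.rpow_const (p := (d : ℝ) - t - 1) (Or.inl hA.ne')
  have h := ((hp.mul (hasDerivAt_radialPotential (d := d) hτ0 hR)).sub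
    (hasDerivAt_radialPotential (d := d) ht.le hR)).const_mul (t / 2)
  refine h.congr_deriv ?_
  have e1 : radialPotential d (t + 2) R =
      (1 - R ^ 2) ^ ((d : ℝ) - t - 2) * radialPotential d τ R := by
    rw [radialPotential_symm (t + 2) hR, hτ]; ring_nf
  have e2 : radialPotential d (τ + 2) R =
      (1 - R ^ 2) ^ (t - (d : ℝ)) * radialPotential d t R := by
    rw [radialPotential_symm (τ + 2) hR, hτ]; ring_nf
  have e3 : radialDeriv d τ R =
      τ * ((1 - R ^ 2) * radialPotential d (τ + 2) R - radialPotential d τ R) / (2 * R) := by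
    rw [eq_div_iff (by positivity), ← two_mul_radialDeriv hτ0 hR]; ring
  have e4 : radialDeriv d t R =
      t * ((1 - R ^ 2) * radialPotential d (t + 2) R - radialPotential d t R) / (2 * R) := by
    rw [eq_div_iff (by positivity), ← two_mul_radialDeriv ht.le hR]; ring
  have e5 : (1 - R ^ 2) * (1 - R ^ 2) * (1 - R ^ 2) ^ ((d : ℝ) - t - 2) *
      (1 - R ^ 2) ^ (t - (d : ℝ)) = 1 := by
    rw [mul_assoc, ← Real.rpow_add hA, show (d : ℝ) - t - 2 + (t - d) = (-2 : ℝ) by ring,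
      Real.rpow_neg hA.le, Real.rpow_two]
    field_simp
  have e6 : (1 - R ^ 2) ^ ((d : ℝ) - t - 1) =
      (1 - R ^ 2) * (1 - R ^ 2) ^ ((d : ℝ) - t - 2) := by
    rw [show (d : ℝ) - t - 1 = 1 + (d - t - 2) by ring, Real.rpow_add hA, Real.rpow_one]
  rw [e4, e3, radialEuler, e2, e1, e6, show (d : ℝ) - t - 1 - 1 = d - t - 2 by ring]
  generalize (1 - R ^ 2) ^ ((d : ℝ) - t - 2) = B at *
  generalize (1 - R ^ 2) ^ (t - (d : ℝ)) = C at *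
  generalize 1 - R ^ 2 = A at *
  rw [hτ]
  linear_combination (t * (2 * d - t - 2) * radialPotential d t R / (4 * R)) * e5

lemma continuousOn_radialPotential {t : ℝ} (ht : 0 ≤ t) :
    ContinuousOn (radialPotential d t) (Ico 0 1) := fun _ hR =>
  (hasDerivAt_radialPotential ht (abs_lt_one_of_mem_Ico hR)).continuousAt.continuousWithinAt

/-- With E = R f'(R) the radial equation reads (R^(d-1) E)' = R^d P. Integrating from 0 gives E = R²
Q₁, hence f' = R Q₁, and f(0) = 1 fixes the remaining constant. -/
lemma radialPotential_eq_polynomial_step {t : ℝ} (ht : 0 < t) (htd : t ≤ d - 1) {P : ℝ[X]}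
    (hP : ∀ R ∈ Ico (0 : ℝ) 1,
      t * (t + 1 - d) * radialPotential d (t + 2) R = P.eval R) :
    ∃ Q : ℝ[X], ∀ R ∈ Ico (0 : ℝ) 1, radialPotential d t R = Q.eval R := by
  obtain ⟨n, rfl⟩ : ∃ n, d = n + 1 := by
    refine Nat.exists_eq_succ_of_ne_zero ?_
    rintro rfl
    push_cast at htd
    linarith
  push_cast at htd hP
  obtain ⟨Q₁, hQ₁⟩ := exists_derivative_X_pow_mul_eq P (n + 1)
  obtain ⟨Q₂, hQ₂⟩ := exists_derivative_X_pow_mul_eq (X * Q₁) 0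
  have hEuler : ∀ R ∈ Ioo (0 : ℝ) 1, radialEuler (n + 1) t R = R ^ 2 * Q₁.eval R := by
    intro R hR
    have hsub : Icc 0 R ⊆ Ico (0 : ℝ) 1 := fun x hx => ⟨hx.1, hx.2.trans_lt hR.2⟩
    have hcE : ContinuousOn (radialEuler (n + 1) t) (Ico 0 1) := by
      unfold radialEuler
      have h1 := continuousOn_radialPotential (d := n + 1) (t := t + 2) (by linarith)
      have h2 := continuousOn_radialPotential (d := n + 1) ht.le
      fun_prop
    have h := eq_of_hasDerivAt_eq (f := fun x => x ^ n * radialEuler (n + 1) t x)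
      (g := fun x => (X ^ (n + 1 + 1) * Q₁).eval x)
      (f' := fun x => x ^ (n + 1) * P.eval x) hR.1.le
      ((continuous_pow n).continuousOn.mul (hcE.mono hsub))
      (Polynomial.continuous _).continuousOn ?_ ?_ ?_
    · simp only [eval_mul, eval_pow, eval_X] at h
      have hRn : R ^ n ≠ 0 := pow_ne_zero _ hR.1.ne'
      refine mul_left_cancel₀ hRn ?_
      rw [h]; ring
    · intro x hx
      have hx1 : |x| < 1 := abs_lt_one_of_mem_Ico ⟨hx.1.le, hx.2.trans hR.2⟩
      have h1 := hasDerivAt_radialEuler (d := n + 1) ht (by push_cast; linarith) hx.1 hx1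
      refine ((hasDerivAt_pow n x).mul h1).congr_deriv ?_
      rw [← hP x ⟨hx.1.le, hx.2.trans hR.2⟩]
      have hx0 := hx.1.ne'
      push_cast
      -- The exponent n - 1 in the derivative of x^n is a truncated subtraction.
      rcases n with _ | n
      · simp; ring
      · simp only [Nat.add_sub_cancel]
        push_cast
        field_simp
        ring
    · intro x _
      have := (X ^ (n + 1 + 1) * Q₁).hasDerivAt x
      rw [hQ₁] at this
      simpa using this
    · simp [radialEuler, radialPotential_zero]
  refine ⟨1 + X * Q₂, fun R hR => ?_⟩
  have hsub : Icc 0 R ⊆ Ico (0 : ℝ) 1 := fun x hx => ⟨hx.1, hx.2.trans_lt hR.2⟩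
  refine eq_of_hasDerivAt_eq (f := radialPotential (n + 1) t) (g := fun x => (1 + X * Q₂).eval x)
    (f' := fun x => x * Q₁.eval x) hR.1 ((continuousOn_radialPotential ht.le).mono hsub)
    (Polynomial.continuous _).continuousOn ?_ ?_ ?_
  · intro x hx
    have hx1 : |x| < 1 := abs_lt_one_of_mem_Ico ⟨hx.1.le, hx.2.trans hR.2⟩
    refine (hasDerivAt_radialPotential ht.le hx1).congr_deriv ?_
    have h1 := mul_radialDeriv (d := n + 1) ht.le hx1
    rw [hEuler x ⟨hx.1, hx.2.trans hR.2⟩] at h1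
    refine mul_left_cancel₀ hx.1.ne' ?_
    rw [h1]; ring
  · intro x _
    have := (1 + X * Q₂).hasDerivAt x
    have h2 : derivative (1 + X * Q₂) = X * Q₁ := by
      simpa using hQ₂
    rw [h2] at this
    simpa using this
  · simp [radialPotential_zero]

/-- At t = d - 1 the coefficient t + 1 - d vanishes, so P = 0 starts the recursion; each further
step lowers the exponent by 2. -/
lemma radialPotential_eq_polynomial (m : ℕ) : ∀ t : ℝ, 0 < t → t = (d : ℝ) - 1 - 2 * m →
    ∃ Q : ℝ[X], ∀ R ∈ Ico (0 : ℝ) 1, radialPotential d t R = Q.eval R := by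
  induction m with
  | zero =>
    intro t ht htd
    refine radialPotential_eq_polynomial_step ht (by rw [htd]; simp) (P := 0) fun R _ => ?_
    rw [htd]; simp
  | succ m ih =>
    intro t ht htd
    push_cast at htd
    obtain ⟨P, hP⟩ := ih (t + 2) (by linarith) (by linarith)
    have hm : (0 : ℝ) ≤ m := Nat.cast_nonneg m
    refine radialPotential_eq_polynomial_step ht (by linarith)
      (P := C (t * (t + 1 - d)) * P) fun R hR => ?_
    rw [hP R hR, eval_mul, eval_C]

lemma goncharB_eq_polynomial {s : ℝ} (hs : 0 < s) (hsd : s < d) (q : ℝ) (m : ℕ)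
    (hm : s = (d : ℝ) - 1 - 2 * m) :
    ∃ P : ℝ[X], ∀ R ∈ Ico (0 : ℝ) 1, goncharB d s q R = P.eval R := by
  obtain ⟨Q, hQ⟩ := radialPotential_eq_polynomial (d := d) m s hs hm
  refine ⟨C ((sphereEnergy d s).toReal / q) * (1 - X) ^ d - (1 + X) ^ (2 * m + 1)
    + (1 - X) ^ d * Q, fun R hR => ?_⟩
  rw [goncharB, wienerEnergy_unitSphere hs hsd,
    toReal_potential_sigma_source (abs_lt_one_of_mem_Ico hR), hQ R hR,
    show (d : ℝ) - s = ((2 * m + 1 : ℕ) : ℝ) by rw [hm]; push_cast; ring, Real.rpow_natCast]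
  simp

end Polynomial

/-! ### Jordan decompositions of differences of finite measures -/

section SignedMeasures

variable {α : Type*} [MeasurableSpace α] {μ ν : Measure α} [IsFiniteMeasure μ] [IsFiniteMeasure ν]

/-- The positive part is μ - ν restricted to a Hahn set, and there μ - ν is at most μ. -/
lemma posPart_sub_le :
    (μ.toSignedMeasure - ν.toSignedMeasure).toJordanDecomposition.posPart ≤ μ := by
  obtain ⟨i, hi, h1, h2, h3, -⟩ :=
    (μ.toSignedMeasure - ν.toSignedMeasure).toJordanDecomposition_spec
  rw [h3]
  refine Measure.le_iff.2 fun j hj => ?_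
  rw [SignedMeasure.toMeasureOfZeroLE_apply _ h1 hi hj, ENNReal.coe_le_iff]
  rintro c hc
  rw [← NNReal.coe_le_coe]
  have h4 : (μ.toSignedMeasure - ν.toSignedMeasure) (i ∩ j) = μ.real (i ∩ j) - ν.real (i ∩ j) :=
    Measure.toSignedMeasure_sub_apply (hi.inter hj)
  have h5 : μ.real (i ∩ j) ≤ μ.real j := measureReal_mono inter_subset_right
  have h6 : μ.real j = c := by rw [measureReal_def, hc]; rfl
  have h7 : 0 ≤ ν.real (i ∩ j) := measureReal_nonneg
  change (μ.toSignedMeasure - ν.toSignedMeasure) (i ∩ j) ≤ _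
  linarith

lemma negPart_sub_le :
    (μ.toSignedMeasure - ν.toSignedMeasure).toJordanDecomposition.negPart ≤ ν := by
  have h := posPart_sub_le (μ := ν) (ν := μ)
  rwa [← neg_sub, SignedMeasure.toJordanDecomposition_neg, JordanDecomposition.neg_posPart] at h

/-- The additive form transfers potentials from an arbitrary decomposition to the Jordan one without
subtracting measures. -/
lemma posPart_add_eq {η : SignedMeasure α} (h : η = μ.toSignedMeasure - ν.toSignedMeasure) :
    η.toJordanDecomposition.posPart + ν = η.toJordanDecomposition.negPart + μ := by
  have h1 := SignedMeasure.toSignedMeasure_toJordanDecomposition η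
  rw [JordanDecomposition.toSignedMeasure] at h1
  rw [← Measure.toSignedMeasure_eq_toSignedMeasure_iff, Measure.toSignedMeasure_add,
    Measure.toSignedMeasure_add]
  have h2 := h1.trans h
  rw [sub_eq_sub_iff_add_eq_add] at h2
  rw [h2, add_comm]

lemma totalVariation_toSignedMeasure :
    (μ.toSignedMeasure).totalVariation = μ := by
  have h0 : μ.toSignedMeasure = μ.toSignedMeasure - (0 : Measure α).toSignedMeasure := by simp
  have h1 : (μ.toSignedMeasure).toJordanDecomposition.negPart = 0 := by
    have := negPart_sub_le (μ := μ) (ν := 0)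
    rw [← h0] at this
    exact le_antisymm this (Measure.zero_le _)
  have h2 := posPart_add_eq h0
  rw [h1, add_zero, zero_add] at h2
  rw [SignedMeasure.totalVariation, h1, add_zero, h2]

lemma eq_of_sub_of_add_eq {μ₁ ν₁ : Measure α} [IsFiniteMeasure μ₁] [IsFiniteMeasure ν₁]
    (h : μ + ν₁ = μ₁ + ν) :
    μ.toSignedMeasure - ν.toSignedMeasure = μ₁.toSignedMeasure - ν₁.toSignedMeasure := by
  have := Measure.toSignedMeasure_eq_toSignedMeasure_iff.2 h
  rw [Measure.toSignedMeasure_add, Measure.toSignedMeasure_add] at this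
  rwa [sub_eq_sub_iff_add_eq_add]

end SignedMeasures

/-! ### Uniqueness of signed equilibria -/

section Equilibrium

variable {d : ℕ} {s : ℝ}

lemma potential_add (μ ν : Measure (Space (d + 1))) (x : Space (d + 1)) :
    potential s (μ + ν) x = potential s μ x + potential s ν x :=
  lintegral_add_measure _ _ _

lemma potential_smul (c : ℝ≥0∞) (μ : Measure (Space (d + 1))) (x : Space (d + 1)) :
    potential s (c • μ) x = c * potential s μ x := lintegral_smul_measure _ _

lemma potential_mono {μ ν : Measure (Space (d + 1))} (h : μ ≤ ν) (x : Space (d + 1)) :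
    potential s μ x ≤ potential s ν x := lintegral_mono' h le_rfl

lemma measure_eq_of_toReal_potential (hs : 0 < s) (hsd : s < d) {μ ν : Measure (Space (d + 1))}
    [IsFiniteMeasure μ] [IsFiniteMeasure ν] (hμ : μ (unitSphere d)ᶜ = 0)
    (hν : ν (unitSphere d)ᶜ = 0) (hmass : μ.real univ = ν.real univ) {C : ℝ}
    (h : ∀ᵐ x ∂sigma d, potential s μ x ≠ ∞ ∧ potential s ν x ≠ ∞ ∧
      (potential s μ x).toReal = (potential s ν x).toReal + C) : μ = ν := by
  refine measure_eq_of_potential_ae_eq hs hsd hμ hν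
    -- C = |C| - (|C| - C) splits the real constant into two nonnegative ones, one for each side.
    ((measureReal_eq_measureReal_iff).1 hmass) (c₁ := ENNReal.ofReal (|C| - C))
    (c₂ := ENNReal.ofReal |C|) ENNReal.ofReal_ne_top ?_
  filter_upwards [h] with x hx
  obtain ⟨h1, h2, h3⟩ := hx
  have hC : 0 ≤ |C| - C := by linarith [le_abs_self C]
  rw [← ENNReal.toReal_eq_toReal_iff' (ENNReal.add_ne_top.2 ⟨h1, ENNReal.ofReal_ne_top⟩)
    (ENNReal.add_ne_top.2 ⟨h2, ENNReal.ofReal_ne_top⟩), ENNReal.toReal_add h1 ENNReal.ofReal_ne_top,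
    ENNReal.toReal_add h2 ENNReal.ofReal_ne_top, ENNReal.toReal_ofReal hC,
    ENNReal.toReal_ofReal (abs_nonneg C), h3]
  ring

lemma IsSignedEquilibrium.eq (hs : 0 < s) (hsd : s < d) {Q : Space (d + 1) → ℝ}
    {η η' : SignedMeasure (Space (d + 1))} (h : IsSignedEquilibrium s (unitSphere d) Q η)
    (h' : IsSignedEquilibrium s (unitSphere d) Q η') : η' = η := by
  set p := η.toJordanDecomposition.posPart with hp
  set n := η.toJordanDecomposition.negPart with hn
  set p' := η'.toJordanDecomposition.posPart with hp'
  set n' := η'.toJordanDecomposition.negPart with hn'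
  have e : η = p.toSignedMeasure - n.toSignedMeasure :=
    (SignedMeasure.toSignedMeasure_toJordanDecomposition η).symm
  have e' : η' = p'.toSignedMeasure - n'.toSignedMeasure :=
    (SignedMeasure.toSignedMeasure_toJordanDecomposition η').symm
  have hsup := h.supported
  have hsup' := h'.supported
  rw [SignedMeasure.totalVariation, Measure.add_apply, add_eq_zero] at hsup hsup'
  have hm := h.total_charge
  have hm' := h'.total_charge
  rw [e, Measure.toSignedMeasure_sub_apply MeasurableSet.univ] at hm
  rw [e', Measure.toSignedMeasure_sub_apply MeasurableSet.univ] at hm'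
  obtain ⟨G, hG⟩ := h.constant
  obtain ⟨G', hG'⟩ := h'.constant
  -- Cross-adding the Jordan parts gives two positive measures of equal mass whose potentials on the
  -- sphere differ by a constant.
  have key : p' + n = p + n' := by
    refine measure_eq_of_toReal_potential hs hsd (C := G' - G) ?_ ?_ ?_ ?_
    · rw [Measure.add_apply, hsup'.1, hsup.2, add_zero]
    · rw [Measure.add_apply, hsup.1, hsup'.2, add_zero]
    · rw [measureReal_add_apply, measureReal_add_apply]
      linarith
    · filter_upwards [ae_mem_unitSphere (sigma_compl (d := d))] with x hx
      have a1 := h.pos_finite x hx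
      have a2 := h.neg_finite x hx
      have a3 := h'.pos_finite x hx
      have a4 := h'.neg_finite x hx
      have g1 := hG x hx
      have g2 := hG' x hx
      rw [potential_add, potential_add]
      refine ⟨ENNReal.add_ne_top.2 ⟨a3, a2⟩, ENNReal.add_ne_top.2 ⟨a1, a4⟩, ?_⟩
      rw [ENNReal.toReal_add a3 a2, ENNReal.toReal_add a1 a4]
      linarith
  rw [e, e']
  exact eq_of_sub_of_add_eq key

/-- A difference of measures of constant weighted potential is a signed equilibrium. -/
lemma isSignedEquilibrium_sub {Q : Space (d + 1) → ℝ} {μ ν : Measure (Space (d + 1))}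
    [IsFiniteMeasure μ] [IsFiniteMeasure ν] (hμ : μ (unitSphere d)ᶜ = 0)
    (hν : ν (unitSphere d)ᶜ = 0) (hmass : μ.real univ - ν.real univ = 1)
    (hμf : ∀ x ∈ unitSphere d, potential s μ x ≠ ∞) (hνf : ∀ x ∈ unitSphere d, potential s ν x ≠ ∞)
    {G : ℝ} (hG : ∀ x ∈ unitSphere d,
      (potential s μ x).toReal - (potential s ν x).toReal + Q x = G) :
    IsSignedEquilibrium s (unitSphere d) Q (μ.toSignedMeasure - ν.toSignedMeasure) := by
  set η := μ.toSignedMeasure - ν.toSignedMeasure with hη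
  have hp : η.toJordanDecomposition.posPart ≤ μ := posPart_sub_le
  have hn : η.toJordanDecomposition.negPart ≤ ν := negPart_sub_le
  have hpf : ∀ x ∈ unitSphere d, potential s η.toJordanDecomposition.posPart x ≠ ∞ := fun x hx =>
    ne_top_of_le_ne_top (hμf x hx) (potential_mono hp x)
  have hnf : ∀ x ∈ unitSphere d, potential s η.toJordanDecomposition.negPart x ≠ ∞ := fun x hx =>
    ne_top_of_le_ne_top (hνf x hx) (potential_mono hn x)
  refine ⟨?_, ?_, hpf, hnf, G, fun x hx => ?_⟩
  · rw [SignedMeasure.totalVariation, Measure.add_apply, add_eq_zero]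
    exact ⟨le_antisymm ((hp _).trans hμ.le) zero_le, le_antisymm ((hn _).trans hν.le) zero_le⟩
  · rw [hη, Measure.toSignedMeasure_sub_apply MeasurableSet.univ, hmass]
  · have h1 := congrArg (fun ρ => potential s ρ x) (posPart_add_eq hη)
    simp only [potential_add] at h1
    have h2 := congrArg ENNReal.toReal h1
    rw [ENNReal.toReal_add (hpf x hx) (hνf x hx), ENNReal.toReal_add (hnf x hx) (hμf x hx)] at h2
    have := hG x hx
    linarith

end Equilibrium

/-! ### Balayage of the point charge and the resulting signed equilibrium -/

section Balayage

variable {d : ℕ} {s : ℝ}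

lemma sphereEnergy_toReal_pos (hs : 0 < s) (hsd : s < d) : 0 < (sphereEnergy d s).toReal :=
  ENNReal.toReal_pos (sphereEnergy_pos hs) (sphereEnergy_ne_top hs hsd)

/-- The density of the balayage of the unit mass at `(0, R)` onto the sphere. -/
noncomputable def balayageDensity (d : ℕ) (s R : ℝ) (y : Space (d + 1)) : ℝ :=
  (1 - R ^ 2) ^ (-(s / 2)) / (sphereEnergy d s).toReal *
    conformalFactor (source d R) y ^ ((d : ℝ) - s / 2)

/-- The balayage of the unit mass at `(0, R)` onto the sphere. -/
noncomputable def balayage (d : ℕ) (s R : ℝ) : Measure (Space (d + 1)) :=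
  (sigma d).withDensity fun y => ENNReal.ofReal (balayageDensity d s R y)

@[fun_prop]
lemma measurable_balayageDensity (R : ℝ) : Measurable (balayageDensity d s R) := by
  unfold balayageDensity; fun_prop

lemma balayage_compl (R : ℝ) : balayage d s R (unitSphere d)ᶜ = 0 :=
  withDensity_absolutelyContinuous _ _ sigma_compl

variable {R : ℝ}

lemma ofReal_balayageDensity (hs : 0 < s) (hsd : s < d) (hR : |R| < 1) (y : Space (d + 1)) :
    ENNReal.ofReal (balayageDensity d s R y) =
      ENNReal.ofReal ((1 - R ^ 2) ^ (-(s / 2)) / (sphereEnergy d s).toReal) *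
      ENNReal.ofReal (conformalFactor (source d R) y ^ ((d : ℝ) - s / 2)) := by
  have hA := one_sub_sq_pos_of_abs hR
  have hW := sphereEnergy_toReal_pos hs hsd
  rw [balayageDensity, ENNReal.ofReal_mul (by positivity)]

lemma potential_balayage (hs : 0 < s) (hsd : s < d) (hR : |R| < 1) {x : Space (d + 1)}
    (hx : x ∈ unitSphere d) :
    potential s (balayage d s R) x = ENNReal.ofReal (‖x - source d R‖ ^ (-s)) := by
  have hA := one_sub_sq_pos_of_abs hR
  have hW := sphereEnergy_toReal_pos hs hsd
  have hx' := mem_unitSphere.1 hx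
  have ha := norm_source_lt_one (d := d) hR
  have hl := conformalFactor_pos ha hx'
  rw [potential, balayage, lintegral_withDensity_eq_lintegral_mul _ (by fun_prop) (by fun_prop)]
  simp only [Pi.mul_apply, ofReal_balayageDensity hs hsd hR, mul_assoc]
  rw [lintegral_const_mul _ (by fun_prop), lintegral_conformalFactor_kernel ha hx,
    ← ENNReal.ofReal_toReal (sphereEnergy_ne_top hs hsd), ← ENNReal.ofReal_mul (by positivity),
    ← ENNReal.ofReal_mul (by positivity)]
  congr 1
  rw [conformalFactor_rpow ha hx', norm_source, sq_abs, Real.rpow_neg hA.le,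
    ENNReal.ofReal_toReal (sphereEnergy_ne_top hs hsd), show -(2 * (s / 2)) = -s by ring]
  field_simp

lemma lintegral_balayageDensity_ne_top (hs : 0 < s) (hsd : s < d) (hR : |R| < 1) :
    ∫⁻ y, ENNReal.ofReal (balayageDensity d s R y) ∂sigma d ≠ ∞ := by
  simp only [ofReal_balayageDensity hs hsd hR]
  rw [lintegral_const_mul _ (by fun_prop)]
  exact ENNReal.mul_ne_top ENNReal.ofReal_ne_top (lintegral_conformalFactor_ne_top
    (norm_source_lt_one hR) (by linarith) sigma_compl)

lemma isFiniteMeasure_balayage (hs : 0 < s) (hsd : s < d) (hR : |R| < 1) :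
    IsFiniteMeasure (balayage d s R) :=
  isFiniteMeasure_withDensity (lintegral_balayageDensity_ne_top hs hsd hR)

/-- The exponent exchange turns the integral of λ^(d - s/2) into that of λ^(s/2), a multiple of the
potential of σ_d at the source. -/
lemma balayage_real_univ (hs : 0 < s) (hsd : s < d) (hR : |R| < 1) :
    (balayage d s R).real univ = radialPotential d s R / (sphereEnergy d s).toReal := by
  have hA := one_sub_sq_pos_of_abs hR
  have hW := sphereEnergy_toReal_pos hs hsd
  rw [measureReal_def, balayage, withDensity_apply _ MeasurableSet.univ, Measure.restrict_univ]
  simp only [ofReal_balayageDensity hs hsd hR]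
  rw [lintegral_const_mul _ (by fun_prop), lintegral_conformalFactor_symm (norm_source_lt_one hR),
    ENNReal.toReal_mul, lintegral_conformalFactor_source hR, ENNReal.toReal_ofReal (by positivity),
    show 2 * (s / 2) = s by ring, Real.rpow_neg hA.le]
  field_simp

lemma field_eq (q : ℝ) (x : Space (d + 1)) :
    field d s q R x = q * ‖x - source d R‖ ^ (-s) := by
  rw [field, Real.rpow_neg (norm_nonneg _), div_eq_mul_inv]

/-- The mass of the multiple of `σ_d` in the signed equilibrium. -/
noncomputable def sigmaMass (d : ℕ) (s q R : ℝ) : ℝ :=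
  1 + q * radialPotential d s R / (sphereEnergy d s).toReal

lemma radialPotential_nonneg (d : ℕ) (t R : ℝ) : 0 ≤ radialPotential d t R :=
  integral_nonneg fun y => by positivity

lemma sigmaMass_pos (hs : 0 < s) (hsd : s < d) {q : ℝ} (hq : 0 < q) :
    0 < sigmaMass d s q R := by
  have hW := sphereEnergy_toReal_pos hs hsd
  have := radialPotential_nonneg d s R
  unfold sigmaMass
  positivity

/-- The signed equilibrium associated with the point charge `q` at `(0, R)`. -/
lemma isSignedEquilibrium_balayage (hs : 0 < s) (hsd : s < d) {q : ℝ} (hq : 0 < q) (hR : |R| < 1)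
    {μ ν : Measure (Space (d + 1))} [IsFiniteMeasure μ] [IsFiniteMeasure ν]
    (hμ : μ = ENNReal.ofReal (sigmaMass d s q R) • sigma d)
    (hν : ν = ENNReal.ofReal q • balayage d s R) :
    IsSignedEquilibrium s (unitSphere d) (field d s q R)
      (μ.toSignedMeasure - ν.toSignedMeasure) := by
  have hW := sphereEnergy_toReal_pos hs hsd
  have hM := sigmaMass_pos (d := d) (R := R) hs hsd hq
  -- On the sphere the potential of ν equals the external field and cancels it, leaving the constant
  -- potential of μ.
  refine isSignedEquilibrium_sub (G := sigmaMass d s q R * (sphereEnergy d s).toReal) ?_ ?_ ?_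
    (fun x hx => ?_) (fun x hx => ?_) (fun x hx => ?_)
  · rw [hμ, Measure.smul_apply, sigma_compl, smul_zero]
  · rw [hν, Measure.smul_apply, balayage_compl, smul_zero]
  · rw [hμ, hν, measureReal_ennreal_smul_apply, measureReal_ennreal_smul_apply, probReal_univ,
      balayage_real_univ hs hsd hR, ENNReal.toReal_ofReal hM.le, ENNReal.toReal_ofReal hq.le,
      sigmaMass]
    ring
  · rw [hμ, potential_smul, potential_sigma hx]
    exact ENNReal.mul_ne_top ENNReal.ofReal_ne_top (sphereEnergy_ne_top hs hsd)
  · rw [hν, potential_smul, potential_balayage hs hsd hR hx]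
    exact ENNReal.mul_ne_top ENNReal.ofReal_ne_top ENNReal.ofReal_ne_top
  · rw [hμ, hν, potential_smul, potential_smul, potential_sigma hx,
      potential_balayage hs hsd hR hx, ENNReal.toReal_mul, ENNReal.toReal_mul,
      ENNReal.toReal_ofReal hM.le, ENNReal.toReal_ofReal hq.le,
      ENNReal.toReal_ofReal (by positivity), field_eq]
    ring

/-- For R ≥ 0 this makes the distance to the source increase with the distance to the pole, which
locates the maximum of the balayage density. -/
lemma dist_source_sq {y : Space (d + 1)} (hy : ‖y‖ = 1) (R : ℝ) :
    ‖y - source d R‖ ^ 2 = (1 - R) ^ 2 + R * ‖y - source d 1‖ ^ 2 := by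
  rw [norm_sub_source_sq, norm_sub_source_sq, hy]
  ring

/-- The maximal value of the balayage density, attained at the pole. -/
lemma balayageDensity_pole (hs : 0 < s) (hsd : s < d) (hR : R ∈ Ico (0 : ℝ) 1) :
    balayageDensity d s R (source d 1) =
      (threshold d s R + radialPotential d s R) / (sphereEnergy d s).toReal := by
  have h1 : 0 < 1 - R := by linarith [hR.2]
  have h2 : 0 < 1 + R := by linarith [hR.1]
  have hW := sphereEnergy_toReal_pos hs hsd
  have hn : ‖source d 1‖ = 1 := by rw [norm_source, abs_one]
  have hl : conformalFactor (source d R) (source d 1) = (1 + R) * (1 - R)⁻¹ := by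
    rw [conformalFactor, dist_source_sq hn, norm_source, sq_abs, sub_self, norm_zero]
    field_simp
    ring
  rw [balayageDensity, hl, threshold, sub_add_cancel, show 1 - R ^ 2 = (1 + R) * (1 - R) by ring,
    Real.mul_rpow h2.le h1.le, Real.mul_rpow h2.le (by positivity), Real.inv_rpow h1.le,
    ← Real.rpow_neg h1.le, div_mul_eq_mul_div]
  congr 1
  rw [mul_mul_mul_comm, ← Real.rpow_add h2, ← Real.rpow_add h1]
  ring_nf

/-- This is the minimum of the signed equilibrium density. Its sign is that of the Gonchar function,
by `goncharB_eq`. -/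
lemma mul_balayageDensity_pole (hs : 0 < s) (hsd : s < d) {q : ℝ} (hq : 0 < q)
    (hR : R ∈ Ico (0 : ℝ) 1) :
    sigmaMass d s q R - q * balayageDensity d s R (source d 1) =
      q / (sphereEnergy d s).toReal * ((sphereEnergy d s).toReal / q - threshold d s R) := by
  have hW := sphereEnergy_toReal_pos hs hsd
  rw [balayageDensity_pole hs hsd hR, sigmaMass]
  field_simp
  ring

lemma balayageDensity_mono (hs : 0 < s) (hsd : s < d) (hR : R ∈ Ico (0 : ℝ) 1)
    {y : Space (d + 1)} (hy : ‖y‖ = 1) :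
    balayageDensity d s R y ≤ balayageDensity d s R (source d 1) := by
  have hR1 := abs_lt_one_of_mem_Ico hR
  have hA := one_sub_sq_pos_of_abs hR1
  have hW := sphereEnergy_toReal_pos hs hsd
  have hn : ‖source d 1‖ = 1 := by rw [norm_source, abs_one]
  have h1 : 0 < 1 - R := by linarith [hR.2]
  unfold balayageDensity
  refine mul_le_mul_of_nonneg_left ?_ (by positivity)
  refine Real.rpow_le_rpow (conformalFactor_pos (norm_source_lt_one hR1) hy).le ?_ (by linarith)
  rw [conformalFactor, conformalFactor, dist_source_sq hn, sub_self, norm_zero, norm_source, sq_abs,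
    dist_source_sq hy]
  have h2 : 0 ≤ R * ‖y - source d 1‖ ^ 2 := mul_nonneg hR.1 (by positivity)
  have h3 : (1 - R) ^ 2 + R * 0 ^ 2 ≤ (1 - R) ^ 2 + R * ‖y - source d 1‖ ^ 2 := by linarith
  have h4 : 0 < (1 - R) ^ 2 + R * 0 ^ 2 := by nlinarith
  exact div_le_div_of_nonneg_left hA.le h4 h3

lemma balayageDensity_strict_mono (hs : 0 < s) (hsd : s < d) (hR : R ∈ Ico (0 : ℝ) 1) (hR0 : 0 < R)
    {y : Space (d + 1)} (hy : ‖y‖ = 1) (hne : y ≠ source d 1) :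
    balayageDensity d s R y < balayageDensity d s R (source d 1) := by
  have hR1 := abs_lt_one_of_mem_Ico hR
  have hA := one_sub_sq_pos_of_abs hR1
  have hW := sphereEnergy_toReal_pos hs hsd
  have hn : ‖source d 1‖ = 1 := by rw [norm_source, abs_one]
  have h1 : 0 < 1 - R := by linarith [hR.2]
  unfold balayageDensity
  refine mul_lt_mul_of_pos_left ?_ (by positivity)
  refine Real.rpow_lt_rpow (conformalFactor_pos (norm_source_lt_one hR1) hy).le ?_ (by linarith)
  rw [conformalFactor, conformalFactor, dist_source_sq hn, sub_self, norm_zero, norm_source, sq_abs,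
    dist_source_sq hy]
  have h3 : 0 < ‖y - source d 1‖ := norm_pos_iff.2 (sub_ne_zero.2 hne)
  have h2 : 0 < R * ‖y - source d 1‖ ^ 2 := by positivity
  have h4 : (1 - R) ^ 2 + R * 0 ^ 2 < (1 - R) ^ 2 + R * ‖y - source d 1‖ ^ 2 := by linarith
  have h5 : 0 < (1 - R) ^ 2 + R * 0 ^ 2 := by nlinarith
  exact div_lt_div_of_pos_left hA h5 h4

end Balayage

/-! ### Sign and support of the signed equilibrium -/

section Positivity

variable {d : ℕ} {s R : ℝ}

/-- The positive part of the density of the signed equilibrium, as a measure. -/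
noncomputable def equilibrium (d : ℕ) (s q R : ℝ) : Measure (Space (d + 1)) :=
  (sigma d).withDensity fun y =>
    ENNReal.ofReal (sigmaMass d s q R - q * balayageDensity d s R y)

/-- Below the threshold the minimum of the density, at the pole, is nonnegative, so `ENNReal.ofReal`
truncates nothing on the sphere. -/
lemma equilibrium_add_balayage (hs : 0 < s) (hsd : s < d) {q : ℝ} (hq : 0 < q)
    (hR : R ∈ Ico (0 : ℝ) 1) (h : threshold d s R ≤ (sphereEnergy d s).toReal / q) :
    equilibrium d s q R + ENNReal.ofReal q • balayage d s R =
      ENNReal.ofReal (sigmaMass d s q R) • sigma d := by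
  have hW := sphereEnergy_toReal_pos hs hsd
  have hA := one_sub_sq_pos_of_abs (abs_lt_one_of_mem_Ico hR)
  refine Measure.ext fun A hA' => ?_
  rw [Measure.add_apply, Measure.smul_apply, Measure.smul_apply, equilibrium, balayage,
    withDensity_apply _ hA', withDensity_apply _ hA', smul_eq_mul, smul_eq_mul,
    ← lintegral_const_mul _ (by fun_prop), ← lintegral_add_right _ (by fun_prop),
    ← setLIntegral_const]
  refine lintegral_congr_ae (ae_restrict_of_ae ?_)
  filter_upwards [ae_mem_unitSphere (sigma_compl (d := d))] with y hy
  have hy' := mem_unitSphere.1 hy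
  have hb := conformalFactor_pos (norm_source_lt_one (d := d) (abs_lt_one_of_mem_Ico hR)) hy'
  have hb' : 0 ≤ balayageDensity d s R y := by unfold balayageDensity; positivity
  have h1 := balayageDensity_mono hs hsd hR hy'
  have h2 := mul_balayageDensity_pole hs hsd hq hR
  have h3 : 0 ≤ q / (sphereEnergy d s).toReal * ((sphereEnergy d s).toReal / q - threshold d s R) :=
    mul_nonneg (by positivity) (by linarith)
  have h4 : q * balayageDensity d s R y ≤ q * balayageDensity d s R (source d 1) := by gcongr
  rw [← ENNReal.ofReal_mul hq.le, ← ENNReal.ofReal_add (by linarith) (by positivity)]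
  congr 1
  ring

lemma sigma_support : (sigma d).support = unitSphere d := by
  apply subset_antisymm
  · exact Measure.support_subset_of_isClosed Metric.isClosed_sphere
      (ae_mem_unitSphere (sigma_compl (d := d)))
  · intro x hx
    rw [Measure.support_eq_forall_isOpen]
    intro U hxU hU
    exact sigma_pos_of_isOpen hU ⟨x, hxU, hx⟩

lemma equilibrium_compl (q : ℝ) : equilibrium d s q R (unitSphere d)ᶜ = 0 :=
  withDensity_absolutelyContinuous _ _ sigma_compl

lemma equilibrium_support (hs : 0 < s) (hsd : s < d) {q : ℝ} (hq : 0 < q)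
    (hR : R ∈ Ico (0 : ℝ) 1) (h : threshold d s R ≤ (sphereEnergy d s).toReal / q) :
    (equilibrium d s q R).support = unitSphere d := by
  have hW := sphereEnergy_toReal_pos hs hsd
  apply subset_antisymm
  · exact Measure.support_subset_of_isClosed Metric.isClosed_sphere
      (ae_mem_unitSphere (equilibrium_compl q))
  · rw [← sigma_support]
    refine Measure.AbsolutelyContinuous.support_mono
      (withDensity_absolutelyContinuous' (by fun_prop) ?_)
    have hne : ∀ᵐ y ∂sigma d, y ≠ source d 1 := by
      rw [ae_iff]; simpa using sigma_singleton hs hsd (source d 1)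
    filter_upwards [ae_mem_unitSphere (sigma_compl (d := d)), hne] with y hy hne
    have hy' := mem_unitSphere.1 hy
    have h2 := mul_balayageDensity_pole hs hsd hq hR
    rw [ne_eq, ENNReal.ofReal_eq_zero, not_le]
    -- For R = 0 the threshold is 0 and even the minimum is positive. For R > 0 the density may
    -- vanish at the pole, but only there, and the pole is a null set.
    rcases hR.1.eq_or_lt with h0 | h0
    · have h1 := balayageDensity_mono hs hsd hR hy'
      have h3 : 0 < q / (sphereEnergy d s).toReal *
          ((sphereEnergy d s).toReal / q - threshold d s R) := by
        rw [← h0, threshold_zero, sub_zero]; positivity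
      have h4 : q * balayageDensity d s R y ≤ q * balayageDensity d s R (source d 1) := by gcongr
      linarith
    · have h1 := balayageDensity_strict_mono hs hsd hR h0 hy' hne
      have h3 : 0 ≤ q / (sphereEnergy d s).toReal *
          ((sphereEnergy d s).toReal / q - threshold d s R) :=
        mul_nonneg (by positivity) (by linarith)
      have h4 : q * balayageDensity d s R y < q * balayageDensity d s R (source d 1) := by gcongr
      linarith

lemma continuousAt_balayageDensity (hR : |R| < 1) {x : Space (d + 1)} (hx : ‖x‖ = 1) :
    ContinuousAt (balayageDensity d s R) x := by
  have ha := norm_source_lt_one (d := d) hR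
  have h1 := sub_ne_zero_of_norm ha hx
  have h2 := conformalFactor_pos ha hx
  have h3 : ContinuousAt (conformalFactor (source d R)) x := by
    unfold conformalFactor
    exact ContinuousAt.div continuousAt_const (by fun_prop) (by positivity)
  exact continuousAt_const.mul (h3.rpow_const (Or.inl h2.ne'))

/-- Above the threshold the density is negative at the pole and, by continuity, bounded away from 0
on a neighbourhood; that neighbourhood has positive surface measure and so negative charge. -/
lemma threshold_le_of_nonneg (hs : 0 < s) (hsd : s < d) {q : ℝ} (hq : 0 < q)
    (hR : R ∈ Ico (0 : ℝ) 1) {μ ν : Measure (Space (d + 1))} [IsFiniteMeasure μ] [IsFiniteMeasure ν]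
    (hμ : μ = ENNReal.ofReal (sigmaMass d s q R) • sigma d)
    (hν : ν = ENNReal.ofReal q • balayage d s R)
    (h : 0 ≤ μ.toSignedMeasure - ν.toSignedMeasure) :
    threshold d s R ≤ (sphereEnergy d s).toReal / q := by
  by_contra hlt
  rw [not_le] at hlt
  have hW := sphereEnergy_toReal_pos hs hsd
  have hM := sigmaMass_pos (d := d) (R := R) hs hsd hq
  have h2 := mul_balayageDensity_pole hs hsd hq hR
  have h3 : q / (sphereEnergy d s).toReal *
      ((sphereEnergy d s).toReal / q - threshold d s R) < 0 :=
    mul_neg_of_pos_of_neg (by positivity) (by linarith)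
  have hn : ‖source d 1‖ = 1 := by rw [norm_source, abs_one]
  obtain ⟨M', hM1, hM2⟩ := exists_between
    (show sigmaMass d s q R < q * balayageDensity d s R (source d 1) by linarith)
  have hev : ∀ᶠ y in nhds (source d 1), M' < q * balayageDensity d s R y :=
    (continuousAt_const.mul (continuousAt_balayageDensity (abs_lt_one_of_mem_Ico hR) hn)).eventually
      (lt_mem_nhds hM2)
  obtain ⟨V, hV, hVo, hVm⟩ := eventually_nhds_iff.1 hev
  have hσ : 0 < (sigma d).real V := by
    rw [measureReal_def]
    exact ENNReal.toReal_pos (sigma_pos_of_isOpen hVo ⟨_, hVm, mem_unitSphere.2 hn⟩).ne'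
      (measure_ne_top _ _)
  have h4 := (VectorMeasure.le_iff.1 h) V hVo.measurableSet
  rw [Measure.toSignedMeasure_sub_apply hVo.measurableSet] at h4
  have h5 : μ.real V = sigmaMass d s q R * (sigma d).real V := by
    rw [hμ, measureReal_ennreal_smul_apply, ENNReal.toReal_ofReal hM.le]
  have h6 : M' * (sigma d).real V ≤ ν.real V := by
    have h7 : ENNReal.ofReal M' * sigma d V ≤ ν V := by
      rw [hν, Measure.smul_apply, balayage, withDensity_apply _ hVo.measurableSet, smul_eq_mul,
        ← lintegral_const_mul _ (by fun_prop), ← setLIntegral_const]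
      refine setLIntegral_mono (by fun_prop) fun y hy => ?_
      rw [← ENNReal.ofReal_mul hq.le]
      exact ENNReal.ofReal_le_ofReal (hV y hy).le
    have h8 := ENNReal.toReal_mono (measure_ne_top _ _) h7
    rwa [ENNReal.toReal_mul, ENNReal.toReal_ofReal (by linarith)] at h8
  have h9 : sigmaMass d s q R * (sigma d).real V < M' * (sigma d).real V := by gcongr
  simp only [FunLike.coe_zero, Pi.zero_apply] at h4
  linarith

end Positivity

/-! ### Minimality and the Frostman inequalities for extremal measures -/

section Extremal

variable {d : ℕ} {s : ℝ}

lemma weightedEnergy_of_ne_top {Q : Space (d + 1) → ℝ} {μ : Measure (Space (d + 1))}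
    (h : energy s μ ≠ ∞) :
    weightedEnergy s Q μ = (((energy s μ).toReal + 2 * ∫ x, Q x ∂μ : ℝ) : EReal) := by
  rw [weightedEnergy, EReal.coe_add]
  congr 1
  conv_lhs => rw [← ENNReal.ofReal_toReal h]
  rw [EReal.coe_ennreal_ofReal, max_eq_left ENNReal.toReal_nonneg]

lemma energy_eq (μ : Measure (Space (d + 1))) : energy s μ = ∫⁻ x, potential s μ x ∂μ := rfl

/-- A probability measure of constant weighted potential on the sphere is extremal. -/
lemma isExtremal_of_potential_eq (hs : 0 < s) {Q : Space (d + 1) → ℝ}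
    {ν : Measure (Space (d + 1))} (hν : ν ∈ unitMeasures (unitSphere d))
    (hQ : ∀ μ ∈ unitMeasures (unitSphere d), Integrable Q μ)
    (hfin : ∀ x ∈ unitSphere d, potential s ν x ≠ ∞) (hE : energy s ν ≠ ∞) {G : ℝ}
    (hG : ∀ x ∈ unitSphere d, (potential s ν x).toReal + Q x = G) :
    IsExtremal s (unitSphere d) Q ν := by
  have := hν.1
  have hint : ∀ μ ∈ unitMeasures (unitSphere d),
      (∫⁻ x, potential s ν x ∂μ).toReal = G - ∫ x, Q x ∂μ := by
    intro μ hμ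
    have := hμ.1
    have h1 := ae_mem_unitSphere hμ.2
    rw [← integral_toReal (measurable_potential s ν).aemeasurable
      (h1.mono fun x hx => (hfin x hx).lt_top)]
    have h2 : ∫ x, (potential s ν x).toReal ∂μ = ∫ x, (G - Q x) ∂μ :=
      integral_congr_ae (h1.mono fun x hx => by linarith [hG x hx])
    rw [h2, integral_sub (integrable_const _) (hQ μ hμ)]
    simp
  refine ⟨hν, le_antisymm (le_iInf₂ fun μ hμ => ?_) (iInf₂_le ν hν)⟩
  have := hμ.1
  by_cases htop : energy s μ = ∞
  · rw [weightedEnergy.eq_def s Q μ, htop, EReal.coe_ennreal_top, EReal.top_add_coe]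
    exact le_top
  · rw [weightedEnergy_of_ne_top hE, weightedEnergy_of_ne_top htop, EReal.coe_le_coe_iff]
    -- The mutual energy is G - ∫ Q dμ, and I_s[ν] = G - ∫ Q dν. Eliminating G from 2 I_s[μ, ν] ≤
    -- I_s[μ] + I_s[ν] gives the comparison of weighted energies.
    have h1 := two_mul_lintegral_potential_le hs μ ν
    have h2 := ENNReal.toReal_mono (ENNReal.add_ne_top.2 ⟨htop, hE⟩) h1
    rw [ENNReal.toReal_mul, ENNReal.toReal_add htop hE, hint μ hμ] at h2
    have h3 := hint ν hν
    rw [← energy_eq] at h3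
    simp only [ENNReal.toReal_ofNat] at h2
    linarith

lemma energy_add_smul (c e : ℝ≥0∞) (μ ν : Measure (Space (d + 1))) [SFinite μ] [SFinite ν] :
    energy s (c • μ + e • ν) = c * c * energy s μ + 2 * (c * e) * ∫⁻ x, potential s μ x ∂ν +
      e * e * energy s ν := by
  have h1 : Measurable (potential s μ) := measurable_potential s μ
  have h2 : Measurable (potential s ν) := measurable_potential s ν
  rw [energy_eq, lintegral_add_measure, lintegral_smul_measure, lintegral_smul_measure]
  simp only [potential_add, potential_smul, smul_eq_mul]
  rw [lintegral_add_left (by fun_prop), lintegral_add_left (by fun_prop),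
    lintegral_const_mul _ h1, lintegral_const_mul _ h2, lintegral_const_mul _ h1,
    lintegral_const_mul _ h2, lintegral_potential_comm ν μ, ← energy_eq, ← energy_eq]
  ring

lemma nonneg_of_forall_small {a b : ℝ} (h : ∀ t ∈ Ioo (0 : ℝ) 1, 0 ≤ 2 * t * a + t ^ 2 * b) :
    0 ≤ a := by
  by_contra ha
  rw [not_le] at ha
  have hb : 0 < |b| + 1 + |a| := by positivity
  -- This t satisfies t b ≤ -a, so 2a + t b ≤ a < 0.
  have ht : -a / (|b| + 1 + |a|) ∈ Ioo (0 : ℝ) 1 := by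
    refine ⟨div_pos (by linarith) hb, ?_⟩
    rw [div_lt_one hb]
    have := neg_abs_le a
    have := abs_nonneg b
    linarith
  have h1 := h _ ht
  set t := -a / (|b| + 1 + |a|) with htdef
  have h2 : t * (|b| + 1 + |a|) = -a := by rw [htdef]; field_simp
  have h3 : t * b ≤ t * (|b| + 1 + |a|) := by
    have := ht.1
    have := le_abs_self b
    have := abs_nonneg a
    gcongr
    linarith
  have h4 : 2 * t * a + t ^ 2 * b = t * (2 * a + t * b) := by ring
  rw [h4] at h1
  have h5 := nonneg_of_mul_nonneg_right h1 ht.1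
  linarith

/-- The variational inequality for extremal measures. -/
lemma IsExtremal.le_integral (hs : 0 < s) {Q : Space (d + 1) → ℝ} {μ ν : Measure (Space (d + 1))}
    (hQ : ∀ μ ∈ unitMeasures (unitSphere d), Integrable Q μ)
    (h : IsExtremal s (unitSphere d) Q μ) (hE : energy s μ ≠ ∞)
    (hν : ν ∈ unitMeasures (unitSphere d)) (hνE : energy s ν ≠ ∞) :
    (energy s μ).toReal + ∫ x, Q x ∂μ ≤ (∫⁻ x, potential s μ x ∂ν).toReal + ∫ x, Q x ∂ν := by
  have := h.1.1
  have := hν.1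
  have hmut : ∫⁻ x, potential s μ x ∂ν ≠ ∞ := by
    have h1 := two_mul_lintegral_potential_le hs ν μ
    refine ne_top_of_le_ne_top (ENNReal.add_ne_top.2 ⟨hνE, hE⟩) (le_trans ?_ h1)
    rw [two_mul]
    exact le_self_add
  rw [← sub_nonneg]
  -- First variation along (1 - t) μ + t ν; b is the coefficient of t².
  refine nonneg_of_forall_small (b := (energy s μ).toReal -
    2 * (∫⁻ x, potential s μ x ∂ν).toReal + (energy s ν).toReal) fun t ht => ?_
  have ht0 := ht.1
  have ht1 : 0 < 1 - t := by linarith [ht.2]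
  set ρ := ENNReal.ofReal (1 - t) • μ + ENNReal.ofReal t • ν with hρ
  have hρm : ρ ∈ unitMeasures (unitSphere d) := by
    refine ⟨⟨?_⟩, ?_⟩
    · rw [hρ, Measure.add_apply, Measure.smul_apply, Measure.smul_apply, measure_univ, measure_univ,
        smul_eq_mul, smul_eq_mul, mul_one, mul_one, ← ENNReal.ofReal_add ht1.le ht0.le]
      simp
    · rw [hρ, Measure.add_apply, Measure.smul_apply, Measure.smul_apply, h.1.2, hν.2]
      simp
  have e1 := energy_add_smul (s := s) (ENNReal.ofReal (1 - t)) (ENNReal.ofReal t) μ ν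
  rw [← hρ] at e1
  have f1 : ENNReal.ofReal (1 - t) * ENNReal.ofReal (1 - t) * energy s μ ≠ ∞ :=
    ENNReal.mul_ne_top (ENNReal.mul_ne_top ENNReal.ofReal_ne_top ENNReal.ofReal_ne_top) hE
  have f2 : 2 * (ENNReal.ofReal (1 - t) * ENNReal.ofReal t) * ∫⁻ x, potential s μ x ∂ν ≠ ∞ :=
    ENNReal.mul_ne_top (ENNReal.mul_ne_top (by norm_num)
      (ENNReal.mul_ne_top ENNReal.ofReal_ne_top ENNReal.ofReal_ne_top)) hmut
  have f3 : ENNReal.ofReal t * ENNReal.ofReal t * energy s ν ≠ ∞ :=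
    ENNReal.mul_ne_top (ENNReal.mul_ne_top ENNReal.ofReal_ne_top ENNReal.ofReal_ne_top) hνE
  have hρE : energy s ρ ≠ ∞ := by
    rw [e1]; exact ENNReal.add_ne_top.2 ⟨ENNReal.add_ne_top.2 ⟨f1, f2⟩, f3⟩
  have e2 : (energy s ρ).toReal = (1 - t) * (1 - t) * (energy s μ).toReal +
      2 * ((1 - t) * t) * (∫⁻ x, potential s μ x ∂ν).toReal + t * t * (energy s ν).toReal := by
    rw [e1, ENNReal.toReal_add (ENNReal.add_ne_top.2 ⟨f1, f2⟩) f3, ENNReal.toReal_add f1 f2]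
    simp only [ENNReal.toReal_mul, ENNReal.toReal_ofReal ht1.le, ENNReal.toReal_ofReal ht0.le,
      ENNReal.toReal_ofNat]
  have e3 : ∫ x, Q x ∂ρ = (1 - t) * ∫ x, Q x ∂μ + t * ∫ x, Q x ∂ν := by
    rw [hρ, integral_add_measure ((hQ μ h.1).smul_measure ENNReal.ofReal_ne_top)
      ((hQ ν hν).smul_measure ENNReal.ofReal_ne_top), integral_smul_measure, integral_smul_measure,
      ENNReal.toReal_ofReal ht1.le, ENNReal.toReal_ofReal ht0.le, smul_eq_mul, smul_eq_mul]
  have hle : weightedEnergy s Q μ ≤ weightedEnergy s Q ρ := by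
    rw [h.2]; exact iInf₂_le ρ hρm
  rw [weightedEnergy_of_ne_top hE, weightedEnergy_of_ne_top hρE, EReal.coe_le_coe_iff,
    e2, e3] at hle
  linarith

/-- Quasi-everywhere, the weighted potential of an extremal measure is bounded from below. -/
lemma IsExtremal.ae_le (hs : 0 < s) {Q : Space (d + 1) → ℝ} {μ ρ : Measure (Space (d + 1))}
    (hQm : Measurable Q) (hQ : ∀ μ ∈ unitMeasures (unitSphere d), Integrable Q μ)
    (h : IsExtremal s (unitSphere d) Q μ) (hE : energy s μ ≠ ∞)
    (hρ : ρ ∈ unitMeasures (unitSphere d)) (hρE : energy s ρ ≠ ∞) :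
    ∀ᵐ x ∂ρ, potential s μ x ≠ ∞ ∧
      (energy s μ).toReal + ∫ x, Q x ∂μ ≤ (potential s μ x).toReal + Q x := by
  have := h.1.1
  have := hρ.1
  have hm := measurable_potential s μ
  have hmut : ∫⁻ x, potential s μ x ∂ρ ≠ ∞ := by
    have h1 := two_mul_lintegral_potential_le hs ρ μ
    refine ne_top_of_le_ne_top (ENNReal.add_ne_top.2 ⟨hρE, hE⟩) (le_trans ?_ h1)
    rw [two_mul]
    exact le_self_add
  have hfin : ∀ᵐ x ∂ρ, potential s μ x < ∞ := ae_lt_top hm hmut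
  set F := (energy s μ).toReal + ∫ x, Q x ∂μ with hF
  set A := {x | (potential s μ x).toReal + Q x < F} with hA
  have hAm : MeasurableSet A := measurableSet_lt (by fun_prop) measurable_const
  suffices hA0 : ρ A = 0 by
    filter_upwards [hfin, measure_eq_zero_iff_ae_notMem.1 hA0] with x h1 h2
    exact ⟨h1.ne, not_lt.1 h2⟩
  by_contra hA0
  -- If the exceptional set A had positive ρ-mass, the normalized restriction of ρ to A would have
  -- finite energy and violate the variational inequality.
  set ν := (ρ A)⁻¹ • ρ.restrict A with hν
  have hAi : (ρ A)⁻¹ ≠ ∞ := ENNReal.inv_ne_top.2 hA0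
  have hνm : ν ∈ unitMeasures (unitSphere d) := by
    refine ⟨⟨?_⟩, ?_⟩
    · rw [hν, Measure.smul_apply, Measure.restrict_apply_univ, smul_eq_mul,
        ENNReal.inv_mul_cancel hA0 (measure_ne_top _ _)]
    · rw [hν, Measure.smul_apply]
      have : ρ.restrict A (unitSphere d)ᶜ = 0 := Measure.absolutelyContinuous_of_le
        Measure.restrict_le_self hρ.2
      rw [this, smul_zero]
  have := hνm.1
  have hνE : energy s ν ≠ ∞ := by
    have h1 : energy s ν ≤ (ρ A)⁻¹ * ((ρ A)⁻¹ * energy s ρ) := by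
      rw [energy_eq, hν, lintegral_smul_measure, smul_eq_mul]
      simp only [potential_smul]
      rw [lintegral_const_mul _ (measurable_potential s _)]
      gcongr
      exact lintegral_mono' Measure.restrict_le_self
        fun x => potential_mono Measure.restrict_le_self x
    exact ne_top_of_le_ne_top (ENNReal.mul_ne_top hAi (ENNReal.mul_ne_top hAi hρE)) h1
  have h2 := h.le_integral hs hQ hE hνm hνE
  rw [← hF] at h2
  have hνac : ν ≪ ρ := (Measure.smul_absolutelyContinuous).trans
    (Measure.absolutelyContinuous_of_le Measure.restrict_le_self)
  have hfinν : ∀ᵐ x ∂ν, potential s μ x < ∞ := hνac.ae_le hfin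
  have hmutν : ∫⁻ x, potential s μ x ∂ν ≠ ∞ := by
    rw [hν, lintegral_smul_measure, smul_eq_mul]
    exact ENNReal.mul_ne_top hAi (ne_top_of_le_ne_top hmut (setLIntegral_le_lintegral _ _))
  have hiU : Integrable (fun x => (potential s μ x).toReal) ν :=
    integrable_toReal_of_lintegral_ne_top hm.aemeasurable hmutν
  rw [← integral_toReal hm.aemeasurable hfinν, ← integral_add hiU (hQ ν hνm)] at h2
  have hνA : ∀ᵐ x ∂ν, x ∈ A := by
    rw [hν]
    exact (Measure.ae_smul_measure (ae_restrict_mem hAm) _)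
  have h3 : ∫ x, ((potential s μ x).toReal + Q x) ∂ν ≤ ∫ _, F ∂ν :=
    integral_mono_ae (hiU.add (hQ ν hνm)) (integrable_const _) (hνA.mono fun x hx => le_of_lt hx)
  have h4 : ∫ x, ((potential s μ x).toReal + Q x) ∂ν = ∫ _, F ∂ν := by
    refine le_antisymm h3 ?_
    simpa using h2
  have h5 := (integral_eq_iff_of_ae_le (hiU.add (hQ ν hνm)) (integrable_const F)
    (hνA.mono fun x hx => le_of_lt hx)).1 h4
  have h6 : ∀ᵐ x ∂ν, False := by
    filter_upwards [hνA, h5] with x hx hx'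
    have hx1 : (potential s μ x).toReal + Q x < F := hx
    exact hx1.ne hx'
  simp at h6
  exact IsProbabilityMeasure.ne_zero ν h6

/-- The weighted potential of an extremal measure is bounded from above on its support. -/
lemma IsExtremal.le_of_mem_support (hs : 0 < s) {Q : Space (d + 1) → ℝ}
    {μ : Measure (Space (d + 1))} (hQm : Measurable Q)
    (hQ : ∀ μ ∈ unitMeasures (unitSphere d), Integrable Q μ)
    (hQ0 : ∀ x, 0 ≤ Q x) (hQc : ContinuousOn Q (unitSphere d))
    (h : IsExtremal s (unitSphere d) Q μ) (hE : energy s μ ≠ ∞)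
    {x : Space (d + 1)} (hx : x ∈ μ.support) :
    (potential s μ x).toReal + Q x ≤ (energy s μ).toReal + ∫ x, Q x ∂μ := by
  have := h.1.1
  have hm := measurable_potential s μ
  set F := (energy s μ).toReal + ∫ x, Q x ∂μ with hF
  have hF0 : 0 ≤ F := add_nonneg ENNReal.toReal_nonneg (integral_nonneg hQ0)
  set B := {x | x ∈ unitSphere d ∧
    potential s μ x + ENNReal.ofReal (Q x) ≤ ENNReal.ofReal F} with hB
  -- Lower semicontinuity of the potential, by Fatou's lemma, together with continuity of Q on the
  -- sphere.
  have hBc : IsClosed B := by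
    refine IsSeqClosed.isClosed fun u z hu huz => ?_
    have hzS : z ∈ unitSphere d :=
      Metric.isClosed_sphere.isSeqClosed (fun n => (hu n).1) huz
    have hQz : Filter.Tendsto (fun n => Q (u n)) Filter.atTop (nhds (Q z)) :=
      (hQc z hzS).tendsto.comp (tendsto_nhdsWithin_iff.2
        ⟨huz, Filter.Eventually.of_forall fun n => (hu n).1⟩)
    refine ⟨hzS, ?_⟩
    have h1 : ∀ x, potential s μ x + ENNReal.ofReal (Q x) =
        ∫⁻ y, (edist x y ^ (-s) + ENNReal.ofReal (Q x)) ∂μ := by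
      intro x
      rw [lintegral_add_right _ measurable_const, lintegral_const, measure_univ, mul_one]
      rfl
    rw [h1]
    have h2 : ∀ y, Filter.Tendsto (fun n => edist (u n) y ^ (-s) + ENNReal.ofReal (Q (u n)))
        Filter.atTop (nhds (edist z y ^ (-s) + ENNReal.ofReal (Q z))) := fun y =>
      ((ENNReal.continuous_rpow_const.tendsto _).comp (huz.edist tendsto_const_nhds)).add
        (ENNReal.tendsto_ofReal hQz)
    calc ∫⁻ y, (edist z y ^ (-s) + ENNReal.ofReal (Q z)) ∂μ
        = ∫⁻ y, Filter.liminf (fun n => edist (u n) y ^ (-s) + ENNReal.ofReal (Q (u n)))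
          Filter.atTop ∂μ := lintegral_congr fun y => (h2 y).liminf_eq.symm
      _ ≤ Filter.liminf (fun n => ∫⁻ y, (edist (u n) y ^ (-s) + ENNReal.ofReal (Q (u n))) ∂μ)
          Filter.atTop := lintegral_liminf_le fun n => by fun_prop
      _ ≤ ENNReal.ofReal F := by
          refine Filter.liminf_le_of_le (by isBoundedDefault) fun b hb => ?_
          obtain ⟨n, hn⟩ := hb.exists
          refine hn.trans ?_
          rw [← h1]
          exact (hu n).2
  have hae := h.ae_le hs hQm hQ hE h.1 hE
  have hiU : Integrable (fun x => (potential s μ x).toReal) μ :=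
    integrable_toReal_of_lintegral_ne_top hm.aemeasurable hE
  have hint : ∫ x, ((potential s μ x).toReal + Q x) ∂μ = F := by
    rw [integral_add hiU (hQ μ h.1), integral_toReal hm.aemeasurable
      (hae.mono fun x hx => hx.1.lt_top), ← energy_eq]
  -- The weighted potential is at least F and has μ-mean F, so it equals F almost everywhere. Hence
  -- the closed set B has full measure and contains the support.
  have heq := (integral_eq_iff_of_ae_le (integrable_const F) (hiU.add (hQ μ h.1))
    (hae.mono fun x hx => hx.2)).1 (by
      refine Eq.trans ?_ hint.symm
      simp)
  have hBae : B ∈ ae μ := by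
    filter_upwards [hae, heq, ae_mem_unitSphere h.1.2] with y hy1 hy2 hy3
    refine ⟨hy3, ?_⟩
    have hy2' : F = (potential s μ y).toReal + Q y := hy2
    rw [hy2', ENNReal.ofReal_add ENNReal.toReal_nonneg (hQ0 y), ENNReal.ofReal_toReal hy1.1]
  have hxB := (Measure.support_subset_of_isClosed hBc hBae hx).2
  have h3 := ENNReal.toReal_mono ENNReal.ofReal_ne_top hxB
  have h4 : potential s μ x ≠ ∞ := ne_top_of_le_ne_top ENNReal.ofReal_ne_top
    (le_self_add.trans hxB)
  rwa [ENNReal.toReal_add h4 ENNReal.ofReal_ne_top, ENNReal.toReal_ofReal (hQ0 x),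
    ENNReal.toReal_ofReal hF0] at h3

end Extremal

/-! ### Extremal measures and signed equilibria for an interior point charge -/

section PointCharge

variable {d : ℕ} {s q R : ℝ}

lemma field_nonneg (hq : 0 < q) (x : Space (d + 1)) : 0 ≤ field d s q R x := by
  unfold field; positivity

lemma measurable_field : Measurable (field d s q R) := by
  unfold field; fun_prop

lemma continuousOn_field (hR : |R| < 1) : ContinuousOn (field d s q R) (unitSphere d) := by
  intro x hx
  have h := norm_sub_source_pos (mem_unitSphere.1 hx) hR
  refine ContinuousAt.continuousWithinAt ?_
  unfold field
  refine continuousAt_const.div (ContinuousAt.rpow_const (by fun_prop) (Or.inl h.ne')) ?_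
  positivity

lemma integrable_field (hs : 0 < s) (hq : 0 < q) (hR : |R| < 1) {μ : Measure (Space (d + 1))}
    (hμ : μ ∈ unitMeasures (unitSphere d)) : Integrable (field d s q R) μ := by
  have := hμ.1
  refine Integrable.of_bound measurable_field.aestronglyMeasurable (q * (1 - |R|) ^ (-s)) ?_
  filter_upwards [ae_mem_unitSphere hμ.2] with x hx
  rw [Real.norm_eq_abs, abs_of_nonneg (field_nonneg hq x), field_eq]
  have := norm_sub_source_rpow_le hs.le (mem_unitSphere.1 hx) hR
  gcongr

lemma infDist_source (hR : R ∈ Ico (0 : ℝ) 1) :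
    Metric.infDist (source d R) (unitSphere d) = 1 - R := by
  have hn : ‖source d 1‖ = 1 := by rw [norm_source, abs_one]
  apply le_antisymm
  · refine (Metric.infDist_le_dist_of_mem (mem_unitSphere.2 hn)).trans ?_
    rw [dist_comm, dist_eq_norm]
    have := dist_source_sq hn R
    rw [sub_self, norm_zero] at this
    refine le_of_sq_le_sq ?_ (by linarith [hR.2])
    rw [this]; simp
  · refine (Metric.le_infDist ⟨_, mem_unitSphere.2 hn⟩).2 fun y hy => ?_
    have := one_sub_le_norm_sub_source (mem_unitSphere.1 hy) R
    rwa [abs_of_nonneg hR.1, ← dist_eq_norm, dist_comm] at this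

lemma sigma_mem_unitMeasures : sigma d ∈ unitMeasures (unitSphere d) :=
  ⟨inferInstance, sigma_compl⟩

lemma energy_sigma : energy s (sigma d) = sphereEnergy d s := by
  have := lintegral_potential_sigma (s := s) (sigma_compl (d := d))
  rwa [measure_univ, mul_one] at this

/-- Subcritical point charges: the signed equilibrium is an extremal measure of full support. -/
lemma isExtremal_equilibrium (hs : 0 < s) (hsd : s < d) (hq : 0 < q)
    (hR : R ∈ Ico (0 : ℝ) 1) (h : threshold d s R ≤ (sphereEnergy d s).toReal / q) :
    IsExtremal s (unitSphere d) (field d s q R) (equilibrium d s q R) := by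
  have hR1 := abs_lt_one_of_mem_Ico hR
  have hM := sigmaMass_pos (d := d) (R := R) hs hsd hq
  have hadd := equilibrium_add_balayage hs hsd hq hR h
  have hWt := sphereEnergy_ne_top hs hsd
  have hfb := isFiniteMeasure_balayage hs hsd hR1
  have hle : equilibrium d s q R ≤ ENNReal.ofReal (sigmaMass d s q R) • sigma d := by
    rw [← hadd]; exact Measure.le_add_right le_rfl
  have hpot : ∀ x ∈ unitSphere d, potential s (equilibrium d s q R) x ≤
      ENNReal.ofReal (sigmaMass d s q R) * sphereEnergy d s := by
    intro x hx
    refine (potential_mono hle x).trans ?_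
    rw [potential_smul, potential_sigma hx]
  have hMW : ENNReal.ofReal (sigmaMass d s q R) * sphereEnergy d s ≠ ∞ :=
    ENNReal.mul_ne_top ENNReal.ofReal_ne_top hWt
  have hfin : IsFiniteMeasure (equilibrium d s q R) := by
    refine ⟨(hle univ).trans_lt ?_⟩
    rw [Measure.smul_apply, measure_univ, smul_eq_mul, mul_one]
    exact ENNReal.ofReal_lt_top
  have hmass : (equilibrium d s q R).real univ = 1 := by
    have h1 : (equilibrium d s q R + ENNReal.ofReal q • balayage d s R).real univ =
        (ENNReal.ofReal (sigmaMass d s q R) • sigma d).real univ := by rw [hadd]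
    have hsm : IsFiniteMeasure (ENNReal.ofReal q • balayage d s R) :=
      Measure.smul_finite _ ENNReal.ofReal_ne_top
    rw [measureReal_add_apply, measureReal_ennreal_smul_apply, measureReal_ennreal_smul_apply,
      probReal_univ (μ := sigma d), balayage_real_univ hs hsd hR1, ENNReal.toReal_ofReal hM.le,
      ENNReal.toReal_ofReal hq.le, sigmaMass, mul_one] at h1
    have h2 := mul_div_assoc q (radialPotential d s R) (sphereEnergy d s).toReal
    linarith
  have hmem : equilibrium d s q R ∈ unitMeasures (unitSphere d) := by
    refine ⟨⟨?_⟩, equilibrium_compl q⟩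
    rwa [measureReal_def, ENNReal.toReal_eq_one_iff] at hmass
  have hpf : ∀ x ∈ unitSphere d, potential s (equilibrium d s q R) x ≠ ∞ := fun x hx =>
    ne_top_of_le_ne_top hMW (hpot x hx)
  refine isExtremal_of_potential_eq hs hmem (fun μ hμ => integrable_field hs hq hR1 hμ) hpf ?_
    (G := sigmaMass d s q R * (sphereEnergy d s).toReal) fun x hx => ?_
  · refine ne_top_of_le_ne_top (b := ∫⁻ _, ENNReal.ofReal (sigmaMass d s q R) * sphereEnergy d s
      ∂equilibrium d s q R) ?_ ?_
    · rw [lintegral_const]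
      exact ENNReal.mul_ne_top hMW (measure_ne_top _ _)
    · exact lintegral_mono_ae ((ae_mem_unitSphere (equilibrium_compl q)).mono hpot)
  · have h1 := congrArg (fun ρ => (potential s ρ x).toReal) hadd
    simp only [potential_add, potential_smul] at h1
    rw [potential_sigma hx, potential_balayage hs hsd hR1 hx, ENNReal.toReal_add (hpf x hx)
      (ENNReal.mul_ne_top ENNReal.ofReal_ne_top ENNReal.ofReal_ne_top), ENNReal.toReal_mul,
      ENNReal.toReal_mul, ENNReal.toReal_ofReal hM.le, ENNReal.toReal_ofReal hq.le,
      ENNReal.toReal_ofReal (by positivity)] at h1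
    rw [field_eq, h1]

/-- If an extremal measure has full support, then the point charge is subcritical. -/
lemma threshold_le_of_isExtremal (hs : 0 < s) (hsd : s < d) (hq : 0 < q)
    (hR : R ∈ Ico (0 : ℝ) 1) {μ : Measure (Space (d + 1))}
    (h : IsExtremal s (unitSphere d) (field d s q R) μ) (hsupp : μ.support = unitSphere d) :
    threshold d s R ≤ (sphereEnergy d s).toReal / q := by
  have hR1 := abs_lt_one_of_mem_Ico hR
  have := h.1.1
  have hM := sigmaMass_pos (d := d) (R := R) hs hsd hq
  have hWt := sphereEnergy_ne_top hs hsd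
  have hfb := isFiniteMeasure_balayage hs hsd hR1
  have hσE : energy s (sigma d) ≠ ∞ := by rwa [energy_sigma]
  have hE : energy s μ ≠ ∞ := by
    intro htop
    have h1 : weightedEnergy s (field d s q R) μ ≤ weightedEnergy s (field d s q R) (sigma d) := by
      rw [h.2]; exact iInf₂_le _ sigma_mem_unitMeasures
    rw [weightedEnergy_of_ne_top hσE, weightedEnergy, htop, EReal.coe_ennreal_top,
      EReal.top_add_coe, top_le_iff] at h1
    exact EReal.coe_ne_top _ h1
  have hQ : ∀ μ ∈ unitMeasures (unitSphere d), Integrable (field d s q R) μ :=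
    fun μ hμ => integrable_field hs hq hR1 hμ
  set μ₀ := ENNReal.ofReal (sigmaMass d s q R) • sigma d with hμ₀
  set ν₀ := ENNReal.ofReal q • balayage d s R with hν₀
  have hf1 : IsFiniteMeasure μ₀ := Measure.smul_finite _ ENNReal.ofReal_ne_top
  have hf2 : IsFiniteMeasure ν₀ := Measure.smul_finite _ ENNReal.ofReal_ne_top
  have hν₀S : ν₀ (unitSphere d)ᶜ = 0 := by
    rw [hν₀, Measure.smul_apply, balayage_compl, smul_zero]
  have hμ₀S : μ₀ (unitSphere d)ᶜ = 0 := by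
    rw [hμ₀, Measure.smul_apply, sigma_compl, smul_zero]
  -- Full support makes both Frostman inequalities hold σ_d-almost everywhere, so μ has constant
  -- weighted potential there. The uniqueness theorem then identifies μ with the signed equilibrium,
  -- which is therefore positive.
  have key : μ + ν₀ = μ₀ := by
    refine measure_eq_of_toReal_potential hs hsd
      (C := (energy s μ).toReal + ∫ x, field d s q R x ∂μ -
        sigmaMass d s q R * (sphereEnergy d s).toReal) ?_ hμ₀S ?_ ?_
    · rw [Measure.add_apply, h.1.2, hν₀S, add_zero]
    · rw [measureReal_add_apply, probReal_univ (μ := μ), hν₀, hμ₀, measureReal_ennreal_smul_apply,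
        measureReal_ennreal_smul_apply, probReal_univ (μ := sigma d), balayage_real_univ hs hsd hR1,
        ENNReal.toReal_ofReal hM.le, ENNReal.toReal_ofReal hq.le, sigmaMass]
      ring
    · filter_upwards [ae_mem_unitSphere (sigma_compl (d := d)),
        h.ae_le hs measurable_field hQ hE sigma_mem_unitMeasures hσE] with x hx hae
      have h1 := h.le_of_mem_support hs measurable_field hQ (field_nonneg hq)
        (continuousOn_field hR1) hE (hsupp ▸ hx)
      have h2 : potential s ν₀ x = ENNReal.ofReal (field d s q R x) := by
        rw [hν₀, potential_smul, potential_balayage hs hsd hR1 hx, field_eq,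
          ENNReal.ofReal_mul hq.le]
      have h3 : potential s μ₀ x = ENNReal.ofReal (sigmaMass d s q R) * sphereEnergy d s := by
        rw [hμ₀, potential_smul, potential_sigma hx]
      rw [potential_add, h2, h3]
      refine ⟨ENNReal.add_ne_top.2 ⟨hae.1, ENNReal.ofReal_ne_top⟩,
        ENNReal.mul_ne_top ENNReal.ofReal_ne_top hWt, ?_⟩
      rw [ENNReal.toReal_add hae.1 ENNReal.ofReal_ne_top, ENNReal.toReal_mul,
        ENNReal.toReal_ofReal hM.le, ENNReal.toReal_ofReal (field_nonneg hq x)]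
      linarith [hae.2]
  refine threshold_le_of_nonneg hs hsd hq hR hμ₀ hν₀ ?_
  have h1 : μ₀.toSignedMeasure - ν₀.toSignedMeasure = μ.toSignedMeasure := by
    rw [sub_eq_iff_eq_add, ← Measure.toSignedMeasure_add]
    exact Measure.toSignedMeasure_eq_toSignedMeasure_iff.2 key.symm
  rw [h1]
  exact Measure.zero_le_toSignedMeasure μ

/-- Existence and uniqueness of the signed equilibrium, and when it is positive. -/
lemma exists_isSignedEquilibrium (hs : 0 < s) (hsd : s < d) (hq : 0 < q)
    (hR : R ∈ Ico (0 : ℝ) 1) :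
    ∃ η : SignedMeasure (Space (d + 1)),
      IsSignedEquilibrium s (unitSphere d) (field d s q R) η ∧
      (∀ η', IsSignedEquilibrium s (unitSphere d) (field d s q R) η' → η' = η) ∧
      (0 ≤ η ↔ threshold d s R ≤ (sphereEnergy d s).toReal / q) ∧
      (threshold d s R ≤ (sphereEnergy d s).toReal / q →
        η.totalVariation.support = unitSphere d) := by
  have hR1 := abs_lt_one_of_mem_Ico hR
  have hfb := isFiniteMeasure_balayage hs hsd hR1
  set μ₀ := ENNReal.ofReal (sigmaMass d s q R) • sigma d with hμ₀
  set ν₀ := ENNReal.ofReal q • balayage d s R with hν₀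
  have hf1 : IsFiniteMeasure μ₀ := Measure.smul_finite _ ENNReal.ofReal_ne_top
  have hf2 : IsFiniteMeasure ν₀ := Measure.smul_finite _ ENNReal.ofReal_ne_top
  have hη := isSignedEquilibrium_balayage hs hsd hq hR1 hμ₀ hν₀
  have hpos : threshold d s R ≤ (sphereEnergy d s).toReal / q →
      ∃ _ : IsFiniteMeasure (equilibrium d s q R), μ₀.toSignedMeasure - ν₀.toSignedMeasure =
        (equilibrium d s q R).toSignedMeasure := by
    intro h
    have := (isExtremal_equilibrium hs hsd hq hR h).1.1
    refine ⟨inferInstance, ?_⟩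
    rw [sub_eq_iff_eq_add, ← Measure.toSignedMeasure_add]
    exact Measure.toSignedMeasure_eq_toSignedMeasure_iff.2
      (equilibrium_add_balayage hs hsd hq hR h).symm
  refine ⟨_, hη, fun η' hη' => hη.eq hs hsd hη', ⟨fun h =>
    threshold_le_of_nonneg hs hsd hq hR hμ₀ hν₀ h, fun h => ?_⟩, fun h => ?_⟩
  · obtain ⟨_, h1⟩ := hpos h
    rw [h1]
    exact Measure.zero_le_toSignedMeasure _
  · obtain ⟨_, h1⟩ := hpos h
    rw [h1, totalVariation_toSignedMeasure, equilibrium_support hs hsd hq hR h]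

lemma mem_goncharDistances_iff (hs : 0 < s) (hsd : s < d) (hq : 0 < q) {δ : ℝ} :
    δ ∈ goncharDistances d s q ↔ ∃ R ∈ Ico (0 : ℝ) 1, δ = 1 - R ∧
      threshold d s R ≤ (sphereEnergy d s).toReal / q := by
  constructor
  · rintro ⟨R, hR, hδ, μ, hμ, hsupp⟩
    exact ⟨R, hR, by rw [hδ, infDist_source hR],
      threshold_le_of_isExtremal hs hsd hq hR hμ hsupp⟩
  · rintro ⟨R, hR, hδ, h⟩
    exact ⟨R, hR, by rw [hδ, infDist_source hR], _,
      isExtremal_equilibrium hs hsd hq hR h, equilibrium_support hs hsd hq hR h⟩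

end PointCharge

end Riesz

theorem mainTheorem4 (d : ℕ) (s q : ℝ) (hs : 0 < s) (hsd : s < d) (hq : 0 < q) :
    -- for `s = d - 1 - 2 m` the Gonchar function is a polynomial
    (∀ m : ℕ, s = (d : ℝ) - 1 - 2 * m →
      ∃ P : Polynomial ℝ, ∀ R ∈ Set.Ico (0 : ℝ) 1, Riesz.goncharB d s q R = P.eval R) ∧
    -- the unique zero `Rq` in `(0, 1)`
    ∃ Rq ∈ Set.Ioo (0 : ℝ) 1, Riesz.goncharB d s q Rq = 0 ∧
      (∀ R ∈ Set.Ioo (0 : ℝ) 1, Riesz.goncharB d s q R = 0 → R = Rq) ∧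
      -- the signed equilibrium exists, is unique, and is positive on all of the sphere
      -- exactly for `R ≤ Rq`
      (∀ R ∈ Set.Ico (0 : ℝ) 1, ∃ η : MeasureTheory.SignedMeasure (Riesz.Space (d + 1)),
        Riesz.IsSignedEquilibrium s (Riesz.unitSphere d) (Riesz.field d s q R) η ∧
        (∀ η', Riesz.IsSignedEquilibrium s (Riesz.unitSphere d) (Riesz.field d s q R) η' →
          η' = η) ∧
        (0 ≤ η ↔ R ≤ Rq) ∧
        (R ≤ Rq → η.totalVariation.support = Riesz.unitSphere d)) ∧
      -- the critical distance, and the trivial one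
      IsLeast (Riesz.goncharDistances d s q) (1 - Rq) ∧
      1 ∈ Riesz.goncharDistances d s q := by
  refine ⟨fun m hm => Riesz.goncharB_eq_polynomial hs hsd q m hm, ?_⟩
  have hW := Riesz.sphereEnergy_toReal_pos hs hsd
  obtain ⟨Rq, hRq, hth⟩ := Riesz.exists_threshold_eq hs hsd
    (show 0 < (Riesz.sphereEnergy d s).toReal / q by positivity)
  have hmono := Riesz.strictMonoOn_threshold hs hsd
  have hRq' : Rq ∈ Ico (0 : ℝ) 1 := ⟨hRq.1.le, hRq.2⟩
  -- Every remaining claim has been reduced to the inequality θ(R) ≤ W/q; strict monotonicity of θ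
  -- turns it into R ≤ Rq.
  have hiff : ∀ R ∈ Ico (0 : ℝ) 1,
      (Riesz.threshold d s R ≤ (Riesz.sphereEnergy d s).toReal / q ↔ R ≤ Rq) := by
    intro R hR
    rw [← hth]
    exact hmono.le_iff_le hR hRq'
  refine ⟨Rq, hRq, ?_, ?_, ?_, ⟨?_, ?_⟩, ?_⟩
  · rw [Riesz.goncharB_eq hs hsd q hRq', hth, sub_self, mul_zero]
  · intro R hR h
    have hR' : R ∈ Ico (0 : ℝ) 1 := ⟨hR.1.le, hR.2⟩
    rw [Riesz.goncharB_eq hs hsd q hR', mul_eq_zero] at h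
    rcases h with h | h
    · exact absurd h (pow_ne_zero _ (by linarith [hR.2]))
    · refine hmono.injOn hR' hRq' ?_
      rw [hth]; linarith
  · intro R hR
    rw [← hiff R hR]
    exact Riesz.exists_isSignedEquilibrium hs hsd hq hR
  · exact (Riesz.mem_goncharDistances_iff hs hsd hq).2 ⟨Rq, hRq', rfl, hth.le⟩
  · intro δ hδ
    obtain ⟨R, hR, rfl, h⟩ := (Riesz.mem_goncharDistances_iff hs hsd hq).1 hδ
    rw [hiff R hR] at h
    linarith
  · refine (Riesz.mem_goncharDistances_iff hs hsd hq).2 ⟨0, ⟨le_rfl, one_pos⟩, by ring, ?_⟩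
    rw [Riesz.threshold_zero]
    positivity
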